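/- A graph $G$ is a \emph{split graph} if its vertex set can be partitioned into a clique and an independent set (either may be empty). A graph $G$ is a \emph{threshold graph} if there are $t\in\mathbb{R}$ and $f\colon V(G)\to\mathbb{R}$ such that any two distinct vertices $u,v$ are adjacent if and only if $f(u)+f(v)\ge t$. In the problem \textsc{Split to Threshold Vertex Deletion} the input is a finite split graph $G$ and an integer $k\ge 0$, and the question is whether there is a set $S\subseteq V(G)$ with $|S|\le k$ such that $G-S$ is a threshold graph. \textbf{Theorem.} \textsc{Split to Threshold Vertex Deletion} can be solved in $O^*(2.733^k)$ time. That is, there are a deterministic algorithm and a polynomial $p$ such that, for every split graph $G$ on $n$ vertices (given by its adjacency matrix, without a split partition) and every integer $k\ge 0$, the algorithm halts after at most $2.733^k\cdot p(n)$ steps and correctly decides whether $(G,k)$ is a yes-instance. Here a step is one instruction of a random access machine with registers and arrays of natural numbers whose instructions are: setting a register to a constant, copying a register, adding or subtracting one, indirect array reads and writes, and comparisons of two registers that control branching and loops. -/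

import Mathlib

namespace STVD

/-! ### Graphs -/

/-- A split graph: the vertex set is partitioned into a clique `C` and an independent set `I`
(either of which may be empty). -/
def IsSplit {V : Type*} (G : SimpleGraph V) : Prop :=
  ∃ C I : Set V, Disjoint C I ∧ C ∪ I = Set.univ ∧ G.IsClique C ∧ G.IsIndepSet I

/-- A threshold graph: for some real `t` and some real vertex weights `f`, two distinct vertices
are adjacent exactly when the sum of their weights is at least `t`. -/
def IsThreshold {V : Type*} (G : SimpleGraph V) : Prop :=
  ∃ (t : ℝ) (f : V → ℝ), ∀ u v : V, u ≠ v → (G.Adj u v ↔ t ≤ f u + f v)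

/-- `(G, k)` is a yes-instance: deleting some set `S` of at most `k` vertices from `G` leaves a
threshold graph. -/
def IsYesInstance {V : Type*} (G : SimpleGraph V) (k : ℕ) : Prop :=
  ∃ S : Finset V, S.card ≤ k ∧ IsThreshold (G.induce {v : V | v ∉ S})

/-! ### The machine model

A random access machine in structured form. It has registers and arrays (a program mentions only
finitely many of each), all holding natural numbers, and indirect addressing into the arrays. The
only arithmetic is adding or subtracting one, so that after `t` steps no number exceeds the largest
number of the input and of the program text by more than `t`: charging one unit per instruction
hides no computation on long numbers. -/

/-- The contents of the registers, and of the cells of the arrays. -/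
structure State where
  reg : ℕ → ℕ
  arr : ℕ → ℕ → ℕ

/-- Tests that compare two registers. -/
inductive Test where
  | eq (x y : ℕ)
  | lt (x y : ℕ)

def Test.Holds : Test → State → Prop
  | .eq x y, σ => σ.reg x = σ.reg y
  | .lt x y, σ => σ.reg x < σ.reg y

/-- Programs. Registers and arrays are named by natural numbers. -/
inductive Prog where
  /-- do nothing -/
  | skip
  /-- set register `x` to the number `c` -/
  | const (x c : ℕ)
  /-- copy register `y` into register `x` -/
  | copy (x y : ℕ)
  /-- add one to register `x` -/
  | inc (x : ℕ)
  /-- subtract one from register `x` (zero stays zero) -/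
  | dec (x : ℕ)
  /-- copy into register `x` the cell of array `a` whose index is in register `i` -/
  | load (x a i : ℕ)
  /-- copy register `x` into the cell of array `a` whose index is in register `i` -/
  | store (a i x : ℕ)
  /-- first `p`, then `q` -/
  | seq (p q : Prog)
  /-- if `b` then `p` else `q` -/
  | ite (b : Test) (p q : Prog)
  /-- while `b` do `p` -/
  | loop (b : Test) (p : Prog)

def State.setReg (σ : State) (x v : ℕ) : State :=
  { σ with reg := Function.update σ.reg x v }

def State.setArr (σ : State) (a i v : ℕ) : State :=
  { σ with arr := Function.update σ.arr a (Function.update (σ.arr a) i v) }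

/-- `Exec p σ t τ`: started in the state `σ`, the program `p` halts after exactly `t` steps in the
state `τ`. Every elementary instruction and every evaluation of a test is one step. -/
inductive Exec : Prog → State → ℕ → State → Prop where
  | skip (σ : State) : Exec .skip σ 1 σ
  | const (σ : State) (x c : ℕ) : Exec (.const x c) σ 1 (σ.setReg x c)
  | copy (σ : State) (x y : ℕ) : Exec (.copy x y) σ 1 (σ.setReg x (σ.reg y))
  | inc (σ : State) (x : ℕ) : Exec (.inc x) σ 1 (σ.setReg x (σ.reg x + 1))
  | dec (σ : State) (x : ℕ) : Exec (.dec x) σ 1 (σ.setReg x (σ.reg x - 1))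
  | load (σ : State) (x a i : ℕ) :
      Exec (.load x a i) σ 1 (σ.setReg x (σ.arr a (σ.reg i)))
  | store (σ : State) (a i x : ℕ) :
      Exec (.store a i x) σ 1 (σ.setArr a (σ.reg i) (σ.reg x))
  | seq {p q : Prog} {σ τ υ : State} {s t : ℕ} :
      Exec p σ s τ → Exec q τ t υ → Exec (.seq p q) σ (s + t) υ
  | iteTrue {b : Test} {p q : Prog} {σ τ : State} {t : ℕ} :
      b.Holds σ → Exec p σ t τ → Exec (.ite b p q) σ (t + 1) τ
  | iteFalse {b : Test} {p q : Prog} {σ τ : State} {t : ℕ} :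
      ¬ b.Holds σ → Exec q σ t τ → Exec (.ite b p q) σ (t + 1) τ
  | loopDone {b : Test} {p : Prog} {σ : State} :
      ¬ b.Holds σ → Exec (.loop b p) σ 1 σ
  | loopStep {b : Test} {p : Prog} {σ τ υ : State} {s t : ℕ} :
      b.Holds σ → Exec p σ s τ → Exec (.loop b p) τ t υ → Exec (.loop b p) σ (s + t + 1) υ

/-- The machine is deterministic: running time and final state are determined by the program and
the initial state. -/
theorem Exec.deterministic {p : Prog} {σ τ : State} {t : ℕ} (h : Exec p σ t τ) :
    ∀ {t' : ℕ} {τ' : State}, Exec p σ t' τ' → t = t' ∧ τ = τ' := by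
  induction h with
  | seq _ _ ih₁ ih₂ =>
    intro t' τ' h'
    cases h' with
    | seq h₁ h₂ =>
      obtain ⟨rfl, rfl⟩ := ih₁ h₁
      obtain ⟨rfl, rfl⟩ := ih₂ h₂
      exact ⟨rfl, rfl⟩
  | iteTrue hb _ ih =>
    intro t' τ' h'
    cases h' with
    | iteTrue _ h₁ => obtain ⟨rfl, rfl⟩ := ih h₁; exact ⟨rfl, rfl⟩
    | iteFalse hb' _ => exact absurd hb hb'
  | iteFalse hb _ ih =>
    intro t' τ' h'
    cases h' with
    | iteTrue hb' _ => exact absurd hb' hb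
    | iteFalse _ h₁ => obtain ⟨rfl, rfl⟩ := ih h₁; exact ⟨rfl, rfl⟩
  | loopDone hb =>
    intro t' τ' h'
    cases h' with
    | loopDone _ => exact ⟨rfl, rfl⟩
    | loopStep hb' _ _ => exact absurd hb' hb
  | loopStep hb _ _ ih₁ ih₂ =>
    intro t' τ' h'
    cases h' with
    | loopDone hb' => exact absurd hb hb'
    | loopStep _ h₁ h₂ =>
      obtain ⟨rfl, rfl⟩ := ih₁ h₁
      obtain ⟨rfl, rfl⟩ := ih₂ h₂
      exact ⟨rfl, rfl⟩
  | _ =>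
    intro t' τ' h'
    cases h'
    exact ⟨rfl, rfl⟩

/-! ### Solving the problem on the machine -/

open Classical in
/-- The initial state on the instance `(G, k)`, where `G` has the vertices `0, …, n - 1`:
register `0` holds `n`, register `1` holds `k`, array `0` holds the adjacency matrix of `G` row by
row, and all else is zero. -/
noncomputable def initState {n : ℕ} (G : SimpleGraph (Fin n)) (k : ℕ) : State where
  reg x := if x = 0 then n else if x = 1 then k else 0
  arr a i := if a = 0 ∧ ∃ u v : Fin n, (u : ℕ) * n + (v : ℕ) = i ∧ G.Adj u v then 1 else 0

/-- `p` solves Split to Threshold Vertex Deletion within time `T`: on every split graph `G` with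
`n` vertices and every `k`, it halts after at most `T n k` steps, and then register `0` holds `1` if
`(G, k)` is a yes-instance, and `0` if it is not. -/
def SolvesInTime (p : Prog) (T : ℕ → ℕ → ℝ) : Prop :=
  ∀ (n : ℕ) (G : SimpleGraph (Fin n)) (k : ℕ), IsSplit G →
    ∃ (t : ℕ) (τ : State), Exec p (initState G k) t τ ∧ (t : ℝ) ≤ T n k ∧
      (IsYesInstance G k → τ.reg 0 = 1) ∧ (¬ IsYesInstance G k → τ.reg 0 = 0)

/-- Split to Threshold Vertex Deletion can be solved in `O*(c ^ k)` time: by one program, within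
`c ^ k` times a polynomial in the number of vertices. -/
def SolvableInOStar (c : ℝ) : Prop :=
  ∃ (p : Prog) (P : Polynomial ℕ), SolvesInTime p fun n k => c ^ k * (P.eval n : ℕ)

end STVD

namespace STVD

/-! ### Reasoning about programs -/

/-! A split graph is a threshold graph exactly when it has no induced path on four vertices, and
such a path has its inner vertices in the clique and its ends in the independent set of any split
partition. So inner vertices and ends of induced paths form two disjoint types that can be read off
without a partition. Direct edges between the types towards the ends and non-edges towards the inner
vertices: the result is a bipartite tournament, in which an induced path `a c d b` is the directed
cycle `c → a → d → b → c`. The question becomes whether at most `k` vertices meet all directed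
cycles of length four (`isYesInstance_iff`).

This is decided by iterative compression. Vertices are admitted one at a time, and a set of at most
`k` vertices that meets all cycles so far is maintained. Together with the new vertex it has at most
`k + 1` elements. For each of its at most `2 ^ (k + 1)` subsets, taken as the part to delete, let
`K` be the part that stays and `R` the typed admitted vertices outside the old set. Then `R` is
acyclic, and it remains to find out whether enough elements of `R` can be added to an acyclic `K`
without creating a cycle.

That last question is polynomial (`iterate_step_iff`). If `K ∪ T` is acyclic with `T ⊆ R`, then `T`
has a linear order: elements of different types are ordered by their arc, elements of the same type
by their in-neighbours in `K`, then in `R`, then by number (`prec_trans`). Building `T` along this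
order, a dynamic program needs to remember four elements only: for each type, the last one and the
one with the most in-neighbours in `R`. `CanAdd.acyc` shows that its tests suffice, `canAdd_last`
that they are necessary. Dropping superfluous elements one by one turns the decision into an actual
set.

On the machine, the algorithm is a sequence of first-order updates of relations of arity at most
four on `{0, …, n}`. Formulas and bounded iteration compile to polynomial time (`Fm.compile_runs`,
`Cmd.compile_runs`). The only exponential construct is the loop over subsets; it contributes `(k +
1) * 2 ^ (k + 1)`, well below `2.733 ^ k` up to a constant (`expFactor_le`). -/

@[simp] theorem State.setReg_reg (σ : State) (x v y : ℕ) :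
    (σ.setReg x v).reg y = if y = x then v else σ.reg y := by
  simp [State.setReg, Function.update_apply]

@[simp] theorem State.setReg_arr (σ : State) (x v : ℕ) : (σ.setReg x v).arr = σ.arr := rfl

@[simp] theorem State.setArr_reg (σ : State) (a i v : ℕ) : (σ.setArr a i v).reg = σ.reg := rfl

@[simp] theorem State.setArr_arr (σ : State) (a i v b j : ℕ) :
    (σ.setArr a i v).arr b j = if b = a ∧ j = i then v else σ.arr b j := by
  by_cases h : b = a
  · subst h; simp [State.setArr, Function.update_apply]
  · simp [State.setArr, h]

/-- Started in `σ`, the program `p` halts within `T` steps in a state that satisfies `Post`. -/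
def Runs (p : Prog) (σ : State) (T : ℕ) (Post : State → Prop) : Prop :=
  ∃ t τ, Exec p σ t τ ∧ t ≤ T ∧ Post τ

theorem Runs.mono {p : Prog} {σ : State} {T T' : ℕ} {Q Q' : State → Prop} (h : Runs p σ T Q)
    (hT : T ≤ T') (hQ : ∀ τ, Q τ → Q' τ) : Runs p σ T' Q' := by
  obtain ⟨t, τ, h1, h2, h3⟩ := h
  exact ⟨t, τ, h1, h2.trans hT, hQ _ h3⟩

theorem Runs.seq {p q : Prog} {σ : State} {T₁ T₂ : ℕ} {Q : State → Prop}
    (h : Runs p σ T₁ fun τ => Runs q τ T₂ Q) : Runs (.seq p q) σ (T₁ + T₂) Q := by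
  obtain ⟨t, τ, h1, h2, t', υ, h3, h4, h5⟩ := h
  exact ⟨_, _, .seq h1 h3, by omega, h5⟩

theorem Runs.skip {σ : State} {Q : State → Prop} (h : Q σ) : Runs .skip σ 1 Q :=
  ⟨_, _, .skip σ, le_rfl, h⟩

theorem Runs.const {σ : State} {x c : ℕ} {Q : State → Prop} (h : Q (σ.setReg x c)) :
    Runs (.const x c) σ 1 Q := ⟨_, _, .const σ x c, le_rfl, h⟩

theorem Runs.copy {σ : State} {x y : ℕ} {Q : State → Prop} (h : Q (σ.setReg x (σ.reg y))) :
    Runs (.copy x y) σ 1 Q := ⟨_, _, .copy σ x y, le_rfl, h⟩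

theorem Runs.inc {σ : State} {x : ℕ} {Q : State → Prop} (h : Q (σ.setReg x (σ.reg x + 1))) :
    Runs (.inc x) σ 1 Q := ⟨_, _, .inc σ x, le_rfl, h⟩

theorem Runs.load {σ : State} {x a i : ℕ} {Q : State → Prop}
    (h : Q (σ.setReg x (σ.arr a (σ.reg i)))) : Runs (.load x a i) σ 1 Q :=
  ⟨_, _, .load σ x a i, le_rfl, h⟩

theorem Runs.store {σ : State} {a i x : ℕ} {Q : State → Prop}
    (h : Q (σ.setArr a (σ.reg i) (σ.reg x))) : Runs (.store a i x) σ 1 Q :=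
  ⟨_, _, .store σ a i x, le_rfl, h⟩

theorem Runs.ite {b : Test} {p q : Prog} {σ : State} {T : ℕ} {Q : State → Prop}
    (h₁ : b.Holds σ → Runs p σ T Q) (h₂ : ¬ b.Holds σ → Runs q σ T Q) :
    Runs (.ite b p q) σ (T + 1) Q := by
  by_cases hb : b.Holds σ
  · obtain ⟨t, τ, h1, h2, h3⟩ := h₁ hb
    exact ⟨_, _, .iteTrue hb h1, by omega, h3⟩
  · obtain ⟨t, τ, h1, h2, h3⟩ := h₂ hb
    exact ⟨_, _, .iteFalse hb h1, by omega, h3⟩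

/-- The invariant carries the number of finished iterations, and the exact number `B` of iterations
is known beforehand. So one induction on the iterations that remain gives termination, the final
state and the time bound together. -/
theorem Runs.loop {b : Test} {p : Prog} {T : ℕ} (I : ℕ → State → Prop) (B : ℕ)
    (hstep : ∀ i σ, i < B → I i σ → b.Holds σ ∧ Runs p σ T (I (i + 1)))
    (hend : ∀ σ, I B σ → ¬ b.Holds σ) {σ : State} (h0 : I 0 σ) :
    Runs (.loop b p) σ (B * (T + 1) + 1) (I B) := by
  have key : ∀ m i, i + m = B → ∀ σ, I i σ → Runs (.loop b p) σ (m * (T + 1) + 1) (I B) := by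
    intro m
    induction m with
    | zero =>
      intro i hi σ hσ
      obtain rfl : i = B := by omega
      exact ⟨1, σ, .loopDone (hend σ hσ), by omega, hσ⟩
    | succ m ih =>
      intro i hi σ hσ
      obtain ⟨hb, t, τ, h1, h2, h3⟩ := hstep i σ (by omega) hσ
      obtain ⟨t', υ, h4, h5, h6⟩ := ih (i + 1) (by omega) τ h3
      exact ⟨_, _, .loopStep hb h1 h4, by rw [Nat.succ_mul]; omega, h6⟩
  exact key B 0 (by omega) σ h0

/-! ### Addresses of tuples -/

/-- The number with the digits `l` in base `b`, most significant digit first. -/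
def address (b : ℕ) (l : List ℕ) : ℕ := l.foldl (fun acc x => acc * b + x) 0

/-- The accumulators are arbitrary because the recursion consumes the leading digit: the tails yield
equality of the accumulators `s * b + x`, and division with remainder by `b` separates `s` from `x`.
-/
theorem address_foldl_inj {b : ℕ} : ∀ {l l' : List ℕ} {s s' : ℕ}, l.length = l'.length →
    (∀ x ∈ l, x < b) → (∀ x ∈ l', x < b) →
    l.foldl (fun acc x => acc * b + x) s = l'.foldl (fun acc x => acc * b + x) s' →
    s = s' ∧ l = l'
  | [], [], _, _, _, _, _, h => ⟨h, rfl⟩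
  | x :: l, y :: l', s, s', hl, h1, h2, h => by
    obtain ⟨h3, h4⟩ := address_foldl_inj (l := l) (l' := l') (by simpa using hl)
      (fun z hz => h1 z (by simp [hz])) (fun z hz => h2 z (by simp [hz])) h
    have hx := h1 x (by simp)
    have hy := h2 y (by simp)
    have hb : 0 < b := by omega
    have e1 : (s * b + x) / b = s := by
      rw [mul_comm, Nat.mul_add_div hb, Nat.div_eq_of_lt hx, add_zero]
    have e2 : (s' * b + y) / b = s' := by
      rw [mul_comm, Nat.mul_add_div hb, Nat.div_eq_of_lt hy, add_zero]
    have h3 : s * b + x = s' * b + y := h3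
    obtain rfl : s = s' := by rw [← e1, ← e2, h3]
    exact ⟨rfl, by rw [h4, show x = y by omega]⟩

theorem address_inj {b : ℕ} {l l' : List ℕ} (hl : l.length = l'.length) (h1 : ∀ x ∈ l, x < b)
    (h2 : ∀ x ∈ l', x < b) (h : address b l = address b l') : l = l' :=
  (address_foldl_inj hl h1 h2 h).2

/-! ### A language of first-order updates -/

/-- Formulas about relations on `{0, …, n}`; the relation with the name `a` has arity `a % 5`. -/
inductive Fm where
  | lt (x y : ℕ)
  | ltn (x : ℕ)
  | ltk (x : ℕ)
  | adj (x y : ℕ)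
  | rel (a : ℕ) (xs : List ℕ)
  | neg (φ : Fm)
  | and (φ ψ : Fm)
  | all (x : ℕ) (φ : Fm)

/-- The data that do not change during a computation: the number of vertices, the budget, and the
cells of the given adjacency matrix. -/
structure Ctx where
  n : ℕ
  k : ℕ
  cell : ℕ → Prop

abbrev Rels := ℕ → List ℕ → Prop

/-- The domain has the extra element `n`, which is no vertex and later marks a missing element. An
atom `adj` reads the cell at an address in base `n`, which is meaningful only for arguments below
`n`; formulas have to guard it with `ltn`. -/
def Fm.ev (c : Ctx) (A : Rels) : Fm → (ℕ → ℕ) → Prop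
  | .lt x y, v => v x < v y
  | .ltn x, v => v x < c.n
  | .ltk x, v => v x < c.k
  | .adj x y, v => c.cell (v x * c.n + v y)
  | .rel a xs, v => xs.length = a % 5 ∧ A a (xs.map v)
  | .neg φ, v => ¬ φ.ev c A v
  | .and φ ψ, v => φ.ev c A v ∧ ψ.ev c A v
  | .all x φ, v => ∀ i < c.n + 1, φ.ev c A (Function.update v x i)

/-- The values `l` for the variables `xs`, and `0` for all others. -/
def assign : (ℕ → ℕ) → List ℕ → List ℕ → ℕ → ℕ
  | v, x :: xs, i :: l => assign (Function.update v x i) xs l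
  | v, _, _ => v

/-- Commands: simultaneous update of a relation, and control structures, of which `iter` repeats
`n + 1` times and `rept` repeats `2 ^ (k + 1)` times. -/
inductive Cmd where
  | skip
  | upd (a : ℕ) (xs : List ℕ) (φ : Fm)
  | seq (p q : Cmd)
  | ite (φ : Fm) (p q : Cmd)
  | iter (p : Cmd)
  | rept (p : Cmd)

open Classical in
noncomputable def Cmd.sem (c : Ctx) : Cmd → Rels → Rels
  | .skip, A => A
  | .upd a xs φ, A =>
    if xs.Nodup ∧ xs.length = a % 5 then
      Function.update A a fun l => φ.ev c A (assign (fun _ => 0) xs l) else A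
  | .seq p q, A => q.sem c (p.sem c A)
  | .ite φ p q, A => if φ.ev c A (fun _ => 0) then p.sem c A else q.sem c A
  | .iter p, A => (p.sem c)^[c.n + 1] A
  | .rept p, A => (p.sem c)^[2 ^ (c.k + 1)] A

/-- The nesting depth of `rept`. -/
def Cmd.depth : Cmd → ℕ
  | .skip => 0
  | .upd _ _ _ => 0
  | .seq p q => max p.depth q.depth
  | .ite _ p q => max p.depth q.depth
  | .iter p => p.depth
  | .rept p => p.depth + 1

/-! ### Compilation -/

/-- The register of a variable. -/
abbrev vr (x : ℕ) : ℕ := 2 * x + 10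

/-- The scratch registers. -/
abbrev sc (d : ℕ) : ℕ := 2 * d + 11

/-- Replace the content `a` of register `4` by `a * b + x`. -/
def digitProg (b x : ℕ) : Prog :=
  .seq (.copy 6 (vr x)) (.seq (.const 7 0) (.seq
    (.loop (.lt 7 4) (.seq (.const 8 0)
      (.seq (.loop (.lt 8 b) (.seq (.inc 6) (.inc 8))) (.inc 7)))) (.copy 4 6)))

def digitsProg (b : ℕ) : List ℕ → Prog
  | [] => .skip
  | x :: xs => .seq (digitProg b x) (digitsProg b xs)

/-- Put the address of the tuple of the variables `xs` into register `4`. -/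
def addressProg (b : ℕ) (xs : List ℕ) : Prog := .seq (.const 4 0) (digitsProg b xs)

/-- The truth value is left in register `3`; register `5` holds zero throughout, for comparison.
Scratch registers from `sc d` on are free: a quantifier saves its variable in `sc d` and accumulates
the conjunction of the instances in `sc (d + 1)`. -/
def Fm.compile : Fm → ℕ → Prog
  | .lt x y, _ => .ite (.lt (vr x) (vr y)) (.const 3 1) (.const 3 0)
  | .ltn x, _ => .ite (.lt (vr x) 0) (.const 3 1) (.const 3 0)
  | .ltk x, _ => .ite (.lt (vr x) 2) (.const 3 1) (.const 3 0)
  | .adj x y, _ => .seq (addressProg 0 [x, y]) (.load 3 0 4)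
  | .rel a xs, _ =>
    if xs.length = a % 5 then .seq (addressProg 1 xs) (.load 3 (a + 2) 4) else .const 3 0
  | .neg φ, d => .seq (φ.compile d) (.ite (.lt 5 3) (.const 3 0) (.const 3 1))
  | .and φ ψ, d => .seq (φ.compile d) (.ite (.lt 5 3) (ψ.compile d) .skip)
  | .all x φ, d =>
    .seq (.copy (sc d) (vr x)) (.seq (.const (vr x) 0) (.seq (.const (sc (d + 1)) 1) (.seq
      (.loop (.lt (vr x) 1) (.seq (φ.compile (d + 2))
        (.seq (.ite (.lt 5 3) .skip (.const (sc (d + 1)) 0)) (.inc (vr x)))))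
      (.seq (.copy (vr x) (sc d)) (.copy 3 (sc (d + 1)))))))

/-- Run `p` for all values of the variables `xs`. -/
def nest : List ℕ → Prog → Prog
  | [], p => p
  | x :: xs, p =>
    .seq (.const (vr x) 0) (.seq (.loop (.lt (vr x) 1) (.seq (nest xs p) (.inc (vr x))))
      (.const (vr x) 0))

/-- The truth values are first collected in array `1` and copied afterwards, since `φ` may itself
read the relation `a`. -/
def updProg (a : ℕ) (xs : List ℕ) (φ : Fm) (d : ℕ) : Prog :=
  .seq (nest xs (.seq (φ.compile (d + 1)) (.seq (.copy (sc d) 3)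
      (.seq (addressProg 1 xs) (.store 1 4 (sc d))))))
    (nest xs (.seq (addressProg 1 xs) (.seq (.load 3 1 4) (.store (a + 2) 4 3))))

def Cmd.compile : Cmd → ℕ → Prog
  | .skip, _ => .skip
  | .upd a xs φ, d => if xs.Nodup ∧ xs.length = a % 5 then updProg a xs φ d else .skip
  | .seq p q, d => .seq (p.compile d) (q.compile d)
  | .ite φ p q, d => .seq (φ.compile d) (.ite (.lt 5 3) (p.compile d) (q.compile d))
  | .iter p, d =>
    .seq (.const (sc d) 0)
      (.loop (.lt (sc d) 1) (.seq (p.compile (d + 1)) (.inc (sc d))))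
  -- The register `sc d` starts with the number two and is doubled `k` times by increments; then it
  -- bounds the main loop. In the test `.lt (sc (d + 1)) 2`, the `2` names the register that holds
  -- `k`.
  | .rept p, d =>
    .seq (.const (sc d) 2) (.seq (.const (sc (d + 1)) 0) (.seq
      (.loop (.lt (sc (d + 1)) 2) (.seq (.copy (sc (d + 2)) (sc d)) (.seq (.const (sc (d + 3)) 0)
        (.seq (.loop (.lt (sc (d + 3)) (sc (d + 2))) (.seq (.inc (sc d)) (.inc (sc (d + 3)))))
          (.inc (sc (d + 1)))))))
      (.seq (.const (sc (d + 1)) 0)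
        (.loop (.lt (sc (d + 1)) (sc d)) (.seq (p.compile (d + 2)) (.inc (sc (d + 1))))))))

/-! ### Correctness of compilation -/

/-- The registers of `σ` hold the constants of `c` and the values `v` of the variables. -/
structure RegRepr (c : Ctx) (v : ℕ → ℕ) (σ : State) : Prop where
  hn : σ.reg 0 = c.n
  hN : σ.reg 1 = c.n + 1
  hk : σ.reg 2 = c.k
  hz : σ.reg 5 = 0
  hv : ∀ x, σ.reg (vr x) = v x

/-- `σ` represents the relations `A` and the values `v` of the variables. -/
structure Repr (c : Ctx) (A : Rels) (v : ℕ → ℕ) (σ : State) : Prop extends RegRepr c v σ where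
  hcell : ∀ i, (c.cell i → σ.arr 0 i = 1) ∧ (¬ c.cell i → σ.arr 0 i = 0)
  hrel : ∀ a l, l.length = a % 5 → (∀ x ∈ l, x < c.n + 1) →
    (A a l → σ.arr (a + 2) (address (c.n + 1) l) = 1) ∧
    (¬ A a l → σ.arr (a + 2) (address (c.n + 1) l) = 0)

/-- The registers that the evaluation of formulas at depth `d` may change. -/
def Junk (d r : ℕ) : Prop := (3 ≤ r ∧ r ≤ 8 ∧ r ≠ 5) ∨ ∃ j, d ≤ j ∧ r = sc j

structure Frame (d : ℕ) (σ τ : State) : Prop where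
  arr : τ.arr = σ.arr
  reg : ∀ r, ¬ Junk d r → τ.reg r = σ.reg r

theorem Frame.refl (d : ℕ) (σ : State) : Frame d σ σ := ⟨rfl, fun _ _ => rfl⟩

theorem Frame.trans {d : ℕ} {σ τ υ : State} (h : Frame d σ τ) (h' : Frame d τ υ) : Frame d σ υ :=
  ⟨h'.arr.trans h.arr, fun r hr => (h'.reg r hr).trans (h.reg r hr)⟩

theorem Frame.mono {d e : ℕ} {σ τ : State} (h : Frame e σ τ) (hd : d ≤ e) : Frame d σ τ :=
  ⟨h.arr, fun r hr => h.reg r fun hj => hr (hj.imp id fun ⟨j, h1, h2⟩ => ⟨j, hd.trans h1, h2⟩)⟩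

theorem Frame.setReg {d : ℕ} {σ τ : State} (h : Frame d σ τ) {r w : ℕ} (hr : Junk d r) :
    Frame d σ (τ.setReg r w) :=
  ⟨h.arr, fun s hs => by
    rw [State.setReg_reg, if_neg (by rintro rfl; exact hs hr), h.reg s hs]⟩

theorem Junk.low {d r : ℕ} (h : 3 ≤ r ∧ r ≤ 8 ∧ r ≠ 5) : Junk d r := .inl h

theorem Junk.sc {d j : ℕ} (h : d ≤ j) : Junk d (sc j) := .inr ⟨j, h, rfl⟩

theorem not_junk_of_lt {d r : ℕ} (h : r < 3 ∨ r = 5 ∨ (9 ≤ r ∧ r < 11)) : ¬ Junk d r := by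
  rintro (h' | ⟨j, _, h'⟩)
  · omega
  · simp only [STVD.sc] at h'; omega

theorem not_junk_vr {d x : ℕ} : ¬ Junk d (vr x) := by
  rintro (h' | ⟨j, _, h'⟩)
  · simp only [vr] at h'; omega
  · simp only [STVD.sc, vr] at h'; omega

theorem not_junk_sc {d j : ℕ} (h : j < d) : ¬ Junk d (sc j) := by
  rintro (h' | ⟨j, _, h'⟩)
  · simp only [STVD.sc] at h'; omega
  · simp only [STVD.sc] at h'; omega

theorem RegRepr.frame {c : Ctx} {v : ℕ → ℕ} {σ τ : State} {d : ℕ} (h : RegRepr c v σ)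
    (hf : Frame d σ τ) : RegRepr c v τ where
  hn := by rw [hf.reg 0 (not_junk_of_lt (by omega)), h.hn]
  hN := by rw [hf.reg 1 (not_junk_of_lt (by omega)), h.hN]
  hk := by rw [hf.reg 2 (not_junk_of_lt (by omega)), h.hk]
  hz := by rw [hf.reg 5 (not_junk_of_lt (by omega)), h.hz]
  hv x := by rw [hf.reg _ not_junk_vr, h.hv]

theorem RegRepr.setVar {c : Ctx} {v : ℕ → ℕ} {σ : State} (h : RegRepr c v σ) (x i : ℕ) :
    RegRepr c (Function.update v x i) (σ.setReg (vr x) i) where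
  hn := by simpa [vr] using h.hn
  hN := by simpa [vr] using h.hN
  hk := by simpa [vr] using h.hk
  hz := by simpa [vr] using h.hz
  hv y := by
    have := h.hv y
    by_cases hy : y = x <;> simp_all [vr]

theorem Repr.frame {c : Ctx} {A : Rels} {v : ℕ → ℕ} {σ τ : State} {d : ℕ} (h : Repr c A v σ)
    (hf : Frame d σ τ) : Repr c A v τ where
  toRegRepr := h.toRegRepr.frame hf
  hcell := by rw [hf.arr]; exact h.hcell
  hrel := by rw [hf.arr]; exact h.hrel

theorem Repr.setVar {c : Ctx} {A : Rels} {v : ℕ → ℕ} {σ : State} (h : Repr c A v σ) (x i : ℕ) :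
    Repr c A (Function.update v x i) (σ.setReg (vr x) i) where
  toRegRepr := h.toRegRepr.setVar x i
  hcell := h.hcell
  hrel := h.hrel

/-- For want of a multiplication instruction, `s * m` is reached by adding one `m` times in each of
`s` rounds. The cost grows with the value of `s`, which is harmless because addresses are polynomial
in `n`. -/
theorem digitProg_runs {b x s d m : ℕ} {σ : State} (hb : b < 3)
    (hm : σ.reg b = m) (hs : σ.reg 4 = s) :
    Runs (digitProg b x) σ (s * (m * 3 + 4) + 4)
      (fun τ => Frame d σ τ ∧ τ.reg 4 = s * m + σ.reg (vr x)) := by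
  unfold digitProg
  have e : s * (m * 3 + 4) + 4 = 1 + (1 + ((s * ((1 + ((m * 2 + m * 1 + 1) + 1)) + 1) + 1) + 1)) := by
    ring
  rw [e]
  refine .seq (.copy (.seq (.const (.seq ?_))))
  refine (Runs.loop (fun i τ => Frame d σ τ ∧ τ.reg 4 = s ∧ τ.reg 7 = i ∧
    τ.reg 6 = i * m + σ.reg (vr x)) s ?_ ?_ ?_).mono le_rfl ?_
  · rintro i τ hi ⟨hf, h4, h7, h6⟩
    refine ⟨by simpa [Test.Holds, h4, h7] using hi, .seq (.const (.seq ?_))⟩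
    refine (Runs.loop (T := 2) (fun j τ => Frame d σ τ ∧ τ.reg 4 = s ∧ τ.reg 7 = i ∧
      τ.reg 6 = i * m + σ.reg (vr x) + j ∧ τ.reg 8 = j) m ?_ ?_ ?_).mono (by omega) ?_
    · rintro j υ hj ⟨hf, h4, h7, h6, h8⟩
      have hbm : υ.reg b = m := by rw [hf.reg b (not_junk_of_lt (by omega)), hm]
      refine ⟨by simpa [Test.Holds, h8, hbm] using hj, Runs.seq (T₁ := 1) (T₂ := 1) (.inc (.inc ?_))⟩
      refine ⟨(hf.setReg (.low (by omega))).setReg (.low (by omega)), ?_⟩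
      simp [h4, h7, h6, h8]; omega
    · rintro υ ⟨hf, h4, h7, h6, h8⟩
      have hbm : υ.reg b = m := by rw [hf.reg b (not_junk_of_lt (by omega)), hm]
      simp [Test.Holds, h8, hbm]
    · exact ⟨hf.setReg (.low (by omega)), by simp [h4, h7, h6]⟩
    · rintro υ ⟨hf, h4, h7, h6, h8⟩
      refine .inc ⟨hf.setReg (.low (by omega)), ?_⟩
      simp [h4, h7, h6]; ring
  · rintro τ ⟨hf, h4, h7, h6⟩
    simp [Test.Holds, h4, h7]
  · refine ⟨((Frame.refl d σ).setReg (.low (by omega))).setReg (.low (by omega)), ?_⟩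
    simp [hs]
  · rintro τ ⟨hf, h4, h7, h6⟩
    refine .copy ⟨hf.setReg (.low (by omega)), ?_⟩
    simp [h6]

/-- A bound on the time to compute an address, for variables that do not exceed `N`. -/
def digitsTime (N : ℕ) : ℕ → ℕ → ℕ
  | _, 0 => 1
  | s, l + 1 => s * (N * 3 + 4) + 4 + digitsTime N (s * N + N) l

theorem digitsTime_mono {N s s' l : ℕ} (h : s ≤ s') : digitsTime N s l ≤ digitsTime N s' l := by
  induction l generalizing s s' with
  | zero => simp [digitsTime]
  | succ l ih =>
    simp only [digitsTime]
    have := ih (s := s * N + N) (s' := s' * N + N) (by gcongr)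
    gcongr

theorem digitsProg_runs {c : Ctx} {v : ℕ → ℕ} {b m d : ℕ} {xs : List ℕ} (hb : b < 3)
    (hmN : m ≤ c.n + 1) (hv : ∀ x, v x < c.n + 1) {s : ℕ} {σ : State} (h : RegRepr c v σ)
    (hm : σ.reg b = m) (hs : σ.reg 4 = s) :
    Runs (digitsProg b xs) σ (digitsTime (c.n + 1) s xs.length)
      (fun τ => Frame d σ τ ∧ τ.reg 4 = (xs.map v).foldl (fun acc x => acc * m + x) s) := by
  induction xs generalizing s σ with
  | nil => exact .skip ⟨.refl _ _, by simp [hs]⟩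
  | cons x xs ih =>
    refine .seq ((digitProg_runs (d := d) hb hm hs).mono (by gcongr) ?_)
    rintro τ ⟨hf, h4⟩
    refine (ih (h.frame hf) (by rw [hf.reg b (not_junk_of_lt (by omega)), hm]) h4).mono ?_ ?_
    · rw [h.hv]
      exact digitsTime_mono (by have := hv x; gcongr)
    · rintro υ ⟨hf', h4'⟩
      exact ⟨hf.trans hf', by simp [h4', h.hv]⟩

theorem addressProg_runs {c : Ctx} {v : ℕ → ℕ} {b m d : ℕ} {xs : List ℕ} (hb : b < 3)
    (hmN : m ≤ c.n + 1) (hv : ∀ x, v x < c.n + 1) {σ : State} (h : RegRepr c v σ)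
    (hm : σ.reg b = m) :
    Runs (addressProg b xs) σ (1 + digitsTime (c.n + 1) 0 xs.length)
      (fun τ => Frame d σ τ ∧ τ.reg 4 = address m (xs.map v)) := by
  have hf : Frame d σ (σ.setReg 4 0) := (Frame.refl d σ).setReg (.low (by omega))
  refine .seq (.const ((digitsProg_runs (d := d) hb hmN hv (h.frame hf)
    (by rw [hf.reg b (not_junk_of_lt (by omega)), hm]) (by simp)).mono le_rfl ?_))
  rintro τ ⟨hf', h4⟩
  exact ⟨hf.trans hf', h4⟩

/-- If the accumulator is bounded by `q`, then after one more digit it is bounded by `q * X + X`; so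
the induction has to allow an arbitrary polynomial as initial value. -/
theorem exists_digitsTime_poly (l : ℕ) (q : Polynomial ℕ) :
    ∃ P : Polynomial ℕ, ∀ N, digitsTime N (q.eval N) l = P.eval N := by
  induction l generalizing q with
  | zero => exact ⟨1, fun N => by simp [digitsTime]⟩
  | succ l ih =>
    obtain ⟨P, hP⟩ := ih (q * .X + .X)
    refine ⟨q * (.X * 3 + 4) + 4 + P, fun N => ?_⟩
    rw [digitsTime]
    simp [← hP]


theorem exists_addressTime_poly (l : ℕ) :
    ∃ P : Polynomial ℕ, ∀ N, 1 + digitsTime N 0 l = P.eval N := by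
  obtain ⟨P, hP⟩ := exists_digitsTime_poly l 0
  exact ⟨1 + P, fun N => by simp [← hP]⟩

/-- `τ` is the result of evaluating a formula with the truth value `p` in the state `σ`. -/
structure Evald (d : ℕ) (p : Prop) (σ τ : State) : Prop where
  frame : Frame d σ τ
  one : p → τ.reg 3 = 1
  zero : ¬ p → τ.reg 3 = 0

theorem Evald.congr {d : ℕ} {p q : Prop} {σ τ : State} (h : Evald d p σ τ) (hpq : p ↔ q) :
    Evald d q σ τ := ⟨h.frame, fun hq => h.one (hpq.2 hq), fun hq => h.zero fun hp => hq (hpq.1 hp)⟩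

theorem Evald.holds {d : ℕ} {p : Prop} {σ τ : State} (h : Evald d p σ τ) (hz : σ.reg 5 = 0) :
    (Test.lt 5 3).Holds τ ↔ p := by
  have h5 : τ.reg 5 = 0 := by rw [h.frame.reg 5 (not_junk_of_lt (by omega)), hz]
  by_cases hp : p
  · simp [Test.Holds, h5, h.one hp, hp]
  · simp [Test.Holds, h5, h.zero hp, hp]

theorem Evald.const_one {d : ℕ} {p : Prop} {σ τ : State} (h : Frame d σ τ) (hp : p) :
    Evald d p σ (τ.setReg 3 1) :=
  ⟨h.setReg (.low (by omega)), fun _ => by simp, fun h => absurd hp h⟩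

theorem Evald.const_zero {d : ℕ} {p : Prop} {σ τ : State} (h : Frame d σ τ) (hp : ¬ p) :
    Evald d p σ (τ.setReg 3 0) :=
  ⟨h.setReg (.low (by omega)), fun h => absurd h hp, fun _ => by simp⟩

theorem compile_test_runs {d : ℕ} {p : Prop} {σ : State} {x y N : ℕ}
    (h : σ.reg x < σ.reg y ↔ p) :
    Runs (.ite (.lt x y) (.const 3 1) (.const 3 0)) σ ((2 : Polynomial ℕ).eval N)
      (Evald d p σ) := by
  refine (Runs.ite (T := 1) (fun hb => .const ?_) (fun hb => .const ?_)).mono (by simp)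
    (fun _ h => h)
  · exact .const_one (.refl _ _) (h.1 hb)
  · exact .const_zero (.refl _ _) fun hp => hb (h.2 hp)

/-- The polynomial is chosen before the context, the relations and the assignment: it depends on the
formula and the scratch depth alone. Each quantifier multiplies the cost by the `n + 1` values of
its variable. -/
theorem Fm.compile_runs (φ : Fm) : ∀ d, ∃ P : Polynomial ℕ, ∀ (c : Ctx) (A : Rels) (v : ℕ → ℕ)
    (σ : State), (∀ x, v x < c.n + 1) → Repr c A v σ →
    Runs (φ.compile d) σ (P.eval (c.n + 1)) (Evald d (φ.ev c A v) σ) := by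
  induction φ with
  | lt x y =>
    exact fun d => ⟨2, fun c A v σ hv h => compile_test_runs (by simp [h.hv, Fm.ev])⟩
  | ltn x =>
    exact fun d => ⟨2, fun c A v σ hv h => compile_test_runs (by rw [h.hv, h.hn]; simp [Fm.ev])⟩
  | ltk x =>
    exact fun d => ⟨2, fun c A v σ hv h => compile_test_runs (by rw [h.hv, h.hk]; simp [Fm.ev])⟩
  | adj x y =>
    intro d
    obtain ⟨P, hP⟩ := exists_addressTime_poly 2
    refine ⟨P + 1, fun c A v σ hv h => ?_⟩
    rw [Polynomial.eval_add, ← hP, Polynomial.eval_one]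
    refine .seq ((addressProg_runs (d := d) (xs := [x, y]) (by omega) (by omega) hv h.toRegRepr h.hn).mono
      le_rfl ?_)
    rintro τ ⟨hf, h4⟩
    have ha : address c.n [v x, v y] = v x * c.n + v y := by simp [address]
    have := (h.frame hf).hcell (v x * c.n + v y)
    refine .load ⟨hf.setReg (.low (by omega)), fun hp => ?_, fun hp => ?_⟩
    · simpa [h4, ha] using this.1 hp
    · simpa [h4, ha] using this.2 hp
  | rel a xs =>
    intro d
    by_cases hl : xs.length = a % 5
    · obtain ⟨P, hP⟩ := exists_addressTime_poly xs.length
      refine ⟨P + 1, fun c A v σ hv h => ?_⟩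
      rw [Polynomial.eval_add, ← hP, Polynomial.eval_one, Fm.compile, if_pos hl]
      refine .seq ((addressProg_runs (d := d) (xs := xs) (by omega) le_rfl hv h.toRegRepr h.hN).mono
        le_rfl ?_)
      rintro τ ⟨hf, h4⟩
      have := (h.frame hf).hrel a (xs.map v) (by simpa using hl) (by simpa using fun x _ => hv x)
      refine .load ⟨hf.setReg (.low (by omega)), fun hp => ?_, fun hp => ?_⟩
      · simpa [h4] using this.1 hp.2
      · simpa [h4] using this.2 fun hA => hp ⟨hl, hA⟩
    · refine ⟨1, fun c A v σ hv h => ?_⟩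
      rw [Fm.compile, if_neg hl, Polynomial.eval_one]
      exact .const (.const_zero (.refl _ _) fun hp => hl hp.1)
  | neg φ ih =>
    intro d
    obtain ⟨P, hP⟩ := ih d
    refine ⟨P + 2, fun c A v σ hv h => ?_⟩
    rw [Polynomial.eval_add]
    refine .seq ((hP c A v σ hv h).mono le_rfl fun τ hτ => ?_)
    refine (Runs.ite (T := 1) (fun hb => .const ?_) (fun hb => .const ?_)).mono (by simp)
      (fun _ h => h)
    · exact .const_zero hτ.frame (by simpa [Fm.ev] using (hτ.holds h.hz).1 hb)
    · exact .const_one hτ.frame fun hp => hb ((hτ.holds h.hz).2 hp)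
  | and φ ψ ih₁ ih₂ =>
    intro d
    obtain ⟨P, hP⟩ := ih₁ d
    obtain ⟨Q, hQ⟩ := ih₂ d
    refine ⟨P + (Q + 1 + 1), fun c A v σ hv h => ?_⟩
    simp only [Polynomial.eval_add, Polynomial.eval_one]
    refine .seq ((hP c A v σ hv h).mono le_rfl fun τ hτ => ?_)
    refine .ite (fun hb => ?_) (fun hb => ?_)
    · have hp := (hτ.holds h.hz).1 hb
      refine (hQ c A v τ hv (h.frame hτ.frame)).mono (by omega) fun υ hυ => ?_
      have := hυ.congr (q := Fm.ev c A (.and φ ψ) v) (by simp [Fm.ev, hp])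
      exact ⟨hτ.frame.trans this.frame, this.one, this.zero⟩
    · have hp : ¬ φ.ev c A v := fun hp => hb ((hτ.holds h.hz).2 hp)
      refine (Runs.skip ?_).mono (by omega) fun _ h => h
      exact ⟨hτ.frame, fun hq => absurd hq.1 hp, fun _ => hτ.zero hp⟩
  | all x φ ih =>
    intro d
    obtain ⟨P, hP⟩ := ih (d + 2)
    refine ⟨1 + (1 + (1 + ((.X * ((P + (2 + 1)) + 1) + 1) + (1 + 1)))), fun c A v σ hv h => ?_⟩
    simp only [Polynomial.eval_add, Polynomial.eval_one, Polynomial.eval_mul, Polynomial.eval_X,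
      Polynomial.eval_ofNat]
    refine .seq (.copy (.seq (.const (.seq (.const (.seq ?_))))))
    -- `Frame` is not available during the loop because the register of `x` changes, so the
    -- invariant exempts that register explicitly. The flag in `sc (d + 1)` tells whether the first
    -- `i` instances hold.
    refine (Runs.loop (fun i τ => Repr c A (Function.update v x i) τ ∧ τ.arr = σ.arr ∧
      (∀ r, ¬ Junk d r → r ≠ vr x → τ.reg r = σ.reg r) ∧ τ.reg (sc d) = v x ∧
      ((∀ j < i, φ.ev c A (Function.update v x j)) → τ.reg (sc (d + 1)) = 1) ∧
      (¬ (∀ j < i, φ.ev c A (Function.update v x j)) → τ.reg (sc (d + 1)) = 0)) (c.n + 1)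
      ?_ ?_ ?_).mono le_rfl ?_
    · rintro i τ hi ⟨hR, harr, hreg, hsc, h1, h0⟩
      have hv' : ∀ y, Function.update v x i y < c.n + 1 := by
        intro y
        by_cases hy : y = x
        · subst hy; simpa using hi
        · simpa [hy] using hv y
      have hx : τ.reg (vr x) = i := by rw [hR.hv]; simp
      refine ⟨by simp only [Test.Holds]; rw [hx, hR.hN]; exact hi, .seq
        ((hP c A _ τ hv' hR).mono le_rfl fun υ hυ => .seq (.ite (T := 1) ?_ ?_))⟩
      · intro hb
        have hp := (hυ.holds hR.hz).1 hb
        have hx' : υ.reg (vr x) = i := by rw [hυ.frame.reg _ not_junk_vr, hx]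
        refine .skip (.inc ⟨?_, ?_, ?_, ?_, ?_, ?_⟩)
        · have := (hR.frame hυ.frame).setVar x (υ.reg (vr x) + 1)
          rw [Function.update_idem] at this
          rwa [hx'] at this ⊢
        · simp [hυ.frame.arr, harr]
        · intro r hr hrx
          simp only [State.setReg_reg, if_neg hrx]
          rw [(hυ.frame.mono (by omega)).reg r hr, hreg r hr hrx]
        · rw [State.setReg_reg, if_neg (by simp only [vr, sc]; omega),
            hυ.frame.reg _ (not_junk_sc (by omega)), hsc]
        · intro hall
          rw [State.setReg_reg, if_neg (by simp only [vr, sc]; omega),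
            hυ.frame.reg _ (not_junk_sc (by omega)), h1 fun j hj => hall j (by omega)]
        · intro hall
          rw [State.setReg_reg, if_neg (by simp only [vr, sc]; omega),
            hυ.frame.reg _ (not_junk_sc (by omega)), h0 fun hall' => hall fun j hj => ?_]
          rcases Nat.lt_succ_iff_lt_or_eq.1 hj with hj | rfl
          · exact hall' j hj
          · exact hp
      · intro hb
        have hp : ¬ φ.ev c A (Function.update v x i) := fun hp => hb ((hυ.holds hR.hz).2 hp)
        have hx' : υ.reg (vr x) = i := by rw [hυ.frame.reg _ not_junk_vr, hx]
        have hfr : Frame d τ (υ.setReg (sc (d + 1)) 0) :=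
          (hυ.frame.mono (by omega)).setReg (.sc (by omega))
        have hx'' : (υ.setReg (sc (d + 1)) 0).reg (vr x) = i := by
          rw [hfr.reg _ not_junk_vr, hx]
        refine .const (.inc ⟨?_, ?_, ?_, ?_, ?_, ?_⟩)
        · have := (hR.frame hfr).setVar x (i + 1)
          rw [Function.update_idem] at this
          rwa [hx'']
        · simp [hυ.frame.arr, harr]
        · intro r hr hrx
          rw [State.setReg_reg, if_neg hrx, hfr.reg r hr, hreg r hr hrx]
        · rw [State.setReg_reg, if_neg (by simp only [vr, sc]; omega), State.setReg_reg,
            if_neg (by simp only [sc]; omega), hυ.frame.reg _ (not_junk_sc (by omega)), hsc]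
        · intro hall
          exact absurd (hall i (by omega)) hp
        · intro hall
          rw [State.setReg_reg, if_neg (by simp only [vr, sc]; omega), State.setReg_reg, if_pos rfl]
    · rintro τ ⟨hR, harr, hreg, hsc, h1, h0⟩
      simp only [Test.Holds]
      rw [hR.hv, hR.hN]
      simp
    · have hf : Frame d σ (σ.setReg (sc d) (σ.reg (vr x))) :=
        (Frame.refl d σ).setReg (.sc le_rfl)
      refine ⟨?_, by simp, ?_, ?_, ?_, ?_⟩
      · exact ((h.frame hf).setVar x 0).frame ((Frame.refl d _).setReg (.sc (by omega)))
      · intro r hr hrx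
        rw [State.setReg_reg, if_neg (by rintro rfl; exact hr (.sc (by omega))), State.setReg_reg,
          if_neg hrx, hf.reg r hr]
      · rw [State.setReg_reg, if_neg (by simp only [sc]; omega), State.setReg_reg,
          if_neg (by simp only [sc, vr]; omega), State.setReg_reg, if_pos rfl, h.hv]
      · intro _; simp
      · intro hall; exact absurd (fun j hj => absurd hj (by omega)) hall
    · rintro τ ⟨hR, harr, hreg, hsc, h1, h0⟩
      have e : (τ.setReg (vr x) (τ.reg (sc d))).reg (sc (d + 1)) = τ.reg (sc (d + 1)) := by
        rw [State.setReg_reg, if_neg (by simp only [sc, vr]; omega)]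
      refine .seq (.copy (.copy ⟨⟨by simp [harr], fun r hr => ?_⟩, ?_, ?_⟩))
      · rw [State.setReg_reg, if_neg (by rintro rfl; exact hr (.low (by omega))), State.setReg_reg]
        by_cases hrx : r = vr x
        · rw [if_pos hrx, hsc, hrx, h.hv]
        · rw [if_neg hrx, hreg r hr hrx]
      · intro hall
        rw [State.setReg_reg, if_pos rfl, e, h1 hall]
      · intro hall
        rw [State.setReg_reg, if_pos rfl, e, h0 hall]

end STVD

namespace STVD

/-! ### Assignments to tuples of variables, nested loops, and relation updates -/

theorem assign_of_notMem {x : ℕ} : ∀ {v : ℕ → ℕ} {xs l : List ℕ}, x ∉ xs → assign v xs l x = v x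
  | _, [], [], _ => rfl
  | _, [], _ :: _, _ => rfl
  | _, _ :: _, [], _ => rfl
  | v, y :: xs, i :: l, h => by
    simp only [List.mem_cons, not_or] at h
    rw [assign, assign_of_notMem h.2, Function.update_of_ne h.1]

theorem map_assign : ∀ {v : ℕ → ℕ} {xs l : List ℕ}, xs.Nodup → xs.length = l.length →
    xs.map (assign v xs l) = l
  | _, [], [], _, _ => rfl
  | v, y :: xs, i :: l, h, hl => by
    rw [List.nodup_cons] at h
    rw [assign, List.map_cons, map_assign h.2 (by simpa using hl), assign_of_notMem h.1]
    simp

theorem assign_lt {N x : ℕ} : ∀ {v : ℕ → ℕ} {xs l : List ℕ}, (∀ y, v y < N) → (∀ i ∈ l, i < N) →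
    assign v xs l x < N
  | _, [], [], h, _ => h _
  | _, [], _ :: _, h, _ => h _
  | _, _ :: _, [], h, _ => h _
  | v, y :: xs, i :: l, h, hl => by
    rw [assign]
    refine assign_lt (fun z => ?_) fun j hj => hl j (by simp [hj])
    by_cases hz : z = y
    · subst hz; rw [Function.update_self]; exact hl i (by simp)
    · simpa [hz] using h z

def nestTime (N T : ℕ) : List ℕ → ℕ
  | [] => T
  | _ :: xs => 1 + ((N * ((nestTime N T xs + 1) + 1) + 1) + 1)

theorem exists_nestTime_poly (P : Polynomial ℕ) (xs : List ℕ) :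
    ∃ Q : Polynomial ℕ, ∀ N, nestTime N (P.eval N) xs = Q.eval N := by
  induction xs with
  | nil => exact ⟨P, fun _ => rfl⟩
  | cons x xs ih =>
    obtain ⟨Q, hQ⟩ := ih
    exact ⟨1 + ((.X * ((Q + 1) + 1) + 1) + 1), fun N => by simp [nestTime, hQ]⟩

/-- The set `D` in the invariant `J` collects the assignments for which the body has been run. Every
variable of `xs` starts at zero and is reset to zero, so the loops can be nested without knowledge
of each other. -/
theorem nest_runs {N T : ℕ} {body : Prog} (J : (ℕ → ℕ) → Set (ℕ → ℕ) → State → Prop)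
    (hreg : ∀ v D σ, J v D σ → (∀ x, σ.reg (vr x) = v x) ∧ σ.reg 1 = N)
    (hmono : ∀ v D D' σ, D' ⊆ D → J v D σ → J v D' σ)
    (hbody : ∀ v D σ, (∀ x, v x < N) → J v D σ → Runs body σ T (J v (insert v D))) :
    ∀ xs : List ℕ, xs.Nodup →
    (∀ x ∈ xs, ∀ v D σ i, J v D σ → J (Function.update v x i) D (σ.setReg (vr x) i)) →
    ∀ v D σ, (∀ x, v x < N) → (∀ x ∈ xs, v x = 0) → J v D σ →
    Runs (nest xs body) σ (nestTime N T xs)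
      (J v (D ∪ {u | (∀ x, u x < N) ∧ ∀ x, x ∉ xs → u x = v x})) := by
  intro xs
  induction xs with
  | nil =>
    intro _ _ v D σ hv _ h
    refine (hbody v D σ hv h).mono le_rfl fun τ hτ => hmono _ _ _ _ ?_ hτ
    rintro u (hu | ⟨_, hu⟩)
    · exact .inr hu
    · exact .inl (funext fun x => hu x (by simp))
  | cons x xs ih =>
    intro hnd hset v D σ hv h0 h
    rw [List.nodup_cons] at hnd
    refine .seq (.const (.seq ?_))
    -- After `i` rounds the body has been run for all assignments with a value below `i` at `x`,
    -- whatever their values at the inner variables.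
    refine (Runs.loop (fun i τ => J (Function.update v x i) (D ∪ {u | (∀ y, u y < N) ∧
      u x < i ∧ ∀ y, y ∉ x :: xs → u y = v y}) τ) N ?_ ?_ ?_).mono le_rfl ?_
    · intro i τ hi hτ
      have hr := hreg _ _ _ hτ
      refine ⟨by simp [Test.Holds, hr.1, hr.2, hi], .seq ((ih hnd.2
        (fun y hy => hset y (by simp [hy])) _ _ τ ?_ ?_ hτ).mono le_rfl ?_)⟩
      · intro y
        by_cases hy : y = x
        · subst hy; simpa using hi
        · simpa [hy] using hv y
      · intro y hy
        have hyx : y ≠ x := by rintro rfl; exact hnd.1 hy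
        simpa [hyx] using h0 y (by simp [hy])
      · intro υ hυ
        refine .inc ?_
        have e : υ.reg (vr x) = i := by rw [(hreg _ _ _ hυ).1]; simp
        rw [e]
        have := hset x (by simp) _ _ _ (i + 1) hυ
        rw [Function.update_idem] at this
        refine hmono _ _ _ _ ?_ this
        rintro u (hu | ⟨hu1, hu2, hu3⟩)
        · exact .inl (.inl hu)
        · rcases Nat.lt_succ_iff_lt_or_eq.1 hu2 with hu2 | hu2
          · exact .inl (.inr ⟨hu1, hu2, hu3⟩)
          · refine .inr ⟨hu1, fun y hy => ?_⟩
            by_cases hyx : y = x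
            · subst hyx; simpa using hu2
            · rw [Function.update_of_ne hyx]; exact hu3 y (by simp [hyx, hy])
    · intro τ hτ
      have hr := hreg _ _ _ hτ
      simp [Test.Holds, hr.1, hr.2]
    · refine hmono _ _ _ _ ?_ (hset x (by simp) _ _ _ 0 h)
      rintro u (hu | ⟨_, hu, _⟩)
      · exact hu
      · omega
    · intro τ hτ
      refine .const ?_
      have := hset x (by simp) _ _ _ 0 hτ
      rw [Function.update_idem, ← h0 x (by simp), Function.update_eq_self] at this
      rw [← h0 x (by simp)]
      refine hmono _ _ _ _ ?_ this
      rintro u (hu | ⟨hu1, hu2⟩)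
      · exact .inl hu
      · exact .inr ⟨hu1, hu1 x, hu2⟩

/-- The cell `i` of the array `b` holds the truth value of `p`. -/
def Holds (σ : State) (b i : ℕ) (p : Prop) : Prop :=
  (p → σ.arr b i = 1) ∧ (¬ p → σ.arr b i = 0)

theorem eq_of_address_eq {N : ℕ} {xs : List ℕ} {u v : ℕ → ℕ} (hu : ∀ x, u x < N)
    (hv : ∀ x, v x < N) (hu0 : ∀ x, x ∉ xs → u x = 0) (hv0 : ∀ x, x ∉ xs → v x = 0)
    (h : address N (xs.map u) = address N (xs.map v)) : u = v := by
  have := address_inj (by simp) (by simpa using fun x _ => hu x) (by simpa using fun x _ => hv x) h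
  rw [List.map_inj_left] at this
  funext x
  by_cases hx : x ∈ xs
  · exact this x hx
  · rw [hu0 x hx, hv0 x hx]

/-- Assignments that vanish outside `xs` are determined by their addresses (`eq_of_address_eq`), so
no write spoils the value recorded for another tuple. -/
theorem updProg_runs (a : ℕ) (xs : List ℕ) (φ : Fm) (d : ℕ) (hnd : xs.Nodup)
    (hlen : xs.length = a % 5) :
    ∃ P : Polynomial ℕ, ∀ (c : Ctx) (A : Rels) (σ : State), Repr c A (fun _ => 0) σ →
    Runs (updProg a xs φ d) σ (P.eval (c.n + 1)) (fun τ => Repr c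
      (Function.update A a fun l => φ.ev c A (assign (fun _ => 0) xs l)) (fun _ => 0) τ ∧
      ∀ j < d, τ.reg (sc j) = σ.reg (sc j)) := by
  obtain ⟨P, hP⟩ := φ.compile_runs (d + 1)
  obtain ⟨Q, hQ⟩ := exists_addressTime_poly xs.length
  obtain ⟨P₁, hP₁⟩ := exists_nestTime_poly (P + (1 + (Q + 1))) xs
  obtain ⟨P₂, hP₂⟩ := exists_nestTime_poly (Q + (1 + 1)) xs
  refine ⟨P₁ + P₂, fun c A σ h => ?_⟩
  rw [Polynomial.eval_add, ← hP₁, ← hP₂]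
  set z : ℕ → ℕ := fun _ => 0 with hz
  have hz0 : ∀ x, z x < c.n + 1 := fun x => by simp [hz]
  refine .seq ((nest_runs (N := c.n + 1) (fun v D τ => Repr c A v τ ∧ (∀ x, x ∉ xs → v x = 0) ∧
    (∀ j < d, τ.reg (sc j) = σ.reg (sc j)) ∧ ∀ u ∈ D, (∀ x, u x < c.n + 1) ∧
    (∀ x, x ∉ xs → u x = 0) ∧ Holds τ 1 (address (c.n + 1) (xs.map u)) (φ.ev c A u))
    (fun v D τ hτ => ⟨hτ.1.hv, hτ.1.hN⟩)
    (fun v D D' τ hD hτ => ⟨hτ.1, hτ.2.1, hτ.2.2.1, fun u hu => hτ.2.2.2 u (hD hu)⟩)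
    ?_ xs hnd ?_ z ∅ σ hz0 (fun _ _ => rfl)
    ⟨h, fun _ _ => rfl, fun _ _ => rfl, fun u hu => absurd hu (by simp)⟩).mono le_rfl ?_)
  · rintro v D τ hv ⟨hR, hv0, hsc, hD⟩
    simp only [Polynomial.eval_add, Polynomial.eval_one, ← hQ]
    refine .seq ((hP c A v τ hv hR).mono le_rfl fun υ hυ => .seq (.copy (.seq ?_)))
    have hf₁ : Frame d τ (υ.setReg (sc d) (υ.reg 3)) :=
      (hυ.frame.mono (by omega)).setReg (.sc le_rfl)
    have hR' := hR.frame hf₁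
    refine ((addressProg_runs (d := d + 1) (xs := xs) (by omega) le_rfl hv
      hR'.toRegRepr hR'.hN).mono le_rfl ?_)
    rintro ρ ⟨hf, h4⟩
    have hR'' := hR'.frame hf
    have hff := hf₁.trans (hf.mono (by omega))
    have h3 : ρ.reg (sc d) = υ.reg 3 := by
      rw [hf.reg _ (not_junk_sc (by omega)), State.setReg_reg, if_pos rfl]
    refine .store ⟨⟨⟨hR''.hn, hR''.hN, hR''.hk, hR''.hz, hR''.hv⟩, ?_, ?_⟩, hv0, ?_, ?_⟩
    · intro i
      simpa using hR''.hcell i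
    · intro b l hl hlt
      simpa using hR''.hrel b l hl hlt
    · intro j hj
      rw [State.setArr_reg, hff.reg _ (not_junk_sc hj), hsc j hj]
    · rintro u hu
      have hself : Holds (ρ.setArr 1 (ρ.reg 4) (ρ.reg (sc d))) 1 (address (c.n + 1) (xs.map v))
          (φ.ev c A v) := by
        refine ⟨fun hp => ?_, fun hp => ?_⟩
        · simpa [h4, h3] using hυ.one hp
        · simpa [h4, h3] using hυ.zero hp
      rcases hu with rfl | hu
      · exact ⟨hv, hv0, hself⟩
      · obtain ⟨hu1, hu2, hu3⟩ := hD u hu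
        refine ⟨hu1, hu2, ?_⟩
        by_cases he : address (c.n + 1) (xs.map u) = address (c.n + 1) (xs.map v)
        · rwa [eq_of_address_eq hu1 hv hu2 hv0 he]
        · simpa [Holds, h4, he, hff.arr] using hu3
  · rintro x hx v D τ i ⟨hR, hv0, hsc, hD⟩
    refine ⟨hR.setVar x i, fun y hy => ?_, fun j hj => ?_, fun u hu => hD u hu⟩
    · rw [Function.update_of_ne (by rintro rfl; exact hy hx)]; exact hv0 y hy
    · rw [State.setReg_reg, if_neg (by simp only [sc, vr]; omega), hsc j hj]
  rintro τ ⟨hR, -, hsc, hD⟩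
  replace hD : ∀ u : ℕ → ℕ, (∀ x, u x < c.n + 1) → (∀ x, x ∉ xs → u x = 0) →
      Holds τ 1 (address (c.n + 1) (xs.map u)) (φ.ev c A u) :=
    fun u h1 h2 => (hD u (.inr ⟨h1, h2⟩)).2.2
  -- While array `a + 2` is overwritten, the state represents neither the old nor the new relations.
  -- Hence only the registers and the other arrays are tracked, and the values come from array `1`.
  refine ((nest_runs (N := c.n + 1) (fun v D υ => RegRepr c v υ ∧ (∀ x, x ∉ xs → v x = 0) ∧
    (∀ j < d, υ.reg (sc j) = σ.reg (sc j)) ∧ (∀ b, b ≠ a + 2 → υ.arr b = τ.arr b) ∧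
    ∀ u ∈ D, (∀ x, u x < c.n + 1) ∧ (∀ x, x ∉ xs → u x = 0) ∧
    Holds υ (a + 2) (address (c.n + 1) (xs.map u)) (φ.ev c A u))
    (fun v D τ hτ => ⟨hτ.1.hv, hτ.1.hN⟩)
    (fun v D D' τ hD hτ => ⟨hτ.1, hτ.2.1, hτ.2.2.1, hτ.2.2.2.1, fun u hu => hτ.2.2.2.2 u (hD hu)⟩)
    ?_ xs hnd ?_ z ∅ τ hz0 (fun _ _ => rfl)
    ⟨hR.toRegRepr, fun _ _ => rfl, hsc, fun _ _ => rfl, fun u hu => absurd hu (by simp)⟩).mono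
    le_rfl ?_)
  · rintro v D υ hv ⟨hυ, hv0, hsc, harr, hD'⟩
    simp only [Polynomial.eval_add, Polynomial.eval_one, ← hQ]
    refine .seq ((addressProg_runs (d := d) (xs := xs) (by omega) le_rfl hv
      hυ hυ.hN).mono le_rfl ?_)
    rintro ρ ⟨hf, h4⟩
    have hρ := hυ.frame hf
    have hff : Frame d υ (ρ.setReg 3 (ρ.arr 1 (ρ.reg 4))) := hf.setReg (.low (by omega))
    have hρ' := hυ.frame hff
    have hval : ρ.arr 1 = τ.arr 1 := by rw [hf.arr, harr 1 (by omega)]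
    refine .seq (.load (.store ⟨⟨hρ'.hn, hρ'.hN, hρ'.hk, hρ'.hz, hρ'.hv⟩, hv0, ?_, ?_, ?_⟩))
    · intro j hj
      rw [State.setArr_reg, hff.reg _ (not_junk_sc hj), hsc j hj]
    · intro b hb
      funext i
      simp [hb, hf.arr, harr b hb]
    · have hself := hD v hv hv0
      rintro u hu
      by_cases he : address (c.n + 1) (xs.map u) = address (c.n + 1) (xs.map v)
      · have huv : u = v := by
          rcases hu with rfl | hu
          · rfl
          · exact eq_of_address_eq (hD' u hu).1 hv (hD' u hu).2.1 hv0 he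
        subst huv
        exact ⟨hv, hv0, by simpa [Holds, h4, hval] using hself⟩
      · rcases hu with rfl | hu
        · exact absurd rfl he
        · obtain ⟨hu1, hu2, hu3⟩ := hD' u hu
          exact ⟨hu1, hu2, by simpa [Holds, h4, he, hf.arr] using hu3⟩
  · rintro x hx v D τ i ⟨hR, hv0, hsc, harr, hD⟩
    refine ⟨hR.setVar x i, fun y hy => ?_, fun j hj => ?_, harr, fun u hu => hD u hu⟩
    · rw [Function.update_of_ne (by rintro rfl; exact hy hx)]; exact hv0 y hy
    · rw [State.setReg_reg, if_neg (by simp only [sc, vr]; omega), hsc j hj]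
  rintro υ ⟨hυ, -, hsc', harr, hD'⟩
  refine ⟨⟨hυ, ?_, ?_⟩, hsc'⟩
  · rw [harr 0 (by omega)]; exact hR.hcell
  · intro b l hl hlt
    by_cases hb : b = a
    · subst hb
      have hl' : xs.length = l.length := by rw [hl, hlen]
      have := (hD' (assign z xs l) (.inr ⟨fun x => assign_lt hz0 hlt,
        fun x hx => assign_of_notMem hx⟩)).2.2
      rw [map_assign hnd hl'] at this
      simpa [Holds] using this
    · rw [Function.update_of_ne hb, harr _ (by omega)]
      exact hR.hrel b l hl hlt

/-! ### Running time of compiled commands -/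

/-- After `i` rounds `sc d` holds `2 ^ (i + 1)`. Each of the `K` rounds is charged the price of the
last one; this loses a factor of order `K` against the geometric sum, which the gap between `2` and
`2.733` absorbs. -/
theorem doubling_runs {σ : State} {d K : ℕ} (hK : σ.reg 2 = K) (hE : σ.reg (sc d) = 2)
    (hi : σ.reg (sc (d + 1)) = 0) :
    Runs (.loop (.lt (sc (d + 1)) 2) (.seq (.copy (sc (d + 2)) (sc d)) (.seq (.const (sc (d + 3)) 0)
        (.seq (.loop (.lt (sc (d + 3)) (sc (d + 2))) (.seq (.inc (sc d)) (.inc (sc (d + 3)))))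
          (.inc (sc (d + 1))))))) σ (10 * ((K + 1) * 2 ^ (K + 1)))
      (fun τ => Frame d σ τ ∧ τ.reg (sc d) = 2 ^ (K + 1)) := by
  have key : K * ((1 + (1 + ((2 ^ (K + 1) * (2 + 1) + 1) + 1))) + 1) + 1
      ≤ 10 * ((K + 1) * 2 ^ (K + 1)) := by
    have := Nat.one_le_two_pow (n := K + 1)
    nlinarith
  refine (Runs.loop (fun i τ => Frame d σ τ ∧ τ.reg (sc d) = 2 ^ (i + 1) ∧
    τ.reg (sc (d + 1)) = i) K ?_ ?_ ⟨.refl _ _, by simpa using hE, hi⟩).mono key ?_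
  · rintro i τ hiK ⟨hf, h1, h2⟩
    have hk : τ.reg 2 = K := by rw [hf.reg 2 (not_junk_of_lt (by omega)), hK]
    refine ⟨by simpa [Test.Holds, h2, hk] using hiK, .seq (.copy (.seq (.const (.seq ?_))))⟩
    refine (Runs.loop (T := 2) (fun j υ => Frame d σ υ ∧ υ.reg (sc d) = 2 ^ (i + 1) + j ∧
      υ.reg (sc (d + 1)) = i ∧ υ.reg (sc (d + 2)) = 2 ^ (i + 1) ∧ υ.reg (sc (d + 3)) = j)
      (2 ^ (i + 1)) ?_ ?_ ?_).mono ?_ ?_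
    · rintro j υ hj ⟨hf, h1, h2, h3, h4⟩
      refine ⟨by simpa [Test.Holds, h3, h4] using hj, Runs.seq (T₁ := 1) (T₂ := 1) (.inc (.inc ?_))⟩
      refine ⟨(hf.setReg (.sc le_rfl)).setReg (.sc (by omega)), ?_⟩
      simp [h1, h2, h3, h4, sc]; omega
    · rintro υ ⟨hf, h1, h2, h3, h4⟩
      simp [Test.Holds, h3, h4]
    · refine ⟨(hf.setReg (.sc (by omega))).setReg (.sc (by omega)), ?_⟩
      simp [h1, h2, sc]
    · have : 2 ^ (i + 1) ≤ 2 ^ (K + 1) := Nat.pow_le_pow_right (by omega) (by omega)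
      gcongr
    · rintro υ ⟨hf, h1, h2, h3, h4⟩
      refine .inc ⟨hf.setReg (.sc (by omega)), ?_⟩
      simp [h1, h2, sc, pow_succ]; omega
  · rintro τ ⟨hf, h1, h2⟩
    have hk : τ.reg 2 = K := by rw [hf.reg 2 (not_junk_of_lt (by omega)), hK]
    simp [Test.Holds, h2, hk]
  · rintro τ ⟨hf, h1, h2⟩
    exact ⟨hf, h1⟩

/-- The exponential factor in the running time of compiled commands. -/
def expFactor (k : ℕ) : ℕ := (k + 1) * 2 ^ (k + 1)

theorem one_le_expFactor_pow (k d : ℕ) : 1 ≤ expFactor k ^ d :=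
  Nat.one_le_pow _ _ (Nat.mul_pos (by omega) (by positivity))

theorem expFactor_pow_mono (k : ℕ) {d e : ℕ} (h : d ≤ e) : expFactor k ^ d ≤ expFactor k ^ e :=
  Nat.pow_le_pow_right (Nat.mul_pos (by omega) (by positivity)) h

/-- Since `k` is not bounded in terms of `n`, the part of the cost that depends on `k` is kept apart
from the polynomial. Each level of `rept` contributes one `expFactor`: its factor `2 ^ (k + 1)` pays
for the repetitions, and the factor `k + 1` for computing their number. -/
theorem Cmd.compile_runs (p : Cmd) : ∀ d, ∃ P : Polynomial ℕ, ∀ (c : Ctx) (A : Rels)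
    (σ : State), Repr c A (fun _ => 0) σ →
    Runs (p.compile d) σ (P.eval (c.n + 1) * expFactor c.k ^ p.depth) (fun τ =>
      Repr c (p.sem c A) (fun _ => 0) τ ∧ ∀ j < d, τ.reg (sc j) = σ.reg (sc j)) := by
  induction p with
  | skip => exact fun d => ⟨1, fun c A σ h => (Runs.skip ⟨h, fun _ _ => rfl⟩).mono
      (by simp [Cmd.depth]) fun _ h => h⟩
  | upd a xs φ =>
    intro d
    by_cases hx : xs.Nodup ∧ xs.length = a % 5
    · obtain ⟨P, hP⟩ := updProg_runs a xs φ d hx.1 hx.2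
      refine ⟨P, fun c A σ h => ?_⟩
      rw [Cmd.compile, if_pos hx, Cmd.sem, if_pos hx]
      exact (hP c A σ h).mono (by simp [Cmd.depth]) fun _ h => h
    · refine ⟨1, fun c A σ h => ?_⟩
      rw [Cmd.compile, if_neg hx, Cmd.sem, if_neg hx]
      exact (Runs.skip ⟨h, fun _ _ => rfl⟩).mono (by simp [Cmd.depth]) fun _ h => h
  | seq p q ih₁ ih₂ =>
    intro d
    obtain ⟨P, hP⟩ := ih₁ d
    obtain ⟨Q, hQ⟩ := ih₂ d
    refine ⟨P + Q, fun c A σ h => ?_⟩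
    rw [Polynomial.eval_add, add_mul]
    refine .seq ((hP c A σ h).mono ?_ fun τ hτ => (hQ c _ τ hτ.1).mono ?_ fun υ hυ =>
      ⟨hυ.1, fun j hj => (hυ.2 j hj).trans (hτ.2 j hj)⟩)
    · exact Nat.mul_le_mul_left _ (expFactor_pow_mono _ (le_max_left _ _))
    · exact Nat.mul_le_mul_left _ (expFactor_pow_mono _ (le_max_right _ _))
  | ite φ p q ih₁ ih₂ =>
    intro d
    obtain ⟨R, hR⟩ := φ.compile_runs d
    obtain ⟨P, hP⟩ := ih₁ d
    obtain ⟨Q, hQ⟩ := ih₂ d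
    refine ⟨R + (P + Q + 1), fun c A σ h => ?_⟩
    have e1 := Nat.mul_le_mul_left (P.eval (c.n + 1)) (expFactor_pow_mono c.k
      (le_max_left p.depth q.depth))
    have e2 := Nat.mul_le_mul_left (Q.eval (c.n + 1)) (expFactor_pow_mono c.k
      (le_max_right p.depth q.depth))
    have e3 := one_le_expFactor_pow c.k (max p.depth q.depth)
    have e4 := Nat.mul_le_mul_left (R.eval (c.n + 1)) e3
    refine Runs.mono (T := R.eval (c.n + 1) + ((P.eval (c.n + 1) + Q.eval (c.n + 1)) *
      expFactor c.k ^ (max p.depth q.depth) + 1)) ?_ ?_ fun _ h => h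
    · refine .seq ((hR c A _ σ (by simp) h).mono le_rfl fun τ hτ => .ite (fun hb => ?_)
        fun hb => ?_)
      · rw [Cmd.sem, if_pos ((hτ.holds h.hz).1 hb)]
        refine (hP c A τ (h.frame hτ.frame)).mono (by rw [add_mul]; omega) fun υ hυ =>
          ⟨hυ.1, fun j hj => by rw [hυ.2 j hj, hτ.frame.reg _ (not_junk_sc hj)]⟩
      · rw [Cmd.sem, if_neg fun hp => hb ((hτ.holds h.hz).2 hp)]
        refine (hQ c A τ (h.frame hτ.frame)).mono (by rw [add_mul]; omega) fun υ hυ =>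
          ⟨hυ.1, fun j hj => by rw [hυ.2 j hj, hτ.frame.reg _ (not_junk_sc hj)]⟩
    · simp only [Polynomial.eval_add, Polynomial.eval_one, Cmd.depth, add_mul] at *
      omega
  | iter p ih =>
    intro d
    obtain ⟨P, hP⟩ := ih (d + 1)
    refine ⟨1 + (.X * (P + 2) + 1), fun c A σ h => ?_⟩
    have hf₀ : Frame d σ (σ.setReg (sc d) 0) := (Frame.refl d σ).setReg (.sc le_rfl)
    refine Runs.mono (T := 1 + ((c.n + 1) * ((P.eval (c.n + 1) * expFactor c.k ^ p.depth + 1) + 1)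
      + 1)) (.seq (.const (Runs.loop (fun i τ => Repr c ((p.sem c)^[i] A) (fun _ => 0) τ ∧
      (∀ j < d, τ.reg (sc j) = σ.reg (sc j)) ∧ τ.reg (sc d) = i) (c.n + 1) ?_ ?_ ?_))) ?_ ?_
    · rintro i τ hi ⟨hτ, hsc, hd⟩
      refine ⟨by simpa [Test.Holds, hd, hτ.hN] using hi, .seq ((hP c _ τ hτ).mono le_rfl ?_)⟩
      rintro υ ⟨hυ, hsc'⟩
      refine .inc ⟨?_, fun j hj => ?_, ?_⟩
      · rw [Function.iterate_succ_apply']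
        exact hυ.frame ((Frame.refl d υ).setReg (.sc le_rfl))
      · rw [State.setReg_reg, if_neg (by simp only [sc]; omega), hsc' j (by omega), hsc j hj]
      · rw [State.setReg_reg, if_pos rfl, hsc' d (by omega), hd]
    · rintro τ ⟨hτ, hsc, hd⟩
      simp [Test.Holds, hd, hτ.hN]
    · exact ⟨h.frame hf₀, fun j hj => hf₀.reg _ (not_junk_sc hj), by simp⟩
    · have := one_le_expFactor_pow c.k p.depth
      simp only [Polynomial.eval_add, Polynomial.eval_one, Polynomial.eval_mul, Polynomial.eval_X,
        Polynomial.eval_ofNat, Cmd.depth]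
      nlinarith
    · rintro τ ⟨hτ, hsc, hd⟩
      exact ⟨hτ, hsc⟩
  | rept p ih =>
    intro d
    obtain ⟨P, hP⟩ := ih (d + 2)
    refine ⟨20 + P, fun c A σ h => ?_⟩
    have hf₀ : Frame d σ ((σ.setReg (sc d) 2).setReg (sc (d + 1)) 0) :=
      ((Frame.refl d σ).setReg (.sc le_rfl)).setReg (.sc (by omega))
    refine Runs.mono (T := 1 + (1 + (10 * expFactor c.k + (1 + (2 ^ (c.k + 1) *
      ((P.eval (c.n + 1) * expFactor c.k ^ p.depth + 1) + 1) + 1)))))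
      (.seq (.const (.seq (.const (.seq ((doubling_runs (d := d)
        (by rw [hf₀.reg 2 (not_junk_of_lt (by omega)), h.hk]) (by simp [sc])
        (by simp)).mono le_rfl ?_)))))) ?_ fun _ h => h
    · rintro τ ⟨hf, hE⟩
      have hf₁ := (hf₀.trans hf).setReg (r := sc (d + 1)) (w := 0) (.sc (by omega))
      refine .seq (.const ((Runs.loop (fun i τ => Repr c ((p.sem c)^[i] A) (fun _ => 0) τ ∧
        (∀ j < d, τ.reg (sc j) = σ.reg (sc j)) ∧ τ.reg (sc d) = 2 ^ (c.k + 1) ∧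
        τ.reg (sc (d + 1)) = i) (2 ^ (c.k + 1)) ?_ ?_ ?_).mono le_rfl ?_))
      · rintro i τ hi ⟨hτ, hsc, hd, hd'⟩
        refine ⟨by simpa [Test.Holds, hd, hd'] using hi, .seq ((hP c _ τ hτ).mono le_rfl ?_)⟩
        rintro υ ⟨hυ, hsc'⟩
        refine .inc ⟨?_, fun j hj => ?_, ?_, ?_⟩
        · rw [Function.iterate_succ_apply']
          exact hυ.frame ((Frame.refl d υ).setReg (.sc (by omega)))
        · rw [State.setReg_reg, if_neg (by simp only [sc]; omega), hsc' j (by omega), hsc j hj]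
        · rw [State.setReg_reg, if_neg (by simp only [sc]; omega), hsc' d (by omega), hd]
        · rw [State.setReg_reg, if_pos rfl, hsc' (d + 1) (by omega), hd']
      · rintro τ ⟨hτ, hsc, hd, hd'⟩
        simp [Test.Holds, hd, hd']
      · exact ⟨h.frame hf₁, fun j hj => hf₁.reg _ (not_junk_sc hj), by
          rw [State.setReg_reg, if_neg (by simp only [sc]; omega), hE], by simp⟩
      · rintro τ ⟨hτ, hsc, hd⟩
        exact ⟨hτ, hsc⟩
    · have e1 := one_le_expFactor_pow c.k p.depth
      have e2 : 2 ^ (c.k + 1) ≤ expFactor c.k := by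
        unfold expFactor; exact Nat.le_mul_of_pos_left _ (by omega)
      have e3 : 1 ≤ 2 ^ (c.k + 1) := Nat.one_le_two_pow
      simp only [Polynomial.eval_add, Polynomial.eval_ofNat, Cmd.depth, pow_succ]
      set F := expFactor c.k
      set G := F ^ p.depth
      set p' := P.eval (c.n + 1)
      have e4 : F ≤ G * F := Nat.le_mul_of_pos_left _ e1
      have e5 : 2 ^ (c.k + 1) * (p' * G) ≤ p' * (G * F) := by
        calc 2 ^ (c.k + 1) * (p' * G) ≤ F * (p' * G) := Nat.mul_le_mul_right _ e2
          _ = _ := by ring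
      rw [← pow_succ]
      rw [mul_add, mul_add]
      rw [add_mul]
      omega

end STVD

namespace STVD

/-! ### Bipartite tournaments -/

/-- The relation `arc` orients all pairs of elements of different types `T₀`, `T₁`, which are
numbers below `n`. -/
structure IsBipTournament (n : ℕ) (arc : ℕ → ℕ → Prop) (T₀ T₁ : ℕ → Prop) : Prop where
  bip : ∀ {x y}, arc x y → (T₀ x ∧ T₁ y) ∨ (T₁ x ∧ T₀ y)
  disj : ∀ {x}, T₀ x → ¬ T₁ x
  tour : ∀ {x y}, T₀ x → T₁ y → (arc x y ↔ ¬ arc y x)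
  lt : ∀ {x}, T₀ x ∨ T₁ x → x < n

/-- There is no directed cycle of length four in `X`. -/
def Acyc (arc : ℕ → ℕ → Prop) (X : Set ℕ) : Prop :=
  ∀ x ∈ X, ∀ y ∈ X, ∀ z ∈ X, ∀ w ∈ X, arc x y → arc y z → arc z w → arc w x → False

theorem Acyc.mono {arc : ℕ → ℕ → Prop} {X Y : Set ℕ} (h : Acyc arc Y) (hXY : X ⊆ Y) :
    Acyc arc X :=
  fun x hx y hy z hz w hw => h x (hXY hx) y (hXY hy) z (hXY hz) w (hXY hw)

/-- The elements of `K` below `n + 1`. -/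
def below (n : ℕ) (K : ℕ → Prop) : Set ℕ := {x | x < n + 1 ∧ K x}

/-- All in-neighbours of `p` in `K` are in-neighbours of `z`. -/
def InSub (n : ℕ) (arc : ℕ → ℕ → Prop) (K : ℕ → Prop) (p z : ℕ) : Prop :=
  ∀ w < n + 1, K w → arc w p → arc w z

/-- The order in which elements of the same type are taken. -/
def Before (n : ℕ) (arc : ℕ → ℕ → Prop) (K R : ℕ → Prop) (p z : ℕ) : Prop :=
  InSub n arc K p z ∧ (¬ InSub n arc K z p ∨ InSub n arc R p z ∧ (¬ InSub n arc R z p ∨ z < p))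

/-- There is a directed path of length three from `z` to `q` with its inner vertices in `K`. -/
def Path3 (n : ℕ) (arc : ℕ → ℕ → Prop) (K : ℕ → Prop) (q z : ℕ) : Prop :=
  ∃ x < n + 1, ∃ y < n + 1, K x ∧ K y ∧ arc z x ∧ arc x y ∧ arc y q

/-- `z` lies in `R` and in no directed cycle of length four with the other vertices in `K`. -/
def Fits (n : ℕ) (arc : ℕ → ℕ → Prop) (K R : ℕ → Prop) (z : ℕ) : Prop :=
  R z ∧ ¬ ∃ w < n + 1, K w ∧ Path3 n arc K w z ∧ arc w z

/-- `m'` is one of `m` and `z` with the most in-neighbours in `R`. -/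
def IsMax (n : ℕ) (arc : ℕ → ℕ → Prop) (R : ℕ → Prop) (m z m' : ℕ) : Prop :=
  (m' = z ∧ InSub n arc R m z) ∨ (m' = m ∧ InSub n arc R z m)

/-- The element `z` can be added to a set whose last element of the type of `z` is `p`, and whose
last element and whose element with the most in-neighbours of the other type are `q` and `m`. -/
def CanAdd (n : ℕ) (arc : ℕ → ℕ → Prop) (K R : ℕ → Prop) (z p q m : ℕ) : Prop :=
  Fits n arc K R z ∧ Before n arc K R p z ∧ ¬ arc z m ∧ ¬ Path3 n arc K q z

/-- From the states that are reachable with `m` elements, those reachable with `m + 1` elements. -/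
def Step (n : ℕ) (arc : ℕ → ℕ → Prop) (K R T₀ T₁ : ℕ → Prop) (Q : ℕ → ℕ → ℕ → ℕ → Prop)
    (p q m l : ℕ) : Prop :=
  (∃ p' < n + 1, ∃ m' < n + 1, Q p' q m' l ∧ T₁ p ∧ CanAdd n arc K R p p' q l ∧
    IsMax n arc R m' p m) ∨
  (∃ q' < n + 1, ∃ l' < n + 1, Q p q' m l' ∧ T₀ q ∧ CanAdd n arc K R q q' p m ∧
    IsMax n arc R l' q l)

def Start (n : ℕ) (p q m l : ℕ) : Prop := n ≤ p ∧ n ≤ q ∧ n ≤ m ∧ n ≤ l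

section

variable {n : ℕ} {arc : ℕ → ℕ → Prop} {T₀ T₁ K R : ℕ → Prop}

theorem IsBipTournament.symm (h : IsBipTournament n arc T₀ T₁) : IsBipTournament n arc T₁ T₀ where
  bip hxy := (h.bip hxy).symm
  disj h₁ h₀ := h.disj h₀ h₁
  tour hx hy := by rw [h.tour hy hx]; simp
  lt hx := h.lt hx.symm

theorem IsBipTournament.asymm (h : IsBipTournament n arc T₀ T₁) {x y : ℕ} (hxy : arc x y) :
    ¬ arc y x := by
  rcases h.bip hxy with ⟨h0, h1⟩ | ⟨h1, h0⟩
  · exact (h.tour h0 h1).1 hxy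
  · exact (h.symm.tour h1 h0).1 hxy

theorem IsBipTournament.lt_left (h : IsBipTournament n arc T₀ T₁) {x y : ℕ} (hxy : arc x y) :
    x < n := h.lt ((h.bip hxy).imp And.left And.left)

theorem IsBipTournament.lt_right (h : IsBipTournament n arc T₀ T₁) {x y : ℕ} (hxy : arc x y) :
    y < n := h.lt ((h.bip hxy).imp And.right And.right).symm

/-- The type of the ends of an arc are different. -/
theorem IsBipTournament.type_right (h : IsBipTournament n arc T₀ T₁) {x y : ℕ} (hxy : arc x y)
    (hx : T₀ x) : T₁ y := by
  rcases h.bip hxy with h' | h'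
  · exact h'.2
  · exact absurd h'.1 (h.disj hx)

theorem IsBipTournament.type_left (h : IsBipTournament n arc T₀ T₁) {x y : ℕ} (hxy : arc x y)
    (hy : T₀ y) : T₁ x := by
  rcases h.bip hxy with h' | h'
  · exact absurd h'.2 (h.disj hy)
  · exact h'.1

theorem InSub.refl (p : ℕ) : InSub n arc K p p := fun _ _ _ h => h

theorem InSub.trans {p q r : ℕ} (h : InSub n arc K p q) (h' : InSub n arc K q r) :
    InSub n arc K p r := fun w hw hK ha => h' w hw hK (h w hw hK ha)

theorem Before.trans {p q r : ℕ} (h : Before n arc K R p q) (h' : Before n arc K R q r) :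
    Before n arc K R p r := by
  obtain ⟨h1, h2⟩ := h
  obtain ⟨h1', h2'⟩ := h'
  refine ⟨h1.trans h1', ?_⟩
  by_cases hrp : InSub n arc K r p
  · refine .inr ?_
    obtain ⟨h3, h4⟩ := h2.resolve_left fun hn => hn (h1'.trans hrp)
    obtain ⟨h3', h4'⟩ := h2'.resolve_left fun hn => hn (hrp.trans h1)
    refine ⟨h3.trans h3', ?_⟩
    by_cases hrp' : InSub n arc R r p
    · have := h4.resolve_left fun hn => hn (h3'.trans hrp')
      have := h4'.resolve_left fun hn => hn (hrp'.trans h3)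
      exact .inr (by omega)
    · exact .inl hrp'
  · exact .inl hrp

theorem Before.irrefl (p : ℕ) : ¬ Before n arc K R p p := by
  rintro ⟨h1, h2⟩
  rcases h2 with h2 | ⟨h2, h3 | h3⟩
  · exact h2 h1
  · exact h3 h2
  · omega

/-! ### Soundness of the dynamic program -/

/-- A summary of the elements of the type `τ` of `T`: `p` is the last one, and `m` is the one with
the most in-neighbours. -/
def Summary (n : ℕ) (arc : ℕ → ℕ → Prop) (K R τ : ℕ → Prop) (T : Finset ℕ) (p m : ℕ) : Prop :=
  ∀ y ∈ T, τ y → InSub n arc K y p ∧ (y = p ∨ Before n arc K R y p) ∧ InSub n arc R y m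

theorem Summary.insert_self {T : Finset ℕ} {z p m m' : ℕ} (h : Summary n arc K R T₀ T p m)
    (hb : Before n arc K R p z) (hm : IsMax n arc R m z m') :
    Summary n arc K R T₀ (insert z T) z m' := by
  have hmm : InSub n arc R m m' ∧ InSub n arc R z m' := by
    rcases hm with ⟨rfl, hm⟩ | ⟨rfl, hm⟩
    · exact ⟨hm, .refl _⟩
    · exact ⟨.refl _, hm⟩
  intro y hy hτ
  rcases Finset.mem_insert.1 hy with rfl | hy
  · exact ⟨.refl _, .inl rfl, hmm.2⟩
  · obtain ⟨h1, h2, h3⟩ := h y hy hτ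
    refine ⟨h1.trans hb.1, .inr ?_, h3.trans hmm.1⟩
    rcases h2 with rfl | h2
    · exact hb
    · exact h2.trans hb

theorem Summary.insert_of_not {T : Finset ℕ} {z p m : ℕ} (h : Summary n arc K R T₀ T p m)
    (hz : ¬ T₀ z) : Summary n arc K R T₀ (insert z T) p m := by
  intro y hy hτ
  rcases Finset.mem_insert.1 hy with rfl | hy
  · exact absurd hτ hz
  · exact h y hy hτ

/-- Strictness of `Before` makes every added element new, so that the number of steps is the number
of elements. -/
theorem Summary.notMem {T : Finset ℕ} {z p m : ℕ} (h : Summary n arc K R T₀ T p m)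
    (hz : T₀ z) (hb : Before n arc K R p z) : z ∉ T := by
  intro hzT
  rcases (h z hzT hz).2.1 with rfl | h2
  · exact Before.irrefl _ hb
  · exact Before.irrefl _ (h2.trans hb)

/-- Adding an element keeps a set acyclic. -/
theorem CanAdd.acyc (h : IsBipTournament n arc T₀ T₁) {T : Finset ℕ} {z p m q l : ℕ}
    (hT : Acyc arc (below n K ∪ T)) (hs : Summary n arc K R T₀ T p m)
    (hs' : Summary n arc K R T₁ T q l) (hz : T₀ z) (ha : CanAdd n arc K R z p q l) :
    Acyc arc (below n K ∪ (insert z T : Finset ℕ)) := by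
  obtain ⟨⟨hzR, hfit⟩, hb, hl, hq⟩ := ha
  have hz1 : z < n + 1 := (h.lt (.inl hz)).trans (Nat.lt_succ_self n)
  have key : ∀ x ∈ below n K ∪ T, ∀ y ∈ below n K ∪ T, ∀ w ∈ below n K ∪ T,
      arc z x → arc x y → arc y w → arc w z → False := by
    intro x hx y hy w hw h1 h2 h3 h4
    have tx := h.type_right h1 hz
    have ty := h.symm.type_right h2 tx
    have tw := h.type_right h3 ty
    -- No arc leads from `z` into `T`: the head would have the in-neighbour `z` in `R`, hence so
    -- would `l`, which has the most of them.
    have hxK : x ∈ below n K := by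
      refine hx.resolve_right fun hxT => hl ?_
      exact (hs' x hxT tx).2.2 z hz1 hzR h1
    -- The vertex `y` has the type of `z`. Were it in `T`, its in-neighbour `x` in `K` would be
    -- inherited by `p` and then by `z`, against `z → x`.
    have hyK : y ∈ below n K := by
      refine hy.resolve_right fun hyT => h.asymm h1 ?_
      exact ((hs y hyT ty).1.trans hb.1) x hxK.1 hxK.2 h2
    rcases hw with hw | hw
    -- If `w` is in `K`, the whole cycle apart from `z` is, which `Fits` excludes. If `w` is in `T`,
    -- then `y → w` implies `y → q`, as the last element of a type has the most in-neighbours in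
    -- `K`; so `z` would reach `q` by a path through `K`.
    · exact hfit ⟨w, hw.1, hw.2, ⟨x, hxK.1, y, hyK.1, hxK.2, hyK.2, h1, h2, h3⟩, h4⟩
    · exact hq ⟨x, hxK.1, y, hyK.1, hxK.2, hyK.2, h1, h2, (hs' w hw tw).1 y hyK.1 hyK.2 h3⟩
  have mem : ∀ x ∈ below n K ∪ ((insert z T : Finset ℕ) : Set ℕ), x = z ∨ x ∈ below n K ∪ T := by
    intro x hx
    rcases hx with hx | hx
    · exact .inr (.inl hx)
    · rcases Finset.mem_insert.1 hx with rfl | hx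
      · exact .inl rfl
      · exact .inr (.inr hx)
  have ne1 : ∀ x, arc z x → x ≠ z := by
    rintro x h1 rfl; exact h.asymm h1 h1
  have ne2 : ∀ x, arc x z → x ≠ z := by
    rintro x h1 rfl; exact h.asymm h1 h1
  have key' : ∀ x ∈ below n K ∪ ((insert z T : Finset ℕ) : Set ℕ),
      ∀ y ∈ below n K ∪ ((insert z T : Finset ℕ) : Set ℕ),
      ∀ w ∈ below n K ∪ ((insert z T : Finset ℕ) : Set ℕ),
      arc z x → arc x y → arc y w → arc w z → False := by
    intro x hx y hy w hw h1 h2 h3 h4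
    have hyz : y ≠ z := by rintro rfl; exact h.asymm h1 h2
    exact key x ((mem x hx).resolve_left (ne1 x h1)) y ((mem y hy).resolve_left hyz) w
      ((mem w hw).resolve_left (ne2 w h4)) h1 h2 h3 h4
  -- A cycle through `z` is rotated so that it starts at `z`; any other cycle lies in the old set.
  intro x hx y hy w hw u hu h1 h2 h3 h4
  rcases mem x hx with rfl | hx'
  · exact key' y hy w hw u hu h1 h2 h3 h4
  rcases mem y hy with rfl | hy'
  · exact key' w hw u hu x hx h2 h3 h4 h1
  rcases mem w hw with rfl | hw'
  · exact key' u hu x hx y hy h3 h4 h1 h2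
  rcases mem u hu with rfl | hu'
  · exact key' x hx y hy w hw h4 h1 h2 h3
  exact hT x hx' y hy' w hw' u hu' h1 h2 h3 h4

/-- The summaries make tests against four elements conclusive for all of `T`. For the empty set they
hold vacuously, whatever the four marks are. -/
theorem exists_finset_of_iterate_step (h : IsBipTournament n arc T₀ T₁)
    (hK : Acyc arc (below n K)) (j : ℕ) :
    ∀ p q m l, (Step n arc K R T₀ T₁)^[j] (Start n) p q m l → ∃ T : Finset ℕ, T.card = j ∧
      (∀ x ∈ T, R x) ∧ Acyc arc (below n K ∪ T) ∧ Summary n arc K R T₁ T p m ∧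
      Summary n arc K R T₀ T q l := by
  induction j with
  | zero =>
    intro p q m l _
    refine ⟨∅, rfl, by simp, by simpa using hK, ?_, ?_⟩ <;> exact fun y hy => by simp at hy
  | succ j ih =>
    intro p q m l hs
    rw [Function.iterate_succ_apply'] at hs
    rcases hs with ⟨p', _, m', _, hQ, hp, hadd, hmax⟩ | ⟨q', _, l', _, hQ, hq, hadd, hmax⟩
    · obtain ⟨T, hc, hTR, hT, hs, hs'⟩ := ih _ _ _ _ hQ
      have hb := hadd.2.1
      refine ⟨insert p T, ?_, ?_, hadd.acyc h.symm hT hs hs' hp, hs.insert_self hb hmax,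
        hs'.insert_of_not (h.symm.disj hp)⟩
      · rw [Finset.card_insert_of_notMem (hs.notMem hp hb), hc]
      · intro x hx
        rcases Finset.mem_insert.1 hx with rfl | hx
        · exact hadd.1.1
        · exact hTR x hx
    · obtain ⟨T, hc, hTR, hT, hs, hs'⟩ := ih _ _ _ _ hQ
      have hb := hadd.2.1
      refine ⟨insert q T, ?_, ?_, hadd.acyc h hT hs' hs hq,
        hs.insert_of_not (h.disj hq), hs'.insert_self hb hmax⟩
      · rw [Finset.card_insert_of_notMem (hs'.notMem hq hb), hc]
      · intro x hx
        rcases Finset.mem_insert.1 hx with rfl | hx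
        · exact hadd.1.1
        · exact hTR x hx

/-! ### Completeness of the dynamic program -/

theorem exists_last {α : Type*} [DecidableEq α] (r : α → α → Prop) (T : Finset α)
    (hT : T.Nonempty)
    (htrans : ∀ x ∈ T, ∀ y ∈ T, ∀ z ∈ T, r x y → r y z → r x z)
    (htotal : ∀ x ∈ T, ∀ y ∈ T, x ≠ y → r x y ∨ r y x) :
    ∃ z ∈ T, ∀ x ∈ T, x ≠ z → r x z := by
  induction hT using Finset.Nonempty.cons_induction with
  | singleton a => exact ⟨a, by simp, by simp⟩
  | cons a s ha hs ih =>
    obtain ⟨z, hz, hmax⟩ := ih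
      (fun x hx y hy w hw => htrans x (by simp [hx]) y (by simp [hy]) w (by simp [hw]))
      (fun x hx y hy => htotal x (by simp [hx]) y (by simp [hy]))
    have haz : a ≠ z := by rintro rfl; exact ha hz
    rcases htotal a (by simp) z (by simp [hz]) haz with h | h
    · refine ⟨z, by simp [hz], fun x hx hxz => ?_⟩
      rcases Finset.mem_cons.1 hx with rfl | hx
      · exact h
      · exact hmax x hx hxz
    · refine ⟨a, by simp, fun x hx hxa => ?_⟩
      have hx := (Finset.mem_cons.1 hx).resolve_left hxa
      by_cases hxz : x = z
      · rw [hxz]; exact h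
      · exact htrans x (by simp [hx]) z (by simp [hz]) a (by simp) (hmax x hx hxz) h

/-- In-neighbourhoods in an acyclic set are nested. -/
theorem inSub_total (h : IsBipTournament n arc T₀ T₁) {X : Set ℕ} (hX : Acyc arc X)
    (hKX : below n K ⊆ X) {x y : ℕ} (hx : x ∈ X) (hy : y ∈ X) (hx0 : T₀ x) (hy0 : T₀ y) :
    InSub n arc K x y ∨ InSub n arc K y x := by
  by_contra! hc
  obtain ⟨h1, h2⟩ := hc
  simp only [InSub, not_forall] at h1 h2
  obtain ⟨w, hw, hwK, hwx, hwy⟩ := h1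
  obtain ⟨u, hu, huK, huy, hux⟩ := h2
  have tw := h.type_left hwx hx0
  have tu := h.type_left huy hy0
  have e1 : arc y w := (h.tour hy0 tw).2 hwy
  have e2 : arc x u := (h.tour hx0 tu).2 hux
  exact hX w (hKX ⟨hw, hwK⟩) x hx u (hKX ⟨hu, huK⟩) y hy hwx e2 huy e1

/-- The order is lexicographic: in-neighbours in `K`, then in-neighbours in `R`, then the larger
number first. The first two comparisons are total because `X` and `R` are acyclic, and the third one
breaks ties. -/
theorem before_total (h : IsBipTournament n arc T₀ T₁) {X : Set ℕ} (hX : Acyc arc X)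
    (hKX : below n K ⊆ X) (hR : Acyc arc (below n R)) {x y : ℕ} (hx : x ∈ X) (hy : y ∈ X)
    (hx0 : T₀ x) (hy0 : T₀ y) (hxR : x ∈ below n R) (hyR : y ∈ below n R) (hxy : x ≠ y) :
    Before n arc K R x y ∨ Before n arc K R y x := by
  by_cases h1 : InSub n arc K x y
  · by_cases h2 : InSub n arc K y x
    · by_cases h3 : InSub n arc R x y
      · by_cases h4 : InSub n arc R y x
        · rcases Nat.lt_or_gt_of_ne hxy with hlt | hlt
          · exact .inr ⟨h2, .inr ⟨h4, .inr hlt⟩⟩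
          · exact .inl ⟨h1, .inr ⟨h3, .inr hlt⟩⟩
        · exact .inl ⟨h1, .inr ⟨h3, .inl h4⟩⟩
      · have h4 := (inSub_total h hR le_rfl hxR hyR hx0 hy0).resolve_left h3
        exact .inr ⟨h2, .inr ⟨h4, .inl h3⟩⟩
    · exact .inl ⟨h1, .inl h2⟩
  · exact .inr ⟨(inSub_total h hX hKX hx hy hx0 hy0).resolve_left h1, .inl h1⟩

/-- The order in which the elements of an acyclic set are taken. -/
def Prec (n : ℕ) (arc : ℕ → ℕ → Prop) (T₀ T₁ K R : ℕ → Prop) (x y : ℕ) : Prop :=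
  ((T₀ x ∧ T₀ y ∨ T₁ x ∧ T₁ y) ∧ Before n arc K R x y) ∨ arc x y

theorem Prec.symm {x y : ℕ} (h : Prec n arc T₀ T₁ K R x y) : Prec n arc T₁ T₀ K R x y :=
  h.imp (fun h => ⟨h.1.symm, h.2⟩) id

theorem prec_total (h : IsBipTournament n arc T₀ T₁) {X : Set ℕ} (hX : Acyc arc X)
    (hKX : below n K ⊆ X) (hR : Acyc arc (below n R)) {x y : ℕ} (hx : x ∈ X) (hy : y ∈ X)
    (hx0 : T₀ x) (hy0 : T₀ y ∨ T₁ y) (hxR : x ∈ below n R) (hyR : y ∈ below n R) (hxy : x ≠ y) :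
    Prec n arc T₀ T₁ K R x y ∨ Prec n arc T₀ T₁ K R y x := by
  rcases hy0 with hy0 | hy1
  · exact (before_total h hX hKX hR hx hy hx0 hy0 hxR hyR hxy).imp
      (fun hb => .inl ⟨.inl ⟨hx0, hy0⟩, hb⟩) (fun hb => .inl ⟨.inl ⟨hy0, hx0⟩, hb⟩)
  · by_cases ha : arc x y
    · exact .inl (.inr ha)
    · exact .inr (.inr ((h.symm.tour hy1 hx0).2 ha))

/-- A failure would close a directed cycle. Suppose that `x` is before `y` and `y → z`, but `z → x`.
If some `w` in `K` is an in-neighbour of `y` and not of `x`, then `y → z → x → w → y` is a cycle;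
otherwise all in-neighbours of `x` in `R`, such as `z`, are in-neighbours of `y`. The case `x → y`
with `y` before `z` is similar. If `x → y → z`, acyclicity makes every in-neighbour of `x`, in `K`
as in `R`, one of `z`, and `y` itself shows that the inclusion in `R` is strict. -/
theorem prec_trans (h : IsBipTournament n arc T₀ T₁) {X : Set ℕ} (hX : Acyc arc X)
    (hKX : below n K ⊆ X) (hR : Acyc arc (below n R)) {x y z : ℕ} (hx : x ∈ X) (hy : y ∈ X)
    (hz : z ∈ X) (hx0 : T₀ x) (hxR : x ∈ below n R) (hyR : y ∈ below n R) (hzR : z ∈ below n R)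
    (hxy : Prec n arc T₀ T₁ K R x y) (hyz : Prec n arc T₀ T₁ K R y z) :
    Prec n arc T₀ T₁ K R x z := by
  rcases hxy with ⟨ht, hxy⟩ | hxy
  · have hy0 : T₀ y := (ht.resolve_right fun ht => h.disj hx0 ht.1).2
    rcases hyz with ⟨ht', hyz⟩ | hyz
    · have hz0 : T₀ z := (ht'.resolve_right fun ht => h.disj hy0 ht.1).2
      exact .inl ⟨.inl ⟨hx0, hz0⟩, hxy.trans hyz⟩
    · have hz1 := h.type_right hyz hy0
      refine .inr ((h.tour hx0 hz1).2 fun hzx => ?_)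
      rcases hxy.2 with h2 | ⟨h2, _⟩
      · simp only [InSub, not_forall] at h2
        obtain ⟨w, hw, hwK, hwy, hwx⟩ := h2
        have e : arc x w := (h.tour hx0 (h.type_left hwy hy0)).2 hwx
        exact hX y hy z hz x hx w (hKX ⟨hw, hwK⟩) hyz hzx e hwy
      · exact h.asymm hyz (h2 z hzR.1 hzR.2 hzx)
  · have hy1 := h.type_right hxy hx0
    rcases hyz with ⟨ht', hyz⟩ | hyz
    · have hz1 : T₁ z := (ht'.resolve_left fun ht => h.disj ht.1 hy1).2
      refine .inr ((h.tour hx0 hz1).2 fun hzx => ?_)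
      rcases hyz.2 with h2 | ⟨h2, _⟩
      · simp only [InSub, not_forall] at h2
        obtain ⟨w, hw, hwK, hwz, hwy⟩ := h2
        have e : arc y w := (h.symm.tour hy1 (h.symm.type_left hwz hz1)).2 hwy
        exact hX x hx y hy w (hKX ⟨hw, hwK⟩) z hz hxy e hwz hzx
      · exact h.asymm hzx (h2 x hxR.1 hxR.2 hxy)
    · have hz0 := h.symm.type_right hyz hy1
      have sub : ∀ {L : ℕ → Prop} {Y : Set ℕ}, Acyc arc Y → below n L ⊆ Y → x ∈ Y → y ∈ Y → z ∈ Y →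
          InSub n arc L x z := by
        intro L Y hY hLY hx hy hz w hw hwL hwx
        by_contra hwz
        have e : arc z w := (h.tour hz0 (h.type_left hwx hx0)).2 hwz
        exact hY w (hLY ⟨hw, hwL⟩) x hx y hy z hz hwx hxy hyz e
      refine .inl ⟨.inl ⟨hx0, hz0⟩, sub hX hKX hx hy hz, .inr ⟨sub hR le_rfl hxR hyR hzR,
        .inl fun hs => h.asymm hxy (hs y hyR.1 hyR.2 hyz)⟩⟩

/-- `p` is an element of `T` of the type `τ`, or marks that there is none. -/
def Marks (n : ℕ) (τ : ℕ → Prop) (T : Finset ℕ) (p : ℕ) : Prop := p = n ∨ p ∈ T ∧ τ p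

theorem Marks.mono {τ : ℕ → Prop} {S T : Finset ℕ} {p : ℕ} (h : Marks n τ S p) (hST : S ⊆ T) :
    Marks n τ T p := h.imp id fun h => ⟨hST h.1, h.2⟩

/-- All other elements of the opposite type have arcs into the last element `z`, so a failing test
would produce a cycle or a pair of opposite arcs. The argument works for arbitrary marks of the
right types in `T.erase z`; they need not be last or maximal. -/
theorem canAdd_last (h : IsBipTournament n arc T₀ T₁) {T : Finset ℕ}
    (hT : Acyc arc (below n K ∪ T)) (hTR : ∀ x ∈ T, R x) {z p q m : ℕ} (hz : z ∈ T) (hz0 : T₀ z)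
    (hlast : ∀ x ∈ T, x ≠ z → Prec n arc T₀ T₁ K R x z) (hp : Marks n T₀ (T.erase z) p)
    (hq : Marks n T₁ (T.erase z) q) (hm : Marks n T₁ (T.erase z) m) :
    CanAdd n arc K R z p q m := by
  have harc : ∀ x, x ∈ T.erase z ∧ T₁ x → arc x z := by
    rintro x ⟨hx, hx1⟩
    rcases hlast x (Finset.mem_of_mem_erase hx) (Finset.ne_of_mem_erase hx) with ⟨ht, _⟩ | ha
    · rcases ht with ht | ht
      · exact absurd hx1 (h.disj ht.1)
      · exact absurd ht.2 (h.disj hz0)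
    · exact ha
  have hzT : z ∈ below n K ∪ (T : Set ℕ) := .inr hz
  refine ⟨⟨hTR z hz, ?_⟩, ?_, ?_, ?_⟩
  · rintro ⟨w, hw, hwK, ⟨x, hx, y, hy, hxK, hyK, h1, h2, h3⟩, h4⟩
    exact hT z hzT x (.inl ⟨hx, hxK⟩) y (.inl ⟨hy, hyK⟩) w (.inl ⟨hw, hwK⟩) h1 h2 h3 h4
  · rcases hp with rfl | ⟨hp, hp0⟩
    · have e : ∀ L : ℕ → Prop, InSub p arc L p z := fun L w _ _ hw =>
        absurd (h.lt_right hw) (lt_irrefl _)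
      exact ⟨e K, .inr ⟨e R, .inr (h.lt (.inl hz0))⟩⟩
    · rcases hlast p (Finset.mem_of_mem_erase hp) (Finset.ne_of_mem_erase hp) with ⟨_, hb⟩ | ha
      · exact hb
      · exact absurd (h.type_right ha hp0) (h.disj hz0)
  · intro hzm
    rcases hm with rfl | hm
    · exact absurd (h.lt_right hzm) (lt_irrefl _)
    · exact h.asymm hzm (harc m hm)
  · rintro ⟨x, hx, y, hy, hxK, hyK, h1, h2, h3⟩
    rcases hq with rfl | hq
    · exact absurd (h.lt_right h3) (lt_irrefl _)
    · exact hT z hzT x (.inl ⟨hx, hxK⟩) y (.inl ⟨hy, hyK⟩) q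
        (.inr (Finset.mem_of_mem_erase hq.1)) h1 h2 h3 (harc q hq)

theorem exists_isMax (h : IsBipTournament n arc T₀ T₁) (hR : Acyc arc (below n R))
    {T : Finset ℕ} (hTR : ∀ x ∈ T, R x) {z m : ℕ} (hz : z ∈ T) (hz0 : T₀ z)
    (hm : Marks n T₀ (T.erase z) m) : ∃ m', Marks n T₀ T m' ∧ IsMax n arc R m z m' := by
  rcases hm with rfl | ⟨hm, hm0⟩
  · exact ⟨z, .inr ⟨hz, hz0⟩, .inl ⟨rfl, fun w _ _ hw => absurd (h.lt_right hw) (lt_irrefl _)⟩⟩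
  · have hmT := Finset.mem_of_mem_erase hm
    have hlt : ∀ {x}, T₀ x → x < n + 1 := fun hx => (h.lt (.inl hx)).trans (Nat.lt_succ_self n)
    rcases inSub_total h hR le_rfl ⟨hlt hm0, hTR m hmT⟩ ⟨hlt hz0, hTR z hz⟩ hm0 hz0 with hs | hs
    · exact ⟨z, .inr ⟨hz, hz0⟩, .inl ⟨rfl, hs⟩⟩
    · exact ⟨m, .inr ⟨hmT, hm0⟩, .inr ⟨rfl, hs⟩⟩

theorem Marks.lt (h : IsBipTournament n arc T₀ T₁) {T : Finset ℕ} {p : ℕ}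
    (hp : Marks n T₀ T p) : p < n + 1 := by
  rcases hp with rfl | hp
  · exact Nat.lt_succ_self _
  · exact (h.lt (.inl hp.2)).trans (Nat.lt_succ_self n)

/-- Removing the last element in the order `Prec` reduces `j + 1` to `j`. By `canAdd_last` it is
enough to know that the marks belong to the set and have the right types, so no summary is carried
along. -/
theorem exists_iterate_step_of_finset (h : IsBipTournament n arc T₀ T₁)
    (hR : Acyc arc (below n R)) (hRT : ∀ x, R x → T₀ x ∨ T₁ x) (j : ℕ) :
    ∀ T : Finset ℕ, T.card = j → (∀ x ∈ T, R x) → Acyc arc (below n K ∪ T) →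
    ∃ p q m l, (Step n arc K R T₀ T₁)^[j] (Start n) p q m l ∧ Marks n T₁ T p ∧ Marks n T₀ T q ∧
      Marks n T₁ T m ∧ Marks n T₀ T l := by
  induction j with
  | zero =>
    intro T _ _ _
    exact ⟨n, n, n, n, ⟨le_rfl, le_rfl, le_rfl, le_rfl⟩, .inl rfl, .inl rfl, .inl rfl, .inl rfl⟩
  | succ j ih =>
    intro T hc hTR hT
    have hlt : ∀ x ∈ T, x ∈ below n R := fun x hx =>
      ⟨(h.lt (hRT x (hTR x hx))).trans (Nat.lt_succ_self n), hTR x hx⟩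
    have hKX : below n K ⊆ below n K ∪ (T : Set ℕ) := Set.subset_union_left
    obtain ⟨z, hz, hlast⟩ := exists_last (Prec n arc T₀ T₁ K R) T
      (Finset.card_pos.1 (by omega))
      (fun x hx y hy w hw h1 h2 => by
        rcases hRT x (hTR x hx) with hx0 | hx1
        · exact prec_trans h hT hKX hR (.inr hx) (.inr hy) (.inr hw) hx0 (hlt x hx) (hlt y hy)
            (hlt w hw) h1 h2
        · exact (prec_trans h.symm hT hKX hR (.inr hx) (.inr hy) (.inr hw) hx1 (hlt x hx)
            (hlt y hy) (hlt w hw) h1.symm h2.symm).symm)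
      (fun x hx y hy hxy => by
        have hy' := hRT y (hTR y hy)
        rcases hRT x (hTR x hx) with hx0 | hx1
        · exact prec_total h hT hKX hR (.inr hx) (.inr hy) hx0 hy' (hlt x hx) (hlt y hy) hxy
        · exact (prec_total h.symm hT hKX hR (.inr hx) (.inr hy) hx1 hy'.symm (hlt x hx)
            (hlt y hy) hxy).imp Prec.symm Prec.symm)
    have hsub : T.erase z ⊆ T := Finset.erase_subset z T
    obtain ⟨p, q, m, l, hQ, hp, hq, hm, hl⟩ := ih (T.erase z)
      (by rw [Finset.card_erase_of_mem hz, hc]; rfl) (fun x hx => hTR x (hsub hx))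
      (hT.mono (Set.union_subset_union_right _ (by exact_mod_cast hsub)))
    rcases hRT z (hTR z hz) with hz0 | hz1
    · obtain ⟨l', hl', hmax⟩ := exists_isMax h hR hTR hz hz0 hl
      refine ⟨p, z, m, l', ?_, hp.mono hsub, .inr ⟨hz, hz0⟩, hm.mono hsub, hl'⟩
      rw [Function.iterate_succ_apply']
      exact .inr ⟨q, hq.lt h, l, hl.lt h, hQ, hz0, canAdd_last h hT hTR hz hz0 hlast hq hp hm, hmax⟩
    · obtain ⟨m', hm', hmax⟩ := exists_isMax h.symm hR hTR hz hz1 hm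
      refine ⟨z, q, m', l, ?_, .inr ⟨hz, hz1⟩, hq.mono hsub, hm', hl.mono hsub⟩
      rw [Function.iterate_succ_apply']
      exact .inl ⟨p, hp.lt h.symm, m, hm.lt h.symm, hQ, hz1, canAdd_last h.symm hT hTR hz hz1
        (fun x hx hxz => (hlast x hx hxz).symm) hp hq hl, hmax⟩

/-- The iteration of `Step` finds out whether `j` elements of `R` can be added to `K`. -/
theorem iterate_step_iff (h : IsBipTournament n arc T₀ T₁) (hK : Acyc arc (below n K))
    (hR : Acyc arc (below n R)) (hRT : ∀ x, R x → T₀ x ∨ T₁ x) (j : ℕ) :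
    (∃ p < n + 1, ∃ q < n + 1, ∃ m < n + 1, ∃ l < n + 1,
      (Step n arc K R T₀ T₁)^[j] (Start n) p q m l) ↔
    ∃ T : Finset ℕ, T.card = j ∧ (∀ x ∈ T, R x) ∧ Acyc arc (below n K ∪ T) := by
  constructor
  · rintro ⟨p, _, q, _, m, _, l, _, hs⟩
    obtain ⟨T, h1, h2, h3, _⟩ := exists_finset_of_iterate_step h hK j p q m l hs
    exact ⟨T, h1, h2, h3⟩
  · rintro ⟨T, h1, h2, h3⟩
    obtain ⟨p, q, m, l, hs, hp, hq, hm, hl⟩ := exists_iterate_step_of_finset h hR hRT j T h1 h2 h3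
    exact ⟨p, hp.lt h.symm, q, hq.lt h, m, hm.lt h.symm, l, hl.lt h, hs⟩

end

end STVD

namespace STVD

/-! ### Split graphs and threshold graphs -/

/-- The vertices `a`, `c`, `d`, `b` form an induced path in this order. -/
def IsPath4 {V : Type*} (g : V → V → Prop) (a c d b : V) : Prop :=
  g a c ∧ g c d ∧ g d b ∧ ¬ g a d ∧ ¬ g c b ∧ ¬ g a b

theorem IsPath4.reverse {V : Type*} {g : V → V → Prop} (hg : ∀ u v, g u v → g v u) {a c d b : V}
    (h : IsPath4 g a c d b) : IsPath4 g b d c a :=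
  ⟨hg _ _ h.2.2.1, hg _ _ h.2.1, hg _ _ h.1, fun h' => h.2.2.2.2.1 (hg _ _ h'),
    fun h' => h.2.2.2.1 (hg _ _ h'), fun h' => h.2.2.2.2.2 (hg _ _ h')⟩

open Classical in
-- If the clique vertex `c` is adjacent to `a` but not to `a'`, both in the independent set, then
-- the neighbourhood of `a'` is strictly contained in that of `a`, for otherwise there is an induced
-- path `a c d a'`. Hence `c` is adjacent exactly to those independent vertices whose degree exceeds
-- the degrees of all its independent non-neighbours.
theorem isThreshold_of_isSplit {V : Type*} [Fintype V] (G : SimpleGraph V) (hG : IsSplit G)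
    (h4 : ∀ a c d b, ¬ IsPath4 G.Adj a c d b) : IsThreshold G := by
  obtain ⟨C, I, hdisj, hunion, hC, hI⟩ := hG
  have hCI : ∀ v, v ∉ C → v ∈ I := fun v hv =>
    ((Set.ext_iff.1 hunion v).2 (Set.mem_univ v)).resolve_left hv
  have hIC : ∀ v, v ∈ I → v ∉ C := fun v hv hvC => Set.disjoint_left.1 hdisj hvC hv
  set r : V → ℕ := fun a => (Finset.univ.filter (G.Adj a)).card with hr
  set h : V → ℕ := fun c => (Finset.univ.filter fun a => a ∈ I ∧ ¬ G.Adj c a).sup fun a => r a + 1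
  set M : ℕ := Fintype.card V + 1 with hM
  have hrM : ∀ a, r a < M := fun a => Nat.lt_succ_of_le (Finset.card_le_univ _)
  have hhM : ∀ c, h c ≤ M := fun c => Finset.sup_le fun a _ => hrM a
  have hadj : ∀ c a, c ∈ C → a ∈ I → (G.Adj c a ↔ h c ≤ r a) := by
    intro c a hc ha
    constructor
    · intro hca
      refine Finset.sup_le fun a' ha' => Finset.card_lt_card ?_
      simp only [Finset.mem_filter, Finset.mem_univ, true_and] at ha'
      refine Finset.ssubset_iff_subset_ne.2 ⟨fun d hd => ?_, fun he => ?_⟩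
      · simp only [Finset.mem_filter, Finset.mem_univ, true_and] at hd ⊢
        by_contra had
        have hdC : d ∈ C := by
          by_contra hdC
          exact hI ha'.1 (hCI d hdC) hd.ne hd
        have hcd : c ≠ d := by rintro rfl; exact had hca.symm
        have haa : a ≠ a' := by rintro rfl; exact had hd
        exact h4 a c d a' ⟨hca.symm, hC hc hdC hcd, hd.symm, had, ha'.2, hI ha ha'.1 haa⟩
      · have : c ∈ Finset.univ.filter (G.Adj a) := by simpa using hca.symm
        rw [← he] at this
        exact ha'.2 (by simpa using (Finset.mem_filter.1 this).2.symm)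
    · intro hle
      by_contra hca
      have : r a + 1 ≤ h c := Finset.le_sup (f := fun a => r a + 1)
        (by simpa using ⟨ha, hca⟩)
      omega
  -- All values of `h` and `r` are at most `M`. So two clique vertices have a sum of at least `2 *
  -- M`, two independent vertices one below `-2 * M`, and in a mixed pair the shifts cancel and
  -- leave the comparison of `h` with `r`.
  refine ⟨0, fun v => if v ∈ C then 2 * (M : ℝ) - h v else r v - 2 * (M : ℝ), fun u v huv => ?_⟩
  have cast1 : ∀ v, (r v : ℝ) < M := fun v => by exact_mod_cast hrM v
  have cast2 : ∀ v, (h v : ℝ) ≤ M := fun v => by exact_mod_cast hhM v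
  have cast0 : (0 : ℝ) < M := by positivity
  by_cases hu : u ∈ C <;> by_cases hv : v ∈ C
  · simp only [hu, hv, if_true]
    exact iff_of_true (hC hu hv huv) (by have := cast2 u; have := cast2 v; linarith)
  · simp only [hu, hv, if_true, if_false]
    rw [hadj u v hu (hCI v hv), ← Nat.cast_le (α := ℝ)]
    constructor <;> intro <;> linarith
  · simp only [hu, hv, if_true, if_false]
    rw [G.adj_comm, hadj v u hv (hCI u hu), ← Nat.cast_le (α := ℝ)]
    constructor <;> intro <;> linarith
  · simp only [hu, hv, if_false]
    refine iff_of_false (hI (hCI u hu) (hCI v hv) huv) ?_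
    have := cast1 u
    have := cast1 v
    linarith

/-! ### The bipartite tournament of a split graph -/

/-- The adjacency relation of a graph on `Fin n`, as a relation on numbers. -/
def natAdj {n : ℕ} (G : SimpleGraph (Fin n)) (u v : ℕ) : Prop :=
  ∃ (hu : u < n) (hv : v < n), G.Adj ⟨u, hu⟩ ⟨v, hv⟩

/-- `x` is an inner vertex of an induced path on four vertices. -/
def IsMid (n : ℕ) (g : ℕ → ℕ → Prop) (x : ℕ) : Prop :=
  ∃ a < n + 1, ∃ d < n + 1, ∃ b < n + 1, IsPath4 g a x d b

/-- `x` is an end of an induced path on four vertices. -/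
def IsEnd (n : ℕ) (g : ℕ → ℕ → Prop) (x : ℕ) : Prop :=
  ∃ c < n + 1, ∃ d < n + 1, ∃ b < n + 1, IsPath4 g x c d b

/-- Edges between inner vertices and ends are directed to the ends, non-edges the other way. -/
def PathArc (n : ℕ) (g : ℕ → ℕ → Prop) (x y : ℕ) : Prop :=
  (IsMid n g x ∧ IsEnd n g y ∧ g x y) ∨ (IsEnd n g x ∧ IsMid n g y ∧ ¬ g x y)

section

variable {n : ℕ} {G : SimpleGraph (Fin n)}

theorem natAdj_symm (u v : ℕ) (h : natAdj G u v) : natAdj G v u :=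
  ⟨h.2.1, h.1, h.2.2.symm⟩

/-- If `c` were independent, its neighbours `a` and `d` would both be in the clique although they
are not adjacent; likewise for `d`. The end `a` misses the clique vertex `d`, so it is not in the
clique. -/
theorem IsPath4.mem_of_split {C I : Set (Fin n)} (hunion : C ∪ I = Set.univ) (hC : G.IsClique C)
    (hI : G.IsIndepSet I) {a c d b : Fin n} (h : IsPath4 G.Adj a c d b) : c ∈ C ∧ a ∈ I := by
  obtain ⟨h1, h2, h3, h4, h5, h6⟩ := h
  have hCI : ∀ v, v ∉ C → v ∈ I := fun v hv =>
    ((Set.ext_iff.1 hunion v).2 (Set.mem_univ v)).resolve_left hv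
  have had : a ≠ d := by rintro rfl; exact h6 h3
  have hcb : c ≠ b := by rintro rfl; exact h6 h1
  have nb : ∀ u v, G.Adj u v → u ∉ C → v ∈ C := fun u v huv hu => by
    by_contra hv
    exact hI (hCI u hu) (hCI v hv) huv.ne huv
  have hc : c ∈ C := by
    by_contra hc
    exact h4 (hC (nb c a h1.symm hc) (nb c d h2 hc) had)
  have hd : d ∈ C := by
    by_contra hd
    exact h5 (hC hc (nb d b h3 hd) hcb)
  exact ⟨hc, hCI a fun ha => h4 (hC ha hd had)⟩

theorem IsPath4.toFin {a c d b : ℕ} (h : IsPath4 (natAdj G) a c d b) :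
    ∃ (ha : a < n) (hc : c < n) (hd : d < n) (hb : b < n),
      IsPath4 G.Adj ⟨a, ha⟩ ⟨c, hc⟩ ⟨d, hd⟩ ⟨b, hb⟩ := by
  obtain ⟨⟨ha, hc, h1⟩, ⟨_, hd, h2⟩, ⟨_, hb, h3⟩, h4, h5, h6⟩ := h
  exact ⟨ha, hc, hd, hb, h1, h2, h3, fun h => h4 ⟨_, _, h⟩, fun h => h5 ⟨_, _, h⟩,
    fun h => h6 ⟨_, _, h⟩⟩

theorem IsPath4.ofFin {a c d b : Fin n} (h : IsPath4 G.Adj a c d b) :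
    IsPath4 (natAdj G) a c d b := by
  obtain ⟨h1, h2, h3, h4, h5, h6⟩ := h
  exact ⟨⟨_, _, h1⟩, ⟨_, _, h2⟩, ⟨_, _, h3⟩, fun ⟨_, _, h⟩ => h4 h, fun ⟨_, _, h⟩ => h5 h,
    fun ⟨_, _, h⟩ => h6 h⟩

theorem IsPath4.isMid {a c d b : ℕ} (h : IsPath4 (natAdj G) a c d b) : IsMid n (natAdj G) c := by
  obtain ⟨ha, _, hd, hb, _⟩ := h.toFin
  exact ⟨a, by omega, d, by omega, b, by omega, h⟩

theorem IsPath4.isEnd {a c d b : ℕ} (h : IsPath4 (natAdj G) a c d b) : IsEnd n (natAdj G) a := by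
  obtain ⟨_, hc, hd, hb, _⟩ := h.toFin
  exact ⟨c, by omega, d, by omega, b, by omega, h⟩

theorem IsMid.lt {x : ℕ} (h : IsMid n (natAdj G) x) : x < n := by
  obtain ⟨a, _, d, _, b, _, h⟩ := h
  exact h.toFin.2.1

theorem IsEnd.lt {x : ℕ} (h : IsEnd n (natAdj G) x) : x < n := by
  obtain ⟨a, _, d, _, b, _, h⟩ := h
  exact h.toFin.1

theorem IsEnd.not_isMid (hG : IsSplit G) {x : ℕ} (h : IsEnd n (natAdj G) x) :
    ¬ IsMid n (natAdj G) x := by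
  obtain ⟨C, I, hdisj, hunion, hC, hI⟩ := hG
  rintro ⟨a, _, d, _, b, _, h'⟩
  obtain ⟨c, _, d, _, b, _, h⟩ := h
  obtain ⟨_, _, _, _, h'⟩ := h'.toFin
  obtain ⟨_, _, _, _, h⟩ := h.toFin
  exact Set.disjoint_left.1 hdisj (h'.mem_of_split hunion hC hI).1 (h.mem_of_split hunion hC hI).2

theorem isBipTournament_pathArc (hG : IsSplit G) :
    IsBipTournament n (PathArc n (natAdj G)) (IsEnd n (natAdj G)) (IsMid n (natAdj G)) where
  bip h := h.elim (fun h => .inr ⟨h.1, h.2.1⟩) (fun h => .inl ⟨h.1, h.2.1⟩)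
  disj h := h.not_isMid hG
  lt h := h.elim IsEnd.lt IsMid.lt
  tour {x y} hx hy := by
    have hx' := hx.not_isMid hG
    have hy' : ¬ IsEnd n (natAdj G) y := fun h => h.not_isMid hG hy
    have hs : natAdj G x y ↔ natAdj G y x := ⟨natAdj_symm _ _, natAdj_symm _ _⟩
    simp [PathArc, hx, hy, hx', hy', hs]

/-- Directed cycles of length four are the obstructions in both directions: in a threshold graph
they contradict the weights, and a split graph without them has no induced path on four vertices.
Arcs are defined by paths of the whole graph, so deletions leave them as they are. -/
theorem isYesInstance_iff (hG : IsSplit G) (k : ℕ) :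
    IsYesInstance G k ↔ ∃ S : Finset ℕ, S.card ≤ k ∧ Acyc (PathArc n (natAdj G)) {x | x ∉ S} := by
  have hB := isBipTournament_pathArc hG
  constructor
  · rintro ⟨S, hS, t, f, hf⟩
    refine ⟨S.map Fin.valEmbedding, by simpa using hS, ?_⟩
    -- The sum of the four weights is at least `2 * t` by the two edges and less than `2 * t` by the
    -- two non-edges.
    have key : ∀ x ∉ S.map Fin.valEmbedding, ∀ y ∉ S.map Fin.valEmbedding,
        ∀ z ∉ S.map Fin.valEmbedding, ∀ w ∉ S.map Fin.valEmbedding,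
        natAdj G x y → ¬ natAdj G y z → natAdj G z w → ¬ natAdj G w x → y ≠ z → w ≠ x → False := by
      rintro x hx y hy z hz w hw ⟨hxn, hyn, h1⟩ h2 ⟨hzn, hwn, h3⟩ h4 hyz hwx
      have mem : ∀ v (hv : v < n), v ∉ S.map Fin.valEmbedding → (⟨v, hv⟩ : Fin n) ∉ S := by
        intro v hv hvS hvS'
        exact hvS (Finset.mem_map.2 ⟨_, hvS', rfl⟩)
      set x' : {v : Fin n | v ∉ S} := ⟨⟨x, hxn⟩, mem x hxn hx⟩ with hx'
      set y' : {v : Fin n | v ∉ S} := ⟨⟨y, hyn⟩, mem y hyn hy⟩ with hy'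
      set z' : {v : Fin n | v ∉ S} := ⟨⟨z, hzn⟩, mem z hzn hz⟩ with hz'
      set w' : {v : Fin n | v ∉ S} := ⟨⟨w, hwn⟩, mem w hwn hw⟩ with hw'
      have e1 := (hf x' y' (fun e => h1.ne (congrArg Subtype.val e))).1 h1
      have e3 := (hf z' w' (fun e => h3.ne (congrArg Subtype.val e))).1 h3
      have e2 := mt (hf y' z' (fun e => hyz (congrArg (fun v => v.1.1) e))).2
        fun h => h2 ⟨hyn, hzn, h⟩
      have e4 := mt (hf w' x' (fun e => hwx (congrArg (fun v => v.1.1) e))).2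
        fun h => h4 ⟨hwn, hxn, h⟩
      linarith
    have ne : ∀ {x y}, PathArc n (natAdj G) x y → x ≠ y := by
      rintro x y h rfl; exact hB.asymm h h
    intro x hx y hy z hz w hw h1 h2 h3 h4
    rcases hB.bip h1 with ⟨tx, ty⟩ | ⟨tx, ty⟩
    · have tz := hB.symm.type_right h2 ty
      have tw := hB.type_right h3 tz
      have g1 : ¬ natAdj G x y := by
        simpa [PathArc, tx, ty, tx.not_isMid hG] using h1
      have g2 : natAdj G y z := by
        simpa [PathArc, ty, tz, tz.not_isMid hG] using h2
      have g3 : ¬ natAdj G z w := by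
        simpa [PathArc, tz, tw, tz.not_isMid hG] using h3
      have g4 : natAdj G w x := by
        simpa [PathArc, tw, tx, tx.not_isMid hG] using h4
      exact key y hy z hz w hw x hx g2 g3 g4 g1 (ne h3) (ne h1)
    · have tz := hB.type_right h2 ty
      have tw := hB.symm.type_right h3 tz
      have g1 : natAdj G x y := by
        simpa [PathArc, tx, ty, ty.not_isMid hG] using h1
      have g2 : ¬ natAdj G y z := by
        simpa [PathArc, ty, tz, ty.not_isMid hG] using h2
      have g3 : natAdj G z w := by
        simpa [PathArc, tz, tw, tw.not_isMid hG] using h3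
      have g4 : ¬ natAdj G w x := by
        simpa [PathArc, tw, tx, tw.not_isMid hG] using h4
      exact key x hx y hy z hz w hw g1 g2 g3 g4 (ne h2) (ne h4)
  · rintro ⟨S, hS, hA⟩
    classical
    refine ⟨Finset.univ.filter fun v : Fin n => (v : ℕ) ∈ S, ?_, ?_⟩
    · refine le_trans ?_ hS
      rw [← Finset.card_map Fin.valEmbedding]
      refine Finset.card_le_card fun x hx => ?_
      obtain ⟨v, hv, rfl⟩ := Finset.mem_map.1 hx
      simpa using hv
    · refine isThreshold_of_isSplit _ ?_ ?_
      · obtain ⟨C, I, hdisj, hunion, hC, hI⟩ := hG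
        refine ⟨{v | v.1 ∈ C}, {v | v.1 ∈ I}, ?_, ?_, ?_, ?_⟩
        · exact Set.disjoint_left.2 fun v h h' => Set.disjoint_left.1 hdisj h h'
        · exact Set.eq_univ_of_forall fun v => (Set.ext_iff.1 hunion v.1).2 (Set.mem_univ _)
        · exact fun u hu v hv huv => hC hu hv fun e => huv (Subtype.ext e)
        · exact fun u hu v hv huv => hI hu hv fun e => huv (Subtype.ext e)
      -- A surviving induced path `a c d b` is the cycle `c → a → d → b → c`.
      · rintro ⟨a, ha⟩ ⟨c, hc⟩ ⟨d, hd⟩ ⟨b, hb⟩ h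
        have h : IsPath4 (natAdj G) a c d b := IsPath4.ofFin h
        have h' := h.reverse natAdj_symm
        have out : ∀ v : Fin n, v ∈ {v : Fin n | v ∉ Finset.univ.filter fun v : Fin n => (v : ℕ) ∈ S}
            → (v : ℕ) ∈ {x | x ∉ S} := fun v hv => by simpa using hv
        refine hA c (out c hc) a (out a ha) d (out d hd) b (out b hb) ?_ ?_ ?_ ?_
        · exact .inl ⟨h.isMid, h.isEnd, natAdj_symm _ _ h.1⟩
        · exact .inr ⟨h.isEnd, h'.isMid, h.2.2.2.1⟩
        · exact .inl ⟨h'.isMid, h'.isEnd, h.2.2.1⟩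
        · exact .inr ⟨h'.isEnd, h.isMid, fun e => h.2.2.2.2.1 (natAdj_symm _ _ e)⟩

end

end STVD

namespace STVD

/-! ### The algorithm -/

namespace Fm

def or (φ ψ : Fm) : Fm := neg (and (neg φ) (neg ψ))
def imp (φ ψ : Fm) : Fm := neg (and φ (neg ψ))
def ex (x : ℕ) (φ : Fm) : Fm := neg (all x (neg φ))
def eq (x y : ℕ) : Fm := and (neg (lt x y)) (neg (lt y x))
def fls : Fm := lt 0 0

variable {c : Ctx} {A : Rels} {v : ℕ → ℕ}

@[simp] theorem ev_lt {x y : ℕ} : (lt x y).ev c A v ↔ v x < v y := Iff.rfl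
@[simp] theorem ev_ltn {x : ℕ} : (ltn x).ev c A v ↔ v x < c.n := Iff.rfl
@[simp] theorem ev_ltk {x : ℕ} : (ltk x).ev c A v ↔ v x < c.k := Iff.rfl
@[simp] theorem ev_adj {x y : ℕ} : (adj x y).ev c A v ↔ c.cell (v x * c.n + v y) := Iff.rfl
@[simp] theorem ev_rel {a : ℕ} {xs : List ℕ} :
    (rel a xs).ev c A v ↔ xs.length = a % 5 ∧ A a (xs.map v) := Iff.rfl
@[simp] theorem ev_neg {φ : Fm} : (neg φ).ev c A v ↔ ¬ φ.ev c A v := Iff.rfl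
@[simp] theorem ev_and {φ ψ : Fm} : (and φ ψ).ev c A v ↔ φ.ev c A v ∧ ψ.ev c A v := Iff.rfl
@[simp] theorem ev_all {x : ℕ} {φ : Fm} :
    (all x φ).ev c A v ↔ ∀ i < c.n + 1, φ.ev c A (Function.update v x i) := Iff.rfl
@[simp] theorem ev_or {φ ψ : Fm} : (or φ ψ).ev c A v ↔ φ.ev c A v ∨ ψ.ev c A v := by
  simp only [or, ev_neg, ev_and]; tauto
@[simp] theorem ev_imp {φ ψ : Fm} : (imp φ ψ).ev c A v ↔ (φ.ev c A v → ψ.ev c A v) := by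
  simp only [imp, ev_neg, ev_and]; tauto
@[simp] theorem ev_ex {x : ℕ} {φ : Fm} :
    (ex x φ).ev c A v ↔ ∃ i < c.n + 1, φ.ev c A (Function.update v x i) := by
  simp [ex, ev_all]
@[simp] theorem ev_eq {x y : ℕ} : (eq x y).ev c A v ↔ v x = v y := by
  simp only [eq, ev_and, ev_neg, ev_lt]; omega
@[simp] theorem ev_fls : ¬ (fls).ev c A v := by simp [fls]

end Fm

/-- The relations that a command may change. -/
def Cmd.writes : Cmd → List ℕ
  | .skip => []
  | .upd a _ _ => [a]
  | .seq p q => p.writes ++ q.writes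
  | .ite _ p q => p.writes ++ q.writes
  | .iter p => p.writes
  | .rept p => p.writes

theorem iterate_apply_eq {f : Rels → Rels} {a : ℕ} (h : ∀ A, f A a = A a) (j : ℕ) (A : Rels) :
    f^[j] A a = A a := by
  induction j with
  | zero => rfl
  | succ j ih => rw [Function.iterate_succ_apply', h, ih]

theorem Cmd.sem_of_notMem {c : Ctx} {p : Cmd} {a : ℕ} (h : a ∉ p.writes) (A : Rels) :
    p.sem c A a = A a := by
  induction p generalizing A with
  | skip => rfl
  | upd b xs φ =>
    rw [Cmd.sem]
    split_ifs
    · exact Function.update_of_ne (by simpa [Cmd.writes] using h) _ _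
    · rfl
  | seq p q ih₁ ih₂ =>
    simp only [Cmd.writes, List.mem_append, not_or] at h
    rw [Cmd.sem, ih₂ h.2, ih₁ h.1]
  | ite φ p q ih₁ ih₂ =>
    simp only [Cmd.writes, List.mem_append, not_or] at h
    rw [Cmd.sem]
    split_ifs
    · exact ih₁ h.1 A
    · exact ih₂ h.2 A
  | iter p ih => exact iterate_apply_eq (ih h) _ A
  | rept p ih => exact iterate_apply_eq (ih h) _ A

@[simp] theorem Cmd.sem_skip {c : Ctx} {A : Rels} : Cmd.skip.sem c A = A := rfl

@[simp] theorem Cmd.sem_seq {c : Ctx} {p q : Cmd} {A : Rels} :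
    (Cmd.seq p q).sem c A = q.sem c (p.sem c A) := rfl

theorem Cmd.sem_ite_pos {c : Ctx} {φ : Fm} {p q : Cmd} {A : Rels} (h : φ.ev c A fun _ => 0) :
    (Cmd.ite φ p q).sem c A = p.sem c A := by
  rw [Cmd.sem, if_pos h]

theorem Cmd.sem_ite_neg {c : Ctx} {φ : Fm} {p q : Cmd} {A : Rels} (h : ¬ φ.ev c A fun _ => 0) :
    (Cmd.ite φ p q).sem c A = q.sem c A := by
  rw [Cmd.sem, if_neg h]

/-- Names of relations; the remainder modulo five is the arity. -/
@[simp] abbrev rAdj : ℕ := 2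
@[simp] abbrev rArc : ℕ := 7
@[simp] abbrev rSubKeep : ℕ := 12
@[simp] abbrev rSubCand : ℕ := 17
@[simp] abbrev rBefore : ℕ := 22
@[simp] abbrev rPath : ℕ := 27
@[simp] abbrev rEnd : ℕ := 1
@[simp] abbrev rMid : ℕ := 6
@[simp] abbrev rDone : ℕ := 11
@[simp] abbrev rSol : ℕ := 16
@[simp] abbrev rOld : ℕ := 21
@[simp] abbrev rDel : ℕ := 26
@[simp] abbrev rFree : ℕ := 31
@[simp] abbrev rKeep : ℕ := 36
@[simp] abbrev rCand : ℕ := 41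
@[simp] abbrev rLeft : ℕ := 46
@[simp] abbrev rBudget : ℕ := 51
@[simp] abbrev rSeen : ℕ := 56
@[simp] abbrev rPool : ℕ := 61
@[simp] abbrev rFits : ℕ := 66
@[simp] abbrev rFail : ℕ := 5
@[simp] abbrev rFound : ℕ := 10
@[simp] abbrev rRes : ℕ := 15
@[simp] abbrev rState : ℕ := 4

section

open Fm Cmd

def path4F (a d x b : ℕ) : Fm :=
  and (rel rAdj [a, d]) (and (rel rAdj [d, x]) (and (rel rAdj [x, b])
    (and (neg (rel rAdj [a, x])) (and (neg (rel rAdj [d, b])) (neg (rel rAdj [a, b]))))))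

/-- Compute the bipartite tournament. -/
def arcCmd : Cmd :=
  seq (upd rAdj [0, 1] (and (ltn 0) (and (ltn 1) (adj 0 1))))
  (seq (upd rMid [0] (ex 1 (ex 2 (ex 3 (path4F 1 0 2 3)))))
  (seq (upd rEnd [0] (ex 1 (ex 2 (ex 3 (path4F 0 1 2 3)))))
  (upd rArc [0, 1] (or (and (rel rMid [0]) (and (rel rEnd [1]) (rel rAdj [0, 1])))
    (and (rel rEnd [0]) (and (rel rMid [1]) (neg (rel rAdj [0, 1]))))))))

/-- Compute the relations on which the steps of the dynamic program depend. -/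
def tablesCmd : Cmd :=
  seq (upd rSubKeep [0, 1]
    (all 2 (imp (rel rKeep [2]) (imp (rel rArc [2, 0]) (rel rArc [2, 1])))))
  (seq (upd rSubCand [0, 1]
    (all 2 (imp (rel rCand [2]) (imp (rel rArc [2, 0]) (rel rArc [2, 1])))))
  (seq (upd rBefore [0, 1] (and (rel rSubKeep [0, 1]) (or (neg (rel rSubKeep [1, 0]))
    (and (rel rSubCand [0, 1]) (or (neg (rel rSubCand [1, 0])) (lt 1 0))))))
  (seq (upd rPath [0, 1] (ex 2 (ex 3 (and (rel rKeep [2]) (and (rel rKeep [3])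
    (and (rel rArc [1, 2]) (and (rel rArc [2, 3]) (rel rArc [3, 0]))))))))
  (upd rFits [0] (and (rel rCand [0])
    (neg (ex 1 (and (rel rKeep [1]) (and (rel rPath [1, 0]) (rel rArc [1, 0]))))))))))

def canAddF (z p q m : ℕ) : Fm :=
  and (rel rFits [z]) (and (rel rBefore [p, z]) (and (neg (rel rArc [z, m]))
    (neg (rel rPath [q, z]))))

def isMaxF (m z m' : ℕ) : Fm :=
  or (and (eq m' z) (rel rSubCand [m, z])) (and (eq m' m) (rel rSubCand [z, m]))

def stepCmd : Cmd :=
  upd rState [0, 1, 2, 3]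
    (or (ex 4 (ex 5 (and (rel rState [4, 1, 5, 3]) (and (rel rMid [0])
      (and (canAddF 0 4 1 3) (isMaxF 5 0 2))))))
    (ex 4 (ex 5 (and (rel rState [0, 4, 2, 5]) (and (rel rEnd [1])
      (and (canAddF 1 4 0 2) (isMaxF 5 1 3)))))))

/-- Take away one element of `rLeft`; then lower the budget, or make a step if it is used up. -/
def roundCmd : Cmd :=
  ite (ex 0 (rel rLeft [0]))
    (seq (upd rLeft [0] (and (rel rLeft [0]) (ex 1 (and (lt 1 0) (rel rLeft [1])))))
      (ite (ex 0 (rel rBudget [0])) (upd rBudget [0] (ex 1 (and (lt 0 1) (rel rBudget [1]))))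
        stepCmd)) skip

/-- Decide whether all but `k` elements of `rPool` can be taken from `rCand`. -/
def decideCmd : Cmd :=
  seq tablesCmd
  (seq (upd rState [0, 1, 2, 3]
    (and (neg (ltn 0)) (and (neg (ltn 1)) (and (neg (ltn 2)) (neg (ltn 3))))))
  (seq (upd rLeft [0] (rel rPool [0]))
  (seq (upd rBudget [0] (ltk 0))
  (seq (iter roundCmd)
  (upd rRes [] (and (ex 0 (ex 1 (ex 2 (ex 3 (rel rState [0, 1, 2, 3])))))
    (neg (ex 0 (ex 1 (and (rel rKeep [0]) (and (rel rKeep [1])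
      (and (rel rPath [1, 0]) (rel rArc [1, 0])))))))))))))

/-- Remove from `rFree` every element that is not needed. -/
def reduceCmd : Cmd :=
  seq (upd rSeen [0] fls)
  (iter (seq (upd rCand [0] (and (rel rFree [0])
      (neg (and (neg (rel rSeen [0])) (all 1 (imp (lt 1 0) (rel rSeen [1])))))))
    (seq (upd rSeen [0] (all 1 (imp (lt 1 0) (rel rSeen [1]))))
    (seq decideCmd (ite (rel rRes []) (upd rFree [0] (rel rCand [0])) skip)))))

/-- The next subset of `rOld`. -/
def nextCmd : Cmd :=
  upd rDel [0] (and (rel rOld [0]) (or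
    (and (rel rDel [0]) (ex 1 (and (lt 1 0) (and (rel rOld [1]) (neg (rel rDel [1]))))))
    (and (neg (rel rDel [0])) (all 1 (imp (lt 1 0) (imp (rel rOld [1]) (rel rDel [1])))))))

/-- Look for a solution that meets `rOld` in `rDel`. -/
def tryCmd : Cmd :=
  seq (upd rKeep [0] (and (rel rOld [0]) (neg (rel rDel [0]))))
  (seq (upd rFree [0] (and (rel rDone [0]) (and (neg (rel rOld [0]))
    (or (rel rEnd [0]) (rel rMid [0])))))
  (seq (upd rPool [0] (or (rel rFree [0]) (rel rDel [0])))
  (seq reduceCmd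
  (seq (upd rCand [0] (rel rFree [0]))
  (seq decideCmd
  (ite (rel rRes [])
    (seq (upd rSol [0] (and (rel rPool [0]) (neg (rel rFree [0]))))
      (upd rFound [] (neg fls))) skip))))))

/-- Process the next vertex. -/
def compressCmd : Cmd :=
  seq (upd rOld [0] (or (rel rSol [0])
    (and (neg (rel rDone [0])) (all 1 (imp (lt 1 0) (rel rDone [1]))))))
  (seq (upd rDone [0] (all 1 (imp (lt 1 0) (rel rDone [1]))))
  (seq (upd rFound [] fls)
  (seq (upd rDel [0] fls)
  (seq (rept (seq tryCmd nextCmd))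
  (ite (rel rFound []) skip (upd rFail [] (neg fls)))))))

def mainCmd : Cmd := seq arcCmd (iter compressCmd)

end

variable {c : Ctx} {A : Rels}

/-- Unary and binary relations as predicates. -/
def Rels.un (A : Rels) (a x : ℕ) : Prop := A a [x]
def Rels.bin (A : Rels) (a x y : ℕ) : Prop := A a [x, y]

@[simp] theorem Rels.un_apply (a x : ℕ) : A.un a x ↔ A a [x] := Iff.rfl
@[simp] theorem Rels.bin_apply (a x y : ℕ) : A.bin a x y ↔ A a [x, y] := Iff.rfl

/-! ### Meaning of the basic commands -/

theorem arcCmd_sem {n k : ℕ} {G : SimpleGraph (Fin n)} {cell : ℕ → Prop}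
    (hcell : ∀ u v : Fin n, cell (u * n + v) ↔ G.Adj u v) (A : Rels) :
    let B := arcCmd.sem ⟨n, k, cell⟩ A
    B.un rMid = IsMid n (natAdj G) ∧ B.un rEnd = IsEnd n (natAdj G) ∧
      B.bin rArc = PathArc n (natAdj G) := by
  have h : ∀ x y, (x < n ∧ y < n ∧ cell (x * n + y)) ↔ natAdj G x y := by
    intro x y
    constructor
    · rintro ⟨hx, hy, h⟩
      exact ⟨hx, hy, (hcell ⟨x, hx⟩ ⟨y, hy⟩).1 h⟩
    · rintro ⟨hx, hy, h⟩
      exact ⟨hx, hy, (hcell ⟨x, hx⟩ ⟨y, hy⟩).2 h⟩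
  have h1 : (arcCmd.sem ⟨n, k, cell⟩ A).un rMid = IsMid n (natAdj G) := by
    funext x
    simp [arcCmd, path4F, Cmd.sem, assign, h, IsMid, IsPath4]
  have h2 : (arcCmd.sem ⟨n, k, cell⟩ A).un rEnd = IsEnd n (natAdj G) := by
    funext x
    simp [arcCmd, path4F, Cmd.sem, assign, h, IsEnd, IsPath4]
  refine ⟨h1, h2, ?_⟩
  funext x y
  simp [arcCmd, path4F, Cmd.sem, assign, h, PathArc, IsEnd, IsMid, IsPath4]

/-- The relations that the dynamic program reads have their intended meaning. -/
structure Tables (c : Ctx) (arc : ℕ → ℕ → Prop) (K R T₀ T₁ : ℕ → Prop) (A : Rels) : Prop where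
  arc_iff : ∀ x y, A rArc [x, y] ↔ arc x y
  sub_iff : ∀ x y, A rSubCand [x, y] ↔ InSub c.n arc R x y
  before_iff : ∀ x y, A rBefore [x, y] ↔ Before c.n arc K R x y
  path_iff : ∀ x y, A rPath [x, y] ↔ Path3 c.n arc K x y
  fits_iff : ∀ x, A rFits [x] ↔ Fits c.n arc K R x
  end_iff : ∀ x, A rEnd [x] ↔ T₀ x
  mid_iff : ∀ x, A rMid [x] ↔ T₁ x

theorem Tables.congr {arc : ℕ → ℕ → Prop} {K R T₀ T₁ : ℕ → Prop} {A B : Rels}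
    (h : Tables c arc K R T₀ T₁ A)
    (hB : ∀ a ∈ [rArc, rSubCand, rBefore, rPath, rFits, rEnd, rMid], B a = A a) :
    Tables c arc K R T₀ T₁ B := by
  simp only [List.forall_mem_cons] at hB
  obtain ⟨h1, h2, h3, h4, h5, h6, h7, -⟩ := hB
  obtain ⟨g1, g2, g3, g4, g5, g6, g7⟩ := h
  exact ⟨by rwa [h1], by rwa [h2], by rwa [h3], by rwa [h4], by rwa [h5], by rwa [h6], by rwa [h7]⟩

def Rels.state (A : Rels) (p q m l : ℕ) : Prop := A rState [p, q, m, l]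

theorem stepCmd_sem {arc : ℕ → ℕ → Prop} {K R T₀ T₁ : ℕ → Prop} (h : Tables c arc K R T₀ T₁ A) :
    (stepCmd.sem c A).state = Step c.n arc K R T₀ T₁ A.state := by
  funext p q m l
  obtain ⟨g1, g2, g3, g4, g5, g6, g7⟩ := h
  simp only [rArc, rSubCand, rBefore, rPath, rFits, rEnd, rMid] at g1 g2 g3 g4 g5 g6 g7
  simp [Step, CanAdd, IsMax, Rels.state, stepCmd, Cmd.sem, assign, canAddF, isMaxF, g1, g2, g3, g4,
    g5, g6, g7]

theorem tablesCmd_tables :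
    Tables c (A.bin rArc) (A.un rKeep) (A.un rCand) (A.un rEnd) (A.un rMid)
      (tablesCmd.sem c A) where
  arc_iff x y := by rw [Cmd.sem_of_notMem (by decide)]; rfl
  sub_iff x y := by simp [tablesCmd, Cmd.sem, assign, InSub]
  before_iff x y := by simp [tablesCmd, Cmd.sem, assign, Before, InSub]
  path_iff x y := by simp [tablesCmd, Cmd.sem, assign, Path3]
  fits_iff x := by simp [tablesCmd, Cmd.sem, assign, Fits, Path3]
  end_iff x := by rw [Cmd.sem_of_notMem (by decide)]; rfl
  mid_iff x := by rw [Cmd.sem_of_notMem (by decide)]; rfl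

end STVD

namespace STVD

/-! ### Correctness of the decision procedure -/

variable {c : Ctx} {A : Rels}

/-- The elements of `K` below `n + 1`, as a finite set. -/
noncomputable def elems (n : ℕ) (K : ℕ → Prop) : Finset ℕ :=
  @Finset.filter _ K (Classical.decPred K) (Finset.range (n + 1))

@[simp] theorem mem_elems {n : ℕ} {K : ℕ → Prop} {x : ℕ} : x ∈ elems n K ↔ x < n + 1 ∧ K x := by
  rw [elems, @Finset.mem_filter _ K (Classical.decPred K), Finset.mem_range]

theorem card_elems_le {n : ℕ} {K : ℕ → Prop} : (elems n K).card ≤ n + 1 :=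
  letI := Classical.decPred K
  (Finset.card_filter_le (Finset.range (n + 1)) K).trans (by simp)

/-- The minimum is the only element without a smaller one in the set. This first-order condition
therefore deletes exactly one element, which lets a unary relation serve as a counter. -/
theorem elems_pop {n : ℕ} {L : ℕ → Prop} (hL : ∃ x < n + 1, L x) :
    (elems n fun x => L x ∧ ∃ y < n + 1, y < x ∧ L y).card + 1 = (elems n L).card := by
  obtain ⟨x₀, hx₀, hLx₀⟩ := hL
  have hne : (elems n L).Nonempty := ⟨x₀, by simp [hx₀, hLx₀]⟩
  have : (elems n fun x => L x ∧ ∃ y < n + 1, y < x ∧ L y) =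
      (elems n L).erase ((elems n L).min' hne) := by
    ext x
    simp only [mem_elems, Finset.mem_erase]
    constructor
    · rintro ⟨hx, hLx, y, hy, hyx, hLy⟩
      have := (elems n L).min'_le y (by simp [hy, hLy])
      exact ⟨by omega, hx, hLx⟩
    · rintro ⟨hne', hx, hLx⟩
      have h1 := (elems n L).min'_le x (by simp [hx, hLx])
      have h2 := mem_elems.1 ((elems n L).min'_mem hne)
      exact ⟨hx, hLx, _, h2.1, by omega, h2.2⟩
  rw [this, Finset.card_erase_add_one (Finset.min'_mem _ _)]

/-- The state after `j` rounds, when `rLeft` had `m` elements at the beginning. -/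
structure RoundInv (c : Ctx) (arc : ℕ → ℕ → Prop) (K R T₀ T₁ : ℕ → Prop) (m j : ℕ) (A : Rels) :
    Prop where
  tables : Tables c arc K R T₀ T₁ A
  left : (elems c.n (A.un rLeft)).card = m - j
  budget : ∀ x < c.n + 1, A rBudget [x] ↔ x + min j m < min c.k (c.n + 1)
  state : A.state = (Step c.n arc K R T₀ T₁)^[min j m - min c.k (c.n + 1)] (Start c.n)

/-- `rLeft` and `rBudget` are unary counters. Among the `m` rounds that find `rLeft` nonempty, the
first ones use up the budget and the others make a step each; this subtracts the budget from `m`. -/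
theorem RoundInv.step {arc : ℕ → ℕ → Prop} {K R T₀ T₁ : ℕ → Prop} {m j : ℕ}
    (h : RoundInv c arc K R T₀ T₁ m j A) :
    RoundInv c arc K R T₀ T₁ m (j + 1) (roundCmd.sem c A) := by
  obtain ⟨ht, hl, hb, hs⟩ := h
  by_cases hL : ∃ x < c.n + 1, A rLeft [x]
  · have hpos := elems_pop (L := A.un rLeft) hL
    have hjm : j < m := by omega
    rw [min_eq_left hjm.le] at hb hs
    set B : Rels := Cmd.sem c (.upd rLeft [0] (.and (.rel rLeft [0]) (.ex 1 (.and (.lt 1 0)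
      (.rel rLeft [1]))))) A with hB
    have hBne : ∀ a, a ≠ rLeft → B a = A a := fun a ha => Cmd.sem_of_notMem (by simpa [Cmd.writes] using ha) A
    have hBl : (elems c.n (B.un rLeft)).card = m - (j + 1) := by
      have : B.un rLeft = fun x => A.un rLeft x ∧ ∃ y < c.n + 1, y < x ∧ A.un rLeft y := by
        funext x
        simp [hB, Cmd.sem, assign]
      rw [this]; omega
    have hex : (∃ x < c.n + 1, B rBudget [x]) ↔ j < min c.k (c.n + 1) := by
      rw [hBne rBudget (by decide)]
      constructor
      · rintro ⟨x, hx, hBx⟩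
        have := (hb x hx).1 hBx
        omega
      · intro hj
        exact ⟨0, by omega, (hb 0 (by omega)).2 (by omega)⟩
    have hsem : roundCmd.sem c A = Cmd.sem c (.ite (.ex 0 (.rel rBudget [0]))
        (.upd rBudget [0] (.ex 1 (.and (.lt 0 1) (.rel rBudget [1])))) stepCmd) B :=
      Cmd.sem_ite_pos (by simpa using hL)
    rw [hsem]
    by_cases hj : j < min c.k (c.n + 1)
    · rw [Cmd.sem_ite_pos (by simpa using hex.2 hj)]
      refine ⟨?_, ?_, ?_, ?_⟩
      · refine ht.congr fun a ha => ?_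
        rw [Cmd.sem_of_notMem, hBne]
        · rintro rfl; revert ha; decide
        · simp only [Cmd.writes, List.mem_singleton]; rintro rfl; revert ha; decide
      · rw [← hBl]
        unfold Rels.un
        rw [Cmd.sem_of_notMem (by decide)]
      · intro x hx
        rw [min_eq_left (by omega : j + 1 ≤ m)]
        simp only [Cmd.sem]
        simp only [rBudget] at hb hBne
        simp [assign, hBne]
        constructor
        · rintro ⟨y, hy, hxy, hBy⟩
          have := (hb y (by omega)).1 hBy
          omega
        · intro hxj
          exact ⟨x + 1, by omega, by omega, (hb (x + 1) (by omega)).2 (by omega)⟩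
      · rw [min_eq_left (by omega : j + 1 ≤ m), show j + 1 - min c.k (c.n + 1) = 0 by omega]
        rw [show j - min c.k (c.n + 1) = 0 by omega] at hs
        rw [← hs]
        unfold Rels.state
        rw [Cmd.sem_of_notMem (by decide), hBne _ (by decide)]
    · rw [Cmd.sem_ite_neg (by simpa using mt hex.1 hj)]
      refine ⟨?_, ?_, ?_, ?_⟩
      · refine ht.congr fun a ha => ?_
        rw [Cmd.sem_of_notMem, hBne]
        · rintro rfl; revert ha; decide
        · simp only [stepCmd, Cmd.writes, List.mem_singleton]; rintro rfl; revert ha; decide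
      · rw [← hBl]
        unfold Rels.un
        rw [Cmd.sem_of_notMem (by decide)]
      · intro x hx
        rw [min_eq_left (by omega : j + 1 ≤ m), Cmd.sem_of_notMem (by decide),
          hBne _ (by decide), hb x hx]
        omega
      · have htB : Tables c arc K R T₀ T₁ B := ht.congr fun a ha => hBne a (by
          rintro rfl; revert ha; decide)
        rw [stepCmd_sem htB, min_eq_left (by omega : j + 1 ≤ m),
          show j + 1 - min c.k (c.n + 1) = (j - min c.k (c.n + 1)) + 1 by omega,
          Function.iterate_succ_apply', ← hs]
        unfold Rels.state
        rw [hBne _ (by decide)]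
  · have hm : m ≤ j := by
      have : elems c.n (A.un rLeft) = ∅ := Finset.eq_empty_of_forall_notMem fun x hx =>
        hL ⟨x, mem_elems.1 hx⟩
      rw [this] at hl
      simp at hl; omega
    have hsem : roundCmd.sem c A = A := by
      rw [roundCmd, Cmd.sem_ite_neg (by simpa using hL), Cmd.sem_skip]
    rw [hsem]
    refine ⟨ht, by omega, ?_, ?_⟩
    · intro x hx
      rw [hb x hx, min_eq_right hm, min_eq_right (by omega : m ≤ j + 1)]
    · rw [hs, min_eq_right hm, min_eq_right (by omega : m ≤ j + 1)]

/-- `s` elements of `R` can be added to `K` without creating a cycle. -/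
def CanKeep (n : ℕ) (arc : ℕ → ℕ → Prop) (K : ℕ → Prop) (s : ℕ) (R : ℕ → Prop) : Prop :=
  ∃ T : Finset ℕ, T.card = s ∧ (∀ x ∈ T, R x) ∧ Acyc arc (below n K ∪ T)

/-- The right-hand side is the form in which `decideCmd` tests that the kept part is acyclic. -/
theorem acyc_below_iff {n : ℕ} {arc : ℕ → ℕ → Prop} {K : ℕ → Prop} :
    Acyc arc (below n K) ↔
      ¬ ∃ x < n + 1, ∃ y < n + 1, K x ∧ K y ∧ Path3 n arc K y x ∧ arc y x := by
  constructor
  · rintro h ⟨x, hx, y, hy, hKx, hKy, ⟨z, hz, w, hw, hKz, hKw, h1, h2, h3⟩, h4⟩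
    exact h x ⟨hx, hKx⟩ z ⟨hz, hKz⟩ w ⟨hw, hKw⟩ y ⟨hy, hKy⟩ h1 h2 h3 h4
  · intro h x hx z hz w hw y hy h1 h2 h3 h4
    exact h ⟨x, hx.1, y, hy.1, hx.2, hy.2, ⟨z, hz.1, w, hw.1, hz.2, hw.2, h1, h2, h3⟩, h4⟩

/-- The dynamic program is meaningful only for acyclic `K`. This is not assumed but tested at the
end; if the test fails, no set can be added either. -/
theorem decideCmd_res (hB : IsBipTournament c.n (A.bin rArc) (A.un rEnd) (A.un rMid))
    (hR : Acyc (A.bin rArc) (below c.n (A.un rCand)))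
    (hRT : ∀ x, A.un rCand x → A.un rEnd x ∨ A.un rMid x) :
    decideCmd.sem c A rRes [] ↔ CanKeep c.n (A.bin rArc) (A.un rKeep)
      ((elems c.n (A.un rPool)).card - c.k) (A.un rCand) := by
  set arc := A.bin rArc
  set K := A.un rKeep with hK
  set R := A.un rCand
  set T₀ := A.un rEnd
  set T₁ := A.un rMid
  set m := (elems c.n (A.un rPool)).card with hm
  have hmn : m ≤ c.n + 1 := card_elems_le
  set B₁ := tablesCmd.sem c A with hB₁
  have h1 : Tables c arc K R T₀ T₁ B₁ := tablesCmd_tables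
  set B₂ := Cmd.sem c (.upd rBudget [0] (.ltk 0)) (Cmd.sem c (.upd rLeft [0] (.rel rPool [0]))
    (Cmd.sem c (.upd rState [0, 1, 2, 3] (.and (.neg (.ltn 0)) (.and (.neg (.ltn 1))
      (.and (.neg (.ltn 2)) (.neg (.ltn 3)))))) B₁)) with hB₂
  have hB₁p : B₁ rPool = A rPool := Cmd.sem_of_notMem (by decide) A
  have h2 : RoundInv c arc K R T₀ T₁ m 0 B₂ := by
    refine ⟨h1.congr fun a ha => ?_, ?_, ?_, ?_⟩
    · rw [hB₂]
      rw [Cmd.sem_of_notMem, Cmd.sem_of_notMem, Cmd.sem_of_notMem] <;>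
      · simp only [Cmd.writes, List.mem_singleton]; rintro rfl; revert ha; decide
    · rw [hm, Nat.sub_zero]
      congr 2
      funext x
      have : B₁ 61 [x] ↔ A 61 [x] := by rw [← hB₁p]
      simp [hB₂, Cmd.sem, assign, this]
    · intro x hx
      simp only [rBudget]
      simp [hB₂, Cmd.sem, assign]
      omega
    · simp
      funext p q m l
      simp [hB₂, Rels.state, Cmd.sem, assign, Start]
  set B₃ := (Cmd.iter roundCmd).sem c B₂ with hB₃
  have h3 : RoundInv c arc K R T₀ T₁ m (c.n + 1) B₃ := by
    have : ∀ j, RoundInv c arc K R T₀ T₁ m j ((roundCmd.sem c)^[j] B₂) := by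
      intro j
      induction j with
      | zero => exact h2
      | succ j ih => rw [Function.iterate_succ_apply']; exact ih.step
    exact this _
  have hK₃ : ∀ x, B₃ rKeep [x] ↔ K x := by
    intro x
    rw [hB₃, Cmd.sem_of_notMem (by decide), hB₂, Cmd.sem_of_notMem (by decide),
      Cmd.sem_of_notMem (by decide), Cmd.sem_of_notMem (by decide), hB₁,
      Cmd.sem_of_notMem (by decide)]
    rfl
  -- The domain caps the budget at `n + 1`, which makes no difference because the pool has at most
  -- `n + 1` elements.
  have hsteps : min (c.n + 1) m - min c.k (c.n + 1) = m - c.k := by omega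
  have hst := h3.state
  rw [hsteps] at hst
  have hres : decideCmd.sem c A rRes [] ↔ (∃ p < c.n + 1, ∃ q < c.n + 1, ∃ m < c.n + 1,
      ∃ l < c.n + 1, B₃.state p q m l) ∧ Acyc arc (below c.n K) := by
    have e : decideCmd.sem c A = Cmd.sem c (.upd rRes [] (.and (.ex 0 (.ex 1 (.ex 2 (.ex 3
      (.rel rState [0, 1, 2, 3]))))) (.neg (.ex 0 (.ex 1 (.and (.rel rKeep [0])
      (.and (.rel rKeep [1]) (.and (.rel rPath [1, 0]) (.rel rArc [1, 0]))))))))) B₃ := rfl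
    obtain ⟨g1, -, -, g4, -⟩ := h3.tables
    simp only [rArc, rPath, rKeep] at g1 g4 hK₃
    rw [e, acyc_below_iff]
    simp [Cmd.sem, assign, g1, g4, hK₃, Rels.state]
  rw [hres, hst]
  constructor
  · rintro ⟨hs, hKa⟩
    exact (iterate_step_iff hB hKa hR hRT _).1 hs
  · rintro ⟨T, hT⟩
    have hKa : Acyc arc (below c.n K) := hT.2.2.mono Set.subset_union_left
    exact ⟨(iterate_step_iff hB hKa hR hRT _).2 ⟨T, hT⟩, hKa⟩

end STVD

namespace STVD

/-! ### Reduction to a set of needed elements -/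

variable {c : Ctx} {A : Rels}

theorem CanKeep.mono {n s : ℕ} {arc : ℕ → ℕ → Prop} {K R R' : ℕ → Prop}
    (h : CanKeep n arc K s R) (hR : ∀ x, R x → R' x) : CanKeep n arc K s R' := by
  obtain ⟨T, h1, h2, h3⟩ := h
  exact ⟨T, h1, fun x hx => hR x (h2 x hx), h3⟩

/-- What is true after `j` rounds of the reduction. -/
structure ReduceInv (c : Ctx) (A : Rels) (s j : ℕ) (B : Rels) : Prop where
  same : ∀ a ∈ [rArc, rEnd, rMid, rKeep, rPool], B a = A a
  seen : ∀ x < c.n + 1, B rSeen [x] ↔ x < j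
  sub : ∀ x, B rFree [x] → A rFree [x]
  keep : CanKeep c.n (A.bin rArc) (A.un rKeep) s (A.un rFree) →
    CanKeep c.n (A.bin rArc) (A.un rKeep) s (B.un rFree)
  needed : ∀ x < j, B rFree [x] →
    ¬ CanKeep c.n (A.bin rArc) (A.un rKeep) s fun y => B rFree [y] ∧ y ≠ x

/-- Each element in turn is dropped if `s` elements can be kept without it. An element found to be
needed remains so, because the free set only shrinks and `CanKeep` is monotone in it. -/
theorem reduceCmd_inv (hB : IsBipTournament c.n (A.bin rArc) (A.un rEnd) (A.un rMid))
    (hR : Acyc (A.bin rArc) (below c.n (A.un rFree)))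
    (hRT : ∀ x, A.un rFree x → A.un rEnd x ∨ A.un rMid x) :
    ReduceInv c A ((elems c.n (A.un rPool)).card - c.k) (c.n + 1) (reduceCmd.sem c A) := by
  set s := (elems c.n (A.un rPool)).card - c.k with hs
  set A₀ := Cmd.sem c (.upd rSeen [0] .fls) A with hA₀
  have h0 : ReduceInv c A s 0 A₀ := by
    have hfree : A₀ rFree = A rFree := Cmd.sem_of_notMem (by decide) A
    refine ⟨fun a ha => Cmd.sem_of_notMem ?_ A, fun x hx => ?_, ?_, ?_, fun x hx => ?_⟩
    · simp only [Cmd.writes, List.mem_singleton]; rintro rfl; revert ha; decide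
    · simp [hA₀, Cmd.sem]
    · intro x; rw [hfree]; exact id
    · unfold Rels.un; rw [hfree]; exact id
    · omega
  have hred : reduceCmd.sem c A = (Cmd.sem c _)^[c.n + 1] A₀ := rfl
  rw [hred]
  generalize c.n + 1 = N
  induction N with
  | zero => exact h0
  | succ j ih =>
    rw [Function.iterate_succ_apply']
    set B := (Cmd.sem c (((Cmd.upd rCand [0] (.and (.rel rFree [0])
      (.neg (.and (.neg (.rel rSeen [0])) (.all 1 (.imp (.lt 1 0) (.rel rSeen [1])))))))).seq
        ((Cmd.upd rSeen [0] (.all 1 (.imp (.lt 1 0) (.rel rSeen [1])))).seq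
        (decideCmd.seq (.ite (.rel rRes []) (.upd rFree [0] (.rel rCand [0])) .skip)))))^[j] A₀
      with hBdef
    obtain ⟨hsame, hseen, hsub, hkeep, hneeded⟩ := ih
    set B₁ := Cmd.sem c (.upd rSeen [0] (.all 1 (.imp (.lt 1 0) (.rel rSeen [1]))))
      (Cmd.sem c (Cmd.upd rCand [0] (.and (.rel rFree [0])
      (.neg (.and (.neg (.rel rSeen [0])) (.all 1 (.imp (.lt 1 0) (.rel rSeen [1])))))))
      B) with hB₁
    have hlt : ∀ x, B rFree [x] → x < c.n + 1 := fun x hx =>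
      (hB.lt (hRT x (hsub x hx))).trans (Nat.lt_succ_self _)
    have hsame₁ : ∀ a ∈ [rArc, rEnd, rMid, rKeep, rPool, rFree], B₁ a = B a := by
      intro a ha
      rw [hB₁, Cmd.sem_of_notMem, Cmd.sem_of_notMem] <;>
      · simp only [Cmd.writes, List.mem_singleton]; rintro rfl; revert ha; decide
    simp only [List.forall_mem_cons] at hsame hsame₁
    obtain ⟨s1, s2, s3, s4, s5, -⟩ := hsame
    obtain ⟨t1, t2, t3, t4, t5, t6, -⟩ := hsame₁
    -- `rSeen` consists of the numbers below `j`, so the one unseen number with all smaller ones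
    -- seen is `j`.
    have hcand : ∀ x, B₁ rCand [x] ↔ B rFree [x] ∧ x ≠ j := by
      intro x
      simp only [rCand, rFree, rSeen] at hlt hseen ⊢
      simp [hB₁, Cmd.sem, assign]
      intro hx
      have hx := hlt x hx
      rw [hseen x hx]
      constructor
      · rintro h rfl
        obtain ⟨y, hy, hyx, hyS⟩ := h (by omega)
        exact hyS ((hseen y (by omega)).2 hyx)
      · intro hxj hle
        have : j < x := by omega
        exact ⟨j, by omega, this, fun h => absurd ((hseen j (by omega)).1 h) (lt_irrefl _)⟩
    have hseen₁ : ∀ x < c.n + 1, B₁ rSeen [x] ↔ x < j + 1 := by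
      intro x hx
      simp only [rSeen] at hseen ⊢
      simp [hB₁, Cmd.sem, assign]
      constructor
      · intro h
        by_contra hxj
        have := (hseen j (by omega)).1 (h j (by omega) (by omega))
        omega
      · intro h i hi hix
        exact (hseen i (by omega)).2 (by omega)
    have hres : decideCmd.sem c B₁ rRes [] ↔
        CanKeep c.n (A.bin rArc) (A.un rKeep) s fun y => B rFree [y] ∧ y ≠ j := by
      have e1 : B₁.bin rArc = A.bin rArc := by unfold Rels.bin; rw [t1, s1]
      have e2 : B₁.un rEnd = A.un rEnd := by unfold Rels.un; rw [t2, s2]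
      have e3 : B₁.un rMid = A.un rMid := by unfold Rels.un; rw [t3, s3]
      have e4 : B₁.un rKeep = A.un rKeep := by unfold Rels.un; rw [t4, s4]
      have e5 : B₁.un rPool = A.un rPool := by unfold Rels.un; rw [t5, s5]
      have e6 : B₁.un rCand = fun y => B rFree [y] ∧ y ≠ j := funext fun x => propext (hcand x)
      have := decideCmd_res (c := c) (A := B₁) (by rw [e1, e2, e3]; exact hB)
        (by
          rw [e1, e6]
          exact hR.mono fun x hx => ⟨hx.1, hsub x hx.2.1⟩)
        (by rw [e2, e3, e6]; exact fun x hx => hRT x (hsub x hx.1))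
      rwa [e1, e4, e5, e6] at this
    set D := decideCmd.sem c B₁ with hD
    have hDfree : D rFree = B rFree := by rw [hD, Cmd.sem_of_notMem (by decide), t6]
    have hDcand : D rCand = B₁ rCand := by rw [hD, Cmd.sem_of_notMem (by decide)]
    have hDseen : D rSeen = B₁ rSeen := by rw [hD, Cmd.sem_of_notMem (by decide)]
    have hDsame : ∀ a ∈ [rArc, rEnd, rMid, rKeep, rPool], D a = A a := by
      simp only [List.forall_mem_cons]
      refine ⟨?_, ?_, ?_, ?_, ?_, by simp⟩
      · rw [hD, Cmd.sem_of_notMem (by decide), t1, s1]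
      · rw [hD, Cmd.sem_of_notMem (by decide), t2, s2]
      · rw [hD, Cmd.sem_of_notMem (by decide), t3, s3]
      · rw [hD, Cmd.sem_of_notMem (by decide), t4, s4]
      · rw [hD, Cmd.sem_of_notMem (by decide), t5, s5]
    simp only [Cmd.sem_seq]
    rw [← hB₁, ← hD]
    by_cases hr : D rRes []
    · rw [Cmd.sem_ite_pos (by simpa using hr)]
      set E := Cmd.sem c (.upd rFree [0] (.rel rCand [0])) D with hE
      have hEfree : ∀ x, E rFree [x] ↔ B rFree [x] ∧ x ≠ j := by
        intro x
        rw [← hcand x, ← hDcand]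
        simp [hE, Cmd.sem, assign]
      have hEne : ∀ a, a ≠ rFree → E a = D a := fun a ha =>
        Cmd.sem_of_notMem (by simpa [Cmd.writes] using ha) D
      refine ⟨fun a ha => ?_, fun x hx => ?_, fun x hx => ?_, fun h => ?_, fun x hx hfx hk => ?_⟩
      · rw [hEne a (by rintro rfl; revert ha; decide), hDsame a ha]
      · rw [hEne _ (by decide), hDseen, hseen₁ x hx]
      · exact hsub x ((hEfree x).1 hx).1
      · exact (hres.1 hr).mono fun x hx => (hEfree x).2 hx
      · obtain ⟨hfx, hxj⟩ := (hEfree x).1 hfx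
        exact hneeded x (by omega) hfx (hk.mono fun y hy => ⟨((hEfree y).1 hy.1).1, hy.2⟩)
    · rw [Cmd.sem_ite_neg (by simpa using hr), Cmd.sem_skip]
      refine ⟨hDsame, fun x hx => ?_, fun x hx => ?_, fun h => ?_, fun x hx hfx hk => ?_⟩
      · rw [hDseen, hseen₁ x hx]
      · rw [hDfree] at hx; exact hsub x hx
      · unfold Rels.un at hkeep ⊢; rw [hDfree]; exact hkeep h
      · rw [hDfree] at hfx hk
        rcases Nat.lt_succ_iff_lt_or_eq.1 hx with hx | rfl
        · exact hneeded x hx hfx hk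
        · exact hr (hres.2 hk)

end STVD

namespace STVD

variable {c : Ctx} {A : Rels}

/-! ### Enumeration of subsets -/

/-- This is the carry rule of a binary counter: a bit flips exactly when all lower bits are set. -/
theorem testBit_add_one (j i : ℕ) :
    ((j + 1).testBit i = true) ↔ (j.testBit i = true ∧ ∃ i' < i, j.testBit i' = false) ∨
      (j.testBit i = false ∧ ∀ i' < i, j.testBit i' = true) := by
  induction i generalizing j with
  | zero => simp [Nat.testBit_zero]; omega
  | succ i ih =>
    rw [Nat.testBit_succ, Nat.testBit_succ]
    rcases Nat.even_or_odd' j with ⟨r, rfl | rfl⟩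
    · have e1 : (2 * r + 1) / 2 = r := by omega
      have e2 : 2 * r / 2 = r := by omega
      have e3 : (2 * r).testBit 0 = false := by simp [Nat.testBit_zero]
      rw [e1, e2]
      constructor
      · exact fun h => .inl ⟨h, 0, by omega, e3⟩
      · rintro (⟨h, _⟩ | ⟨_, h⟩)
        · exact h
        · have := h 0 (by omega); rw [e3] at this; cases this
    · have e1 : (2 * r + 1 + 1) / 2 = r + 1 := by omega
      have e2 : (2 * r + 1) / 2 = r := by omega
      have e3 : (2 * r + 1).testBit 0 = true := by simp [Nat.testBit_zero]
      have e4 : ∀ i, (2 * r + 1).testBit (i + 1) = r.testBit i := fun i => by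
        rw [Nat.testBit_succ, e2]
      rw [e1, e2, ih]
      refine or_congr (and_congr_right fun _ => ⟨?_, ?_⟩) (and_congr_right fun _ => ⟨?_, ?_⟩)
      · rintro ⟨i', hi', h⟩
        exact ⟨i' + 1, by omega, by rw [e4, h]⟩
      · rintro ⟨i', hi', h⟩
        rcases i' with _ | i'
        · rw [e3] at h; cases h
        · exact ⟨i', by omega, by rw [← e4, h]⟩
      · intro h i' hi'
        rcases i' with _ | i'
        · exact e3
        · rw [e4]; exact h i' (by omega)
      · intro h i' hi'
        rw [← e4]; exact h (i' + 1) (by omega)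

/-- The number of elements of `K` below `x`. -/
noncomputable def rank (K : ℕ → Prop) (x : ℕ) : ℕ := @Nat.count K (Classical.decPred K) x

theorem rank_lt_rank {K : ℕ → Prop} {x y : ℕ} (hx : K x) (hxy : x < y) : rank K x < rank K y := by
  classical
  unfold rank
  exact Nat.count_strict_mono hx hxy

theorem exists_rank_eq {K : ℕ → Prop} {x i : ℕ} (hi : i < rank K x) :
    ∃ y < x, K y ∧ rank K y = i := by
  let := Classical.decPred K
  unfold rank at *
  refine ⟨Nat.nth K i, Nat.nth_lt_of_lt_count hi, ?_, ?_⟩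
  · refine Nat.nth_mem i fun hf => ?_
    exact hi.trans_le (Nat.count_le_card hf x)
  · refine Nat.count_nth fun hf => ?_
    exact hi.trans_le (Nat.count_le_card hf x)

theorem rank_eq_card {n : ℕ} {K : ℕ → Prop} : rank K (n + 1) = (elems n K).card := by
  let := Classical.decPred K
  exact Nat.count_eq_card_filter_range K (n + 1)

/-- `Y` is, below `n + 1`, the subset of `W` with the number `j`. -/
def IsSubset (n : ℕ) (W : ℕ → Prop) (j : ℕ) (Y : ℕ → Prop) : Prop :=
  ∀ x < n + 1, Y x ↔ W x ∧ j.testBit (rank W x) = true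

/-- Bit `i` of `j` records whether the element of `W` of rank `i` belongs to `Y`. -/
theorem exists_isSubset {n m : ℕ} {W Y : ℕ → Prop} (hW : (elems n W).card ≤ m)
    (hY : ∀ x, Y x → W x) : ∃ j < 2 ^ m, IsSubset n W j Y := by
  classical
  refine ⟨Nat.ofBits fun i : Fin m => decide (∃ x, W x ∧ rank W x = i ∧ Y x),
    Nat.ofBits_lt_two_pow _, fun x hx => ?_⟩
  constructor
  · intro hYx
    have hWx := hY x hYx
    refine ⟨hWx, ?_⟩
    have : rank W x < m := (rank_lt_rank hWx hx).trans_le (by rw [rank_eq_card]; exact hW)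
    rw [Nat.testBit_ofBits_lt _ _ this, decide_eq_true_iff]
    exact ⟨x, hWx, rfl, hYx⟩
  · rintro ⟨hWx, hb⟩
    have : rank W x < m := (rank_lt_rank hWx hx).trans_le (by rw [rank_eq_card]; exact hW)
    rw [Nat.testBit_ofBits_lt _ _ this, decide_eq_true_iff] at hb
    obtain ⟨y, hy, hyx, hYy⟩ := hb
    rcases lt_trichotomy x y with h | rfl | h
    · have := rank_lt_rank hWx h; simp only at hyx; omega
    · exact hYy
    · have := rank_lt_rank hy h; simp only at hyx; omega

/-- The ranks of the elements of `rOld` below `x` are exactly the numbers below the rank of `x`, so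
the condition on smaller elements is the carry rule `testBit_add_one`. -/
theorem nextCmd_isSubset {j : ℕ} (h : IsSubset c.n (A.un rOld) j (A.un rDel)) :
    IsSubset c.n (A.un rOld) (j + 1) ((nextCmd.sem c A).un rDel) := by
  intro x hx
  have e : (nextCmd.sem c A).un rDel x ↔ A.un rOld x ∧
      ((A.un rDel x ∧ ∃ y < c.n + 1, y < x ∧ A.un rOld y ∧ ¬ A.un rDel y) ∨
      (¬ A.un rDel x ∧ ∀ y < c.n + 1, y < x → A.un rOld y → A.un rDel y)) := by
    simp [nextCmd, Cmd.sem, assign]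
  rw [e, testBit_add_one]
  refine and_congr_right fun hW => or_congr (and_congr ?_ ⟨?_, ?_⟩) (and_congr ?_ ⟨?_, ?_⟩)
  · rw [h x hx]; exact and_iff_right hW
  · rintro ⟨y, hy, hyx, hWy, hDy⟩
    rw [h y hy] at hDy
    exact ⟨_, rank_lt_rank hWy hyx, Bool.eq_false_iff.2 fun hb => hDy ⟨hWy, hb⟩⟩
  · rintro ⟨i, hi, hb⟩
    obtain ⟨y, hyx, hWy, rfl⟩ := exists_rank_eq hi
    exact ⟨y, by omega, hyx, hWy, by rw [h y (by omega)]; simp [hb]⟩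
  · rw [h x hx, and_iff_right hW, Bool.not_eq_true]
  · intro hall i hi
    obtain ⟨y, hyx, hWy, rfl⟩ := exists_rank_eq hi
    exact ((h y (by omega)).1 (hall y (by omega) hyx hWy)).2
  · intro hall y hy hyx hWy
    exact (h y hy).2 ⟨hWy, hall _ (rank_lt_rank hWy hyx)⟩

/-! ### Compression -/

/-- The set `Sol` of at most `k` elements meets all cycles in `Done`. -/
def IsSol (n k : ℕ) (arc : ℕ → ℕ → Prop) (Done Sol : ℕ → Prop) : Prop :=
  (elems n Sol).card ≤ k ∧ Acyc arc (below n fun x => Done x ∧ ¬ Sol x)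

/-- The elements of `Done` outside `Old` that are of either type. -/
def Typed (T₀ T₁ Done Old : ℕ → Prop) (x : ℕ) : Prop := Done x ∧ ¬ Old x ∧ (T₀ x ∨ T₁ x)

/-- There is a solution that meets `Old` in `Del`. -/
def Extends (n k : ℕ) (arc : ℕ → ℕ → Prop) (T₀ T₁ Done Old Del : ℕ → Prop) : Prop :=
  CanKeep n arc (fun x => Old x ∧ ¬ Del x)
    ((elems n fun x => Typed T₀ T₁ Done Old x ∨ Del x).card - k) (Typed T₀ T₁ Done Old)

/-- Needed because a numbered subset is determined only below `n + 1`. -/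
theorem Extends.congr {n k : ℕ} {arc : ℕ → ℕ → Prop} {T₀ T₁ Done Old Del Del' : ℕ → Prop}
    (h : Extends n k arc T₀ T₁ Done Old Del) (hD : ∀ x < n + 1, Del x ↔ Del' x) :
    Extends n k arc T₀ T₁ Done Old Del' := by
  have e1 : (below n fun x => Old x ∧ ¬ Del x) = below n fun x => Old x ∧ ¬ Del' x := by
    ext x
    refine and_congr_right fun hx => ?_
    show (Old x ∧ ¬ Del x) ↔ (Old x ∧ ¬ Del' x)
    rw [hD x hx]
  have e2 : (elems n fun x => Typed T₀ T₁ Done Old x ∨ Del x) =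
      elems n fun x => Typed T₀ T₁ Done Old x ∨ Del' x := by
    ext x
    simp only [mem_elems]
    exact and_congr_right fun hx => by rw [hD x hx]
  unfold Extends CanKeep at *
  rwa [← e1, ← e2]

/-- The pool is contained in the union of `S` and the typed elements outside `S`, so at least its
size minus `k` many typed elements avoid `S`. As `S` is a solution for the whole tournament, this
holds at every stage, and a stage without success refutes the existence of `S`. -/
theorem Extends.of_solution {n k : ℕ} {arc : ℕ → ℕ → Prop} {T₀ T₁ Done Old : ℕ → Prop}
    {S : Finset ℕ} (hS : S.card ≤ k) (hA : Acyc arc {x | x ∉ S}) :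
    Extends n k arc T₀ T₁ Done Old fun x => Old x ∧ x ∈ S := by
  classical
  set R := Typed T₀ T₁ Done Old
  have hcard : (elems n fun x => R x ∨ Old x ∧ x ∈ S).card ≤ (elems n R \ S).card + k := by
    refine (Finset.card_le_card (t := (elems n R \ S) ∪ S) fun x hx => ?_).trans
      ((Finset.card_union_le _ _).trans (by omega))
    simp only [mem_elems, Finset.mem_union, Finset.mem_sdiff] at hx ⊢
    tauto
  obtain ⟨T, hT, hc⟩ := Finset.exists_subset_card_eq
    (s := elems n R \ S) (n := (elems n fun x => R x ∨ Old x ∧ x ∈ S).card - k) (by omega)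
  refine ⟨T, hc, fun x hx => ?_, hA.mono fun x hx => ?_⟩
  · exact (mem_elems.1 (Finset.mem_sdiff.1 (hT hx)).1).2
  · rcases hx with ⟨_, hx, hx'⟩ | hx
    · exact fun hxS => hx' ⟨hx, hxS⟩
    · exact (Finset.mem_sdiff.1 (hT hx)).2

/-- The cycles in `Done` outside `Pool` without `Free` lie in `Keep` and `Free`. -/
theorem isSol_of_reduced {n k : ℕ} {arc : ℕ → ℕ → Prop} {T₀ T₁ Done Old Del Free : ℕ → Prop}
    (hB : IsBipTournament n arc T₀ T₁)
    (hsub : ∀ x, Free x → Typed T₀ T₁ Done Old x)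
    (hkeep : CanKeep n arc (fun x => Old x ∧ ¬ Del x)
      ((elems n fun x => Typed T₀ T₁ Done Old x ∨ Del x).card - k) Free)
    (hneeded : ∀ x < n + 1, Free x → ¬ CanKeep n arc (fun x => Old x ∧ ¬ Del x)
      ((elems n fun x => Typed T₀ T₁ Done Old x ∨ Del x).card - k) fun y => Free y ∧ y ≠ x) :
    IsSol n k arc Done fun x => (Typed T₀ T₁ Done Old x ∨ Del x) ∧ ¬ Free x := by
  classical
  set Pool := fun x => Typed T₀ T₁ Done Old x ∨ Del x
  obtain ⟨T, hTc, hTF, hTA⟩ := hkeep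
  -- The set `T` alone suffices, so an element of `Free` outside `T` would not be needed. Hence
  -- `Free` equals `T`, and its size is known.
  have hFT : ∀ x, Free x → x ∈ T := by
    intro x hx
    by_contra hxT
    refine hneeded x ((hB.lt (hsub x hx).2.2).trans (Nat.lt_succ_self n)) hx
      ⟨T, hTc, fun y hy => ⟨hTF y hy, ?_⟩, hTA⟩
    rintro rfl
    exact hxT hy
  constructor
  · have : (elems n fun x => Pool x ∧ ¬ Free x) = elems n Pool \ T := by
      ext x
      simp only [mem_elems, Finset.mem_sdiff]
      constructor
      · rintro ⟨h1, h2, h3⟩; exact ⟨⟨h1, h2⟩, fun h => h3 (hTF x h)⟩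
      · rintro ⟨⟨h1, h2⟩, h3⟩; exact ⟨h1, h2, fun h => h3 (hFT x h)⟩
    have hTP : T ⊆ elems n Pool := fun x hx => by
      have := hsub x (hTF x hx)
      exact mem_elems.2 ⟨(hB.lt this.2.2).trans (Nat.lt_succ_self n), .inl this⟩
    rw [this, Finset.card_sdiff_of_subset hTP, hTc]
    omega
  -- Vertices of neither type lie on no arc, so it does no harm that the pool ignores them.
  · have key : ∀ z, T₀ z ∨ T₁ z → z ∈ (below n fun x => Done x ∧ ¬ (Pool x ∧ ¬ Free x)) →
        z ∈ (below n fun x => Old x ∧ ¬ Del x) ∪ (T : Set ℕ) := by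
      rintro z hz ⟨hzn, hD, hP⟩
      by_cases hF : Free z
      · exact .inr (hFT z hF)
      · have hP' : ¬ Pool z := fun h => hP ⟨h, hF⟩
        by_cases hO : Old z
        · exact .inl ⟨hzn, hO, fun h => hP' (.inr h)⟩
        · exact absurd (.inl ⟨hD, hO, hz⟩) hP'
    have ty : ∀ {x y}, arc x y → T₀ x ∨ T₁ x := fun h => (hB.bip h).imp And.left And.left
    intro x hx y hy z hz w hw h1 h2 h3 h4
    exact hTA x (key x (ty h1) hx) y (key y (ty h2) hy) z (key z (ty h3) hz) w (key w (ty h4) hw)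
      h1 h2 h3 h4

/-- The old set meets all cycles, so the candidates outside it are acyclic, as the dynamic program
requires. The decision is repeated after the reduction, whose last answer concerned a different
candidate set; by monotonicity a positive answer for the reduced set implies one for the original
set. -/
theorem tryCmd_sem (hB : IsBipTournament c.n (A.bin rArc) (A.un rEnd) (A.un rMid))
    (hA : Acyc (A.bin rArc) (below c.n fun x => A.un rDone x ∧ ¬ A.un rOld x)) :
    (Extends c.n c.k (A.bin rArc) (A.un rEnd) (A.un rMid) (A.un rDone) (A.un rOld) (A.un rDel) →
      tryCmd.sem c A rFound [] ∧
      IsSol c.n c.k (A.bin rArc) (A.un rDone) ((tryCmd.sem c A).un rSol)) ∧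
    (¬ Extends c.n c.k (A.bin rArc) (A.un rEnd) (A.un rMid) (A.un rDone) (A.un rOld)
        (A.un rDel) →
      tryCmd.sem c A rFound = A rFound ∧ tryCmd.sem c A rSol = A rSol) := by
  set arc := A.bin rArc with harc
  set T₀ := A.un rEnd with hT₀
  set T₁ := A.un rMid with hT₁
  set Done := A.un rDone with hDone
  set Old := A.un rOld with hOld
  set Del := A.un rDel with hDel
  set B := Cmd.sem c (.upd rPool [0] (.or (.rel rFree [0]) (.rel rDel [0])))
    (Cmd.sem c (.upd rFree [0] (.and (.rel rDone [0]) (.and (.neg (.rel rOld [0]))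
      (.or (.rel rEnd [0]) (.rel rMid [0])))))
    (Cmd.sem c (.upd rKeep [0] (.and (.rel rOld [0]) (.neg (.rel rDel [0])))) A)) with hBdef
  have hBne : ∀ a, a ∉ [rPool, rFree, rKeep] → B a = A a := by
    intro a ha
    simp only [List.mem_cons, not_or, List.not_mem_nil, not_false_eq_true, and_true] at ha
    rw [hBdef, Cmd.sem_of_notMem, Cmd.sem_of_notMem, Cmd.sem_of_notMem] <;>
      simp only [Cmd.writes, List.mem_singleton]
    · exact ha.2.2
    · exact ha.2.1
    · exact ha.1
  have bArc : B.bin rArc = arc := by unfold Rels.bin; rw [hBne _ (by decide)]; rfl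
  have bEnd : B.un rEnd = T₀ := by unfold Rels.un; rw [hBne _ (by decide)]; rfl
  have bMid : B.un rMid = T₁ := by unfold Rels.un; rw [hBne _ (by decide)]; rfl
  have bKeep : B.un rKeep = fun x => Old x ∧ ¬ Del x := by
    funext x
    simp [hBdef, hOld, hDel, Cmd.sem, assign]
  have bFree : B.un rFree = Typed T₀ T₁ Done Old := by
    funext x
    simp [hBdef, hOld, hDone, hT₀, hT₁, Typed, Cmd.sem, assign]
  have bPool : B.un rPool = fun x => Typed T₀ T₁ Done Old x ∨ Del x := by
    funext x
    simp [hBdef, hOld, hDone, hDel, hT₀, hT₁, Typed, Cmd.sem, assign]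
  have hRB : Acyc (B.bin rArc) (below c.n (B.un rFree)) := by
    rw [bArc, bFree]
    exact hA.mono fun x hx => ⟨hx.1, hx.2.1, hx.2.2.1⟩
  have hRT : ∀ x, B.un rFree x → B.un rEnd x ∨ B.un rMid x := by
    rw [bFree, bEnd, bMid]; exact fun x hx => hx.2.2
  have hBB : IsBipTournament c.n (B.bin rArc) (B.un rEnd) (B.un rMid) := by
    rw [bArc, bEnd, bMid]; exact hB
  obtain ⟨hsame, -, hsub, hkeep, hneeded⟩ := reduceCmd_inv hBB hRB hRT
  rw [bArc, bKeep, bPool] at hkeep hneeded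
  rw [bFree] at hkeep
  set C := reduceCmd.sem c B with hC
  set s := (elems c.n fun x => Typed T₀ T₁ Done Old x ∨ Del x).card - c.k with hs
  have hsub' : ∀ x, C.un rFree x → Typed T₀ T₁ Done Old x := fun x hx => by
    rw [← bFree]; exact hsub x hx
  set D := Cmd.sem c (.upd rCand [0] (.rel rFree [0])) C with hD
  have hDne : ∀ a, a ≠ rCand → D a = C a := fun a ha =>
    Cmd.sem_of_notMem (by simpa [Cmd.writes] using ha) C
  simp only [List.forall_mem_cons] at hsame
  obtain ⟨s1, s2, s3, s4, s5, -⟩ := hsame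
  have dArc : D.bin rArc = arc := by
    rw [← bArc]; unfold Rels.bin; rw [hDne _ (by decide), s1]
  have dEnd : D.un rEnd = T₀ := by rw [← bEnd]; unfold Rels.un; rw [hDne _ (by decide), s2]
  have dMid : D.un rMid = T₁ := by rw [← bMid]; unfold Rels.un; rw [hDne _ (by decide), s3]
  have dKeep : D.un rKeep = fun x => Old x ∧ ¬ Del x := by
    rw [← bKeep]; unfold Rels.un; rw [hDne _ (by decide), s4]
  have dPool : D.un rPool = fun x => Typed T₀ T₁ Done Old x ∨ Del x := by
    rw [← bPool]; unfold Rels.un; rw [hDne _ (by decide), s5]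
  have dCand : D.un rCand = C.un rFree := by
    funext x
    simp [hD, Cmd.sem, assign]
  have hres : decideCmd.sem c D rRes [] ↔ CanKeep c.n arc (fun x => Old x ∧ ¬ Del x) s
      (C.un rFree) := by
    have := decideCmd_res (c := c) (A := D) (by rw [dArc, dEnd, dMid]; exact hB)
      (by
        rw [dArc, dCand]
        exact hA.mono fun x hx => ⟨hx.1, (hsub' x hx.2).1, (hsub' x hx.2).2.1⟩)
      (by rw [dEnd, dMid, dCand]; exact fun x hx => (hsub' x hx).2.2)
    rwa [dArc, dKeep, dPool, dCand] at this
  have htry : tryCmd.sem c A = Cmd.sem c (.ite (.rel rRes [])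
    (.seq (.upd rSol [0] (.and (.rel rPool [0]) (.neg (.rel rFree [0]))))
      (.upd rFound [] (.neg .fls))) .skip) (decideCmd.sem c D) := rfl
  set E := decideCmd.sem c D with hE
  constructor
  · intro hext
    have hk := hkeep hext
    rw [htry, Cmd.sem_ite_pos (by simpa using hres.2 hk)]
    refine ⟨?_, ?_⟩
    · simp [Cmd.sem, assign]
    · have : Rels.un (Cmd.sem c (.seq (.upd rSol [0] (.and (.rel rPool [0])
          (.neg (.rel rFree [0])))) (.upd rFound [] (.neg .fls))) E) rSol =
          fun x => (Typed T₀ T₁ Done Old x ∨ Del x) ∧ ¬ C.un rFree x := by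
        have e1 : E.un rPool = fun x => Typed T₀ T₁ Done Old x ∨ Del x := by
          rw [← dPool]; unfold Rels.un; rw [hE, Cmd.sem_of_notMem (by decide)]
        have e2 : E.un rFree = C.un rFree := by
          unfold Rels.un; rw [hE, Cmd.sem_of_notMem (by decide), hDne _ (by decide)]
        rw [← e2]
        funext x
        have e1 := congrFun e1 x
        simp only [Rels.un, rPool] at e1
        simp [Cmd.sem, assign, e1]
      rw [this]
      exact isSol_of_reduced hB hsub' hk hneeded
  · intro hext
    have hk : ¬ E rRes [] := fun h => hext ((hres.1 h).mono hsub')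
    rw [htry, Cmd.sem_ite_neg (by simpa using hk), Cmd.sem_skip]
    refine ⟨?_, ?_⟩
    · rw [hE, Cmd.sem_of_notMem (by decide), hDne _ (by decide), hC,
        Cmd.sem_of_notMem (by decide), hBne _ (by decide)]
    · rw [hE, Cmd.sem_of_notMem (by decide), hDne _ (by decide), hC,
        Cmd.sem_of_notMem (by decide), hBne _ (by decide)]

end STVD

namespace STVD

/-! ### Correctness of the search and of iterative compression -/

variable {c : Ctx} {A B : Rels}

/-- Some set of at most `k` elements meets all cycles. -/
def HasSol (k : ℕ) (arc : ℕ → ℕ → Prop) : Prop :=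
  ∃ S : Finset ℕ, S.card ≤ k ∧ Acyc arc {x | x ∉ S}

/-- The state of the search after the first `j` subsets of `rOld`. -/
structure SearchInv (c : Ctx) (B : Rels) (j : ℕ) (A : Rels) : Prop where
  same : ∀ a ∈ [rArc, rEnd, rMid, rOld, rDone, rFail], A a = B a
  del : IsSubset c.n (B.un rOld) j (A.un rDel)
  sol : A rFound [] → IsSol c.n c.k (B.bin rArc) (B.un rDone) (A.un rSol)
  found : ∀ j' < j, ∀ Y, IsSubset c.n (B.un rOld) j' Y →
    Extends c.n c.k (B.bin rArc) (B.un rEnd) (B.un rMid) (B.un rDone) (B.un rOld) Y → A rFound []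

/-- A failed trial changes neither the flag nor the recorded solution, and a successful one sets the
flag together with a valid solution. So later trials never spoil an earlier success. -/
theorem SearchInv.step (hB : IsBipTournament c.n (B.bin rArc) (B.un rEnd) (B.un rMid))
    (hD : Acyc (B.bin rArc) (below c.n fun x => B.un rDone x ∧ ¬ B.un rOld x)) {j : ℕ}
    (h : SearchInv c B j A) :
    SearchInv c B (j + 1) ((Cmd.seq tryCmd nextCmd).sem c A) := by
  obtain ⟨hsame, hdel, hsol, hfound⟩ := h
  have hs := hsame
  simp only [List.forall_mem_cons] at hs
  obtain ⟨s1, s2, s3, s4, s5, -⟩ := hs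
  have aArc : A.bin rArc = B.bin rArc := by unfold Rels.bin; rw [s1]
  have aEnd : A.un rEnd = B.un rEnd := by unfold Rels.un; rw [s2]
  have aMid : A.un rMid = B.un rMid := by unfold Rels.un; rw [s3]
  have aOld : A.un rOld = B.un rOld := by unfold Rels.un; rw [s4]
  have aDone : A.un rDone = B.un rDone := by unfold Rels.un; rw [s5]
  have htry := tryCmd_sem (c := c) (A := A) (by rw [aArc, aEnd, aMid]; exact hB)
    (by rw [aArc, aOld, aDone]; exact hD)
  rw [aArc, aEnd, aMid, aOld, aDone] at htry
  set C := tryCmd.sem c A with hC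
  have hnF : nextCmd.sem c C rFound = C rFound := Cmd.sem_of_notMem (by decide) C
  have hnS : (nextCmd.sem c C).un rSol = C.un rSol := by
    unfold Rels.un; rw [Cmd.sem_of_notMem (by decide)]
  have cOld : C.un rOld = B.un rOld := by
    rw [← aOld]; unfold Rels.un; rw [hC, Cmd.sem_of_notMem (by decide)]
  have cDel : C.un rDel = A.un rDel := by
    unfold Rels.un; rw [hC, Cmd.sem_of_notMem (by decide)]
  rw [Cmd.sem_seq, ← hC]
  refine ⟨?_, ?_, ?_, ?_⟩
  · intro a ha
    rw [← hsame a ha, Cmd.sem_of_notMem, hC, Cmd.sem_of_notMem]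
    · revert a; decide
    · revert a; decide
  · have := nextCmd_isSubset (c := c) (A := C) (j := j) (by rw [cOld, cDel]; exact hdel)
    rwa [cOld] at this
  · rw [hnF, hnS]
    intro hf
    by_cases hext : Extends c.n c.k (B.bin rArc) (B.un rEnd) (B.un rMid) (B.un rDone)
      (B.un rOld) (A.un rDel)
    · exact (htry.1 hext).2
    · obtain ⟨h1, h2⟩ := htry.2 hext
      have : C.un rSol = A.un rSol := by unfold Rels.un; rw [h2]
      rw [this]
      exact hsol (by rwa [← h1])
  · rw [hnF]
    intro j' hj' Y hY hext
    by_cases hextA : Extends c.n c.k (B.bin rArc) (B.un rEnd) (B.un rMid) (B.un rDone)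
      (B.un rOld) (A.un rDel)
    · exact (htry.1 hextA).1
    · rw [(htry.2 hextA).1]
      rcases Nat.lt_succ_iff_lt_or_eq.1 hj' with hlt | rfl
      · exact hfound j' hlt Y hY hext
      · exact absurd (hext.congr fun x hx => (hY x hx).trans (hdel x hx).symm) hextA

/-- The state of the algorithm after the first `i` vertices. -/
structure CompressInv (c : Ctx) (arc : ℕ → ℕ → Prop) (T₀ T₁ : ℕ → Prop) (i : ℕ) (A : Rels) :
    Prop where
  arc_eq : A.bin rArc = arc
  end_eq : A.un rEnd = T₀
  mid_eq : A.un rMid = T₁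
  done : ∀ x < c.n + 1, A.un rDone x ↔ x < i
  fail : A rFail [] → ¬ HasSol c.k arc
  sol : ¬ A rFail [] → IsSol c.n c.k arc (A.un rDone) (A.un rSol)

/-- The previous solution with the new vertex `i` meets all cycles in the enlarged set and has at
most `k + 1` elements, so `2 ^ (k + 1)` trials exhaust its subsets. If a solution `S` exists, the
trial that deletes its intersection with the old set succeeds. Once the failure flag is set it
stays, and the recorded solution no longer matters. -/
theorem CompressInv.step {arc : ℕ → ℕ → Prop} {T₀ T₁ : ℕ → Prop}
    (hB : IsBipTournament c.n arc T₀ T₁) {i : ℕ} (hi : i < c.n + 1)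
    (h : CompressInv c arc T₀ T₁ i A) :
    CompressInv c arc T₀ T₁ (i + 1) (compressCmd.sem c A) := by
  classical
  obtain ⟨h1, h2, h3, hdone, hfail, hsol⟩ := h
  have hall : ∀ x < c.n + 1, (∀ y < c.n + 1, y < x → A.un rDone y) ↔ x < i + 1 := by
    intro x hx
    constructor
    · intro h
      by_contra hxi
      exact absurd ((hdone i hi).1 (h i hi (by omega))) (lt_irrefl i)
    · intro h y hy hyx
      exact (hdone y hy).2 (by omega)
  set B := Cmd.sem c (.upd rDel [0] .fls) (Cmd.sem c (.upd rFound [] .fls)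
    (Cmd.sem c (.upd rDone [0] (.all 1 (.imp (.lt 1 0) (.rel rDone [1]))))
    (Cmd.sem c (.upd rOld [0] (.or (.rel rSol [0])
      (.and (.neg (.rel rDone [0])) (.all 1 (.imp (.lt 1 0) (.rel rDone [1])))))) A)))
    with hBdef
  have hBne : ∀ a, a ∉ [rOld, rDone, rFound, rDel] → B a = A a := by
    intro a ha
    simp only [List.mem_cons, not_or, List.not_mem_nil, not_false_eq_true, and_true] at ha
    rw [hBdef, Cmd.sem_of_notMem, Cmd.sem_of_notMem, Cmd.sem_of_notMem, Cmd.sem_of_notMem] <;>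
      simp only [Cmd.writes, List.mem_singleton]
    · exact ha.1
    · exact ha.2.1
    · exact ha.2.2.1
    · exact ha.2.2.2
  have bArc : B.bin rArc = arc := by unfold Rels.bin; rw [hBne _ (by decide)]; exact h1
  have bEnd : B.un rEnd = T₀ := by unfold Rels.un; rw [hBne _ (by decide)]; exact h2
  have bMid : B.un rMid = T₁ := by unfold Rels.un; rw [hBne _ (by decide)]; exact h3
  have bFail : B rFail = A rFail := hBne _ (by decide)
  have bOld : ∀ x < c.n + 1, B.un rOld x ↔ A.un rSol x ∨ x = i := by
    intro x hx
    have : B.un rOld x ↔ A.un rSol x ∨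
        (¬ A.un rDone x ∧ ∀ y < c.n + 1, y < x → A.un rDone y) := by
      simp [hBdef, Cmd.sem, assign]
    rw [this, hdone x hx, hall x hx]
    exact or_congr_right (by omega)
  have bDone : ∀ x < c.n + 1, B.un rDone x ↔ x < i + 1 := by
    intro x hx
    rw [← hall x hx]
    simp [hBdef, Cmd.sem, assign]
  have bFound : ¬ B rFound [] := by simp [hBdef, Cmd.sem, assign]
  have bDel : ∀ x, ¬ B.un rDel x := fun x => by simp [hBdef, Cmd.sem, assign]
  have hcomp : compressCmd.sem c A =
      Cmd.sem c (.ite (.rel rFound []) .skip (.upd rFail [] (.neg .fls)))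
        (((Cmd.seq tryCmd nextCmd).sem c)^[2 ^ (c.k + 1)] B) := rfl
  set C := ((Cmd.seq tryCmd nextCmd).sem c)^[2 ^ (c.k + 1)] B with hC
  have hCne : ∀ a ∈ [rArc, rEnd, rMid, rDone, rFail], C a = B a := fun a ha =>
    iterate_apply_eq (fun A => Cmd.sem_of_notMem (by revert a; decide) A) _ _
  have hne : ∀ a, a ≠ rFail → compressCmd.sem c A a = C a := by
    intro a ha
    rw [hcomp]
    exact Cmd.sem_of_notMem (by simpa [Cmd.writes] using ha) C
  have dDone : (compressCmd.sem c A).un rDone = B.un rDone := by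
    unfold Rels.un; rw [hne _ (by decide), hCne _ (by decide)]
  have dSol : (compressCmd.sem c A).un rSol = C.un rSol := by
    unfold Rels.un; rw [hne _ (by decide)]
  have cFail : C rFail = A rFail := (hCne _ (by decide)).trans bFail
  have dFail : compressCmd.sem c A rFail [] ↔ A rFail [] ∨ ¬ C rFound [] := by
    rw [hcomp]
    by_cases hf : C rFound []
    · rw [Cmd.sem_ite_pos (by simpa using hf), Cmd.sem_skip, cFail]
      simp [hf]
    · rw [Cmd.sem_ite_neg (by simpa using hf)]
      simp [Cmd.sem, assign, hf]
  have hinv : ¬ A rFail [] → SearchInv c B (2 ^ (c.k + 1)) C := by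
    intro hF
    have hBB : IsBipTournament c.n (B.bin rArc) (B.un rEnd) (B.un rMid) := by
      rw [bArc, bEnd, bMid]; exact hB
    have hD : Acyc (B.bin rArc) (below c.n fun x => B.un rDone x ∧ ¬ B.un rOld x) := by
      rw [bArc]
      refine (hsol hF).2.mono ?_
      rintro x ⟨hx, hx1, hx2⟩
      rw [bDone x hx] at hx1
      rw [bOld x hx, not_or] at hx2
      exact ⟨hx, (hdone x hx).2 (by omega), hx2.1⟩
    rw [hC]
    generalize 2 ^ (c.k + 1) = m
    induction m with
    | zero =>
      exact ⟨fun _ _ => rfl, fun x _ => iff_of_false (bDel x) (by simp), fun h => absurd h bFound,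
        fun j hj => absurd hj (Nat.not_lt_zero j)⟩
    | succ m ih =>
      rw [Function.iterate_succ_apply']
      exact ih.step hBB hD
  refine ⟨?_, ?_, ?_, ?_, ?_, ?_⟩
  · rw [← bArc]; unfold Rels.bin; rw [hne _ (by decide), hCne _ (by decide)]
  · rw [← bEnd]; unfold Rels.un; rw [hne _ (by decide), hCne _ (by decide)]
  · rw [← bMid]; unfold Rels.un; rw [hne _ (by decide), hCne _ (by decide)]
  · rw [dDone]; exact bDone
  · rw [dFail]
    rintro hF ⟨S, hS, hA⟩
    by_cases hF' : A rFail []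
    · exact hfail hF' ⟨S, hS, hA⟩
    · refine hF.elim hF' fun hf => hf ?_
      have hcard : (elems c.n (B.un rOld)).card ≤ c.k + 1 := by
        refine (Finset.card_le_card (t := insert i (elems c.n (A.un rSol))) fun x hx => ?_).trans
          ((Finset.card_insert_le _ _).trans (Nat.succ_le_succ (hsol hF').1))
        rw [mem_elems] at hx
        rw [Finset.mem_insert, mem_elems]
        rcases (bOld x hx.1).1 hx.2 with h | h
        · exact .inr ⟨hx.1, h⟩
        · exact .inl h
      obtain ⟨j, hj, hY⟩ := exists_isSubset (Y := fun x => B.un rOld x ∧ x ∈ S) hcard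
        fun x hx => hx.1
      refine (hinv hF').found j hj _ hY (Extends.of_solution hS ?_)
      rw [bArc]; exact hA
  · rw [dFail, not_or, not_not, dDone, dSol]
    rintro ⟨hF, hf⟩
    have := (hinv hF).sol hf
    rwa [bArc] at this

/-- After `n + 1` stages all vertices are admitted, and unless failure has been flagged, the
recorded solution meets every cycle. The extra number `n` is harmless, since arcs join only numbers
below `n`. -/
theorem mainCmd_rFail {n k : ℕ} {G : SimpleGraph (Fin n)} {cell : ℕ → Prop} (hG : IsSplit G)
    (hcell : ∀ u v : Fin n, cell (u * n + v) ↔ G.Adj u v) :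
    mainCmd.sem ⟨n, k, cell⟩ (fun _ _ => False) rFail [] ↔ ¬ IsYesInstance G k := by
  classical
  set c : Ctx := ⟨n, k, cell⟩ with hc
  have hB := isBipTournament_pathArc hG
  obtain ⟨h1, h2, h3⟩ := arcCmd_sem (k := k) hcell fun _ _ => False
  have key : ∀ i ≤ n + 1, CompressInv c (PathArc n (natAdj G)) (IsEnd n (natAdj G))
      (IsMid n (natAdj G)) i ((compressCmd.sem c)^[i] (arcCmd.sem c fun _ _ => False)) := by
    intro i
    induction i with
    | zero =>
      have hDone : ∀ x, ¬ (arcCmd.sem c fun _ _ => False) rDone [x] := fun x => by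
        rw [Cmd.sem_of_notMem (by decide)]; exact id
      have hSol : ∀ x, ¬ (arcCmd.sem c fun _ _ => False) rSol [x] := fun x => by
        rw [Cmd.sem_of_notMem (by decide)]; exact id
      have hFail : ¬ (arcCmd.sem c fun _ _ => False) rFail [] := by
        rw [Cmd.sem_of_notMem (by decide)]; exact id
      refine fun _ => ⟨h3, h2, h1, fun x _ => ?_, fun h => absurd h hFail, fun _ => ⟨?_, ?_⟩⟩
      · exact iff_of_false (hDone x) (Nat.not_lt_zero x)
      · rw [Finset.card_eq_zero.2]
        · exact Nat.zero_le _
        · exact Finset.eq_empty_of_forall_notMem fun x hx => hSol x (mem_elems.1 hx).2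
      · exact fun x hx => absurd hx.2.1 (hDone x)
    | succ i ih =>
      intro hi
      rw [Function.iterate_succ_apply']
      exact (ih (by omega)).step hB (by simpa [hc] using hi)
  have hfin := key (n + 1) le_rfl
  have hmain : mainCmd.sem c (fun _ _ => False) =
    (compressCmd.sem c)^[n + 1] (arcCmd.sem c fun _ _ => False) := rfl
  rw [hmain, isYesInstance_iff hG]
  set D := (compressCmd.sem c)^[n + 1] (arcCmd.sem c fun _ _ => False)
  refine ⟨hfin.fail, fun h => ?_⟩
  by_contra hF
  obtain ⟨hcard, hA⟩ := hfin.sol hF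
  refine h ⟨elems n (D.un rSol), hcard, ?_⟩
  have inb : ∀ {x y}, PathArc n (natAdj G) x y → x ∉ elems n (D.un rSol) →
      x ∈ below c.n fun x => D.un rDone x ∧ ¬ D.un rSol x := by
    intro x y hxy hx
    have hx' : x < n + 1 := (hB.lt_left hxy).trans (Nat.lt_succ_self n)
    exact ⟨hx', (hfin.done x hx').2 hx', fun hs => hx (mem_elems.2 ⟨hx', hs⟩)⟩
  intro x hx y hy z hz w hw g1 g2 g3 g4
  exact hA x (inb g1 hx) y (inb g2 hy) z (inb g3 hz) w (inb g4 hw) g1 g2 g3 g4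

end STVD

namespace STVD

/-! ### The program and its running time -/

/-- Since `2.733 = 2 * 1.3665`, it suffices to bound `k + 1` by `3 * 1.3665 ^ k`; this is
Bernoulli's inequality, because `3 * 0.3665 > 1`. The remaining factor two comes from `2 ^ (k + 1)`.
-/
theorem expFactor_le (k : ℕ) : (expFactor k : ℝ) ≤ 6 * 2.733 ^ k := by
  have h1 : 1 + (k : ℝ) * 0.3665 ≤ (1 + 0.3665) ^ k :=
    one_add_mul_le_pow (by norm_num) k
  have h2 : (2.733 : ℝ) ^ k = 2 ^ k * (1 + 0.3665) ^ k := by rw [← mul_pow]; norm_num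
  have h3 : (0 : ℝ) < 2 ^ k := by positivity
  have h4 : (k : ℝ) + 1 ≤ 3 * (1 + 0.3665) ^ k := by
    have : (0 : ℝ) ≤ k := k.cast_nonneg
    linarith
  rw [h2, expFactor]
  push_cast
  rw [pow_succ]
  nlinarith [mul_le_mul_of_nonneg_left h4 h3.le]

/-- The program: it moves the input to its place, runs the algorithm and reports the outcome. -/
def solver : Prog :=
  .seq (.copy 2 1) (.seq (.copy 1 0) (.seq (.inc 1) (.seq (mainCmd.compile 0)
    (.seq ((Fm.rel rFail []).compile 0) (.ite (.lt 5 3) (.const 0 0) (.const 0 1))))))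

/-- The entries of the adjacency matrix, row by row. -/
def matrixCell {n : ℕ} (G : SimpleGraph (Fin n)) (i : ℕ) : Prop :=
  ∃ u v : Fin n, (u : ℕ) * n + (v : ℕ) = i ∧ G.Adj u v

theorem matrixCell_iff {n : ℕ} (G : SimpleGraph (Fin n)) (u v : Fin n) :
    matrixCell G (u * n + v) ↔ G.Adj u v := by
  refine ⟨?_, fun h => ⟨u, v, rfl, h⟩⟩
  rintro ⟨u', v', h, hadj⟩
  have hn : 0 < n := u.pos
  have h1 : (u' : ℕ) = u := by
    have := congrArg (· / n) h
    simpa [Nat.mul_comm _ n, Nat.mul_add_div hn, Nat.div_eq_of_lt] using this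
  have h2 : (v' : ℕ) = v := by rw [h1] at h; omega
  rwa [Fin.ext h1, Fin.ext h2] at hadj

/-- The state is the one after the first three instructions of `solver`: register `1`, which holds
the budget in the input, is wanted for `n + 1`. -/
theorem repr_initState {n : ℕ} (G : SimpleGraph (Fin n)) (k : ℕ) :
    Repr ⟨n, k, matrixCell G⟩ (fun _ _ => False) (fun _ => 0)
      ((((initState G k).setReg 2 k).setReg 1 n).setReg 1 (n + 1)) where
  hn := by simp [initState]
  hN := by simp
  hk := by simp
  hz := by simp [initState]
  hv x := by simp [initState, vr]
  hcell i := by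
    constructor
    · intro h
      simp only [State.setReg_arr, initState]
      exact if_pos ⟨rfl, h⟩
    · intro h
      simp only [State.setReg_arr, initState]
      exact if_neg fun h' => h h'.2
  hrel a l _ _ := ⟨False.elim, fun _ => by simp [initState]⟩

theorem solver_runs : ∃ P Q : Polynomial ℕ, ∀ (n : ℕ) (G : SimpleGraph (Fin n)) (k : ℕ),
    IsSplit G → Runs solver (initState G k)
      (P.eval (n + 1) * expFactor k + Q.eval (n + 1) + 5) fun τ =>
        (IsYesInstance G k → τ.reg 0 = 1) ∧ (¬ IsYesInstance G k → τ.reg 0 = 0) := by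
  obtain ⟨P, hP⟩ := mainCmd.compile_runs 0
  obtain ⟨Q, hQ⟩ := (Fm.rel rFail []).compile_runs 0
  refine ⟨P, Q, fun n G k hG => ?_⟩
  -- Only the search over subsets uses `rept`, so the exponential factor occurs just once.
  have hdepth : mainCmd.depth = 1 := rfl
  refine Runs.mono (T := 1 + (1 + (1 + (P.eval (n + 1) * expFactor k ^ mainCmd.depth +
    (Q.eval (n + 1) + (1 + 1)))))) ?_ (by rw [hdepth, pow_one]; omega) fun _ h => h
  refine Runs.seq (Runs.copy (Runs.seq (Runs.copy (Runs.seq (Runs.inc (Runs.seq ?_))))))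
  have hrep := repr_initState G k
  refine (hP _ _ _ hrep).mono le_rfl fun τ hτ => Runs.seq ?_
  refine (hQ _ _ _ _ (fun _ => Nat.succ_pos _) hτ.1).mono le_rfl fun υ hυ => ?_
  have hiff := hυ.holds hτ.1.hz
  rw [Fm.ev_rel, List.map_nil, mainCmd_rFail hG (matrixCell_iff G)] at hiff
  refine Runs.ite (fun h => Runs.const ?_) fun h => Runs.const ?_
  · have := (hiff.1 h).2
    exact ⟨fun h' => absurd h' this, fun _ => by simp⟩
  · have : IsYesInstance G k := by
      by_contra h'
      exact h (hiff.2 ⟨rfl, h'⟩)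
    exact ⟨fun _ => by simp, fun h' => absurd this h'⟩

end STVD

theorem mainTheorem2 : STVD.SolvableInOStar 2.733 := by
  obtain ⟨P, Q, h⟩ := STVD.solver_runs
  refine ⟨STVD.solver, (6 * P + Q + 5).comp (Polynomial.X + 1), fun n G k hG => ?_⟩
  obtain ⟨t, τ, h1, h2, h3⟩ := h n G k hG
  refine ⟨t, τ, h1, ?_, h3⟩
  have e : ((6 * P + Q + 5).comp (Polynomial.X + 1)).eval n =
      6 * P.eval (n + 1) + Q.eval (n + 1) + 5 := by
    simp [Polynomial.eval_comp]
  have h2' : (t : ℝ) ≤ (P.eval (n + 1) : ℕ) * (STVD.expFactor k : ℕ) + (Q.eval (n + 1) : ℕ) + 5 := by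
    exact_mod_cast h2
  have h4 : (1 : ℝ) ≤ 2.733 ^ k := one_le_pow₀ (by norm_num)
  have h5 := mul_le_mul_of_nonneg_left (STVD.expFactor_le k)
    ((P.eval (n + 1)).cast_nonneg (α := ℝ))
  have h6 := mul_le_mul_of_nonneg_left h4
    (add_nonneg ((Q.eval (n + 1)).cast_nonneg (α := ℝ)) (by norm_num : (0 : ℝ) ≤ 5))
  beta_reduce
  rw [e]
  push_cast
  linarith
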